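/- Let $n\ge 2$. Let $W:\mathbb R\to\mathbb R$ be of class $C^{4,\beta}$ for some $0<\beta<1$, $1$-periodic, $W=0$ on $\mathbb Z$, $W>0$ on $\mathbb R\setminus\mathbb Z$, $W''(0)>0$. Let $\phi\in C^{1,1}(\mathbb R)$ (bounded, with bounded Lipschitz derivative) be the layer solution: $$C_n\,\mathrm{P.V.}\!\int_{\mathbb R}\frac{\phi(\xi+y)-\phi(\xi)}{|y|^2}\,dy=W'(\phi(\xi))\ \ (\xi\in\mathbb R),\qquad \dot\phi>0,\qquad \phi(-\infty)=0,\ \phi(+\infty)=1,\ \phi(0)=\tfrac12,$$ where $C_n=\int_{\mathbb R^{n-1}}(|y|^2+1)^{-\frac{n+1}2}dy$. Let $t_0\in\mathbb R$, $h>0$, and for $t\in[t_0,t_0+h]$ let $\Omega_t\subset\mathbb R^n$ be nonempty open sets, bounded uniformly in $t$, with boundary $\Gamma_t$. Let $\tilde d(t,x)=\operatorname{dist}(x,\Gamma_t)$ for $x\in\Omega_t$ and $\tilde d(t,x)=-\operatorname{dist}(x,\Gamma_t)$ otherwise, and put $Q_r=\{(t,x)\in[t_0,t_0+h]\times\mathbb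 R^n:|\tilde d(t,x)|\le r\}$. Let $\rho>0$ be such that $\tilde d$ is smooth on $Q_{2\rho}$ (in particular the $\Gamma_t$ are smooth), and let $\eta:[t_0,t_0+h]\times\mathbb R^n\to[0,1]$ be smooth with $\eta=1$ where $|\tilde d|\le\rho$ and $\eta=0$ where $|\tilde d|\ge2\rho$. Let $d=\tilde d$ on $Q_\rho$, $d=\tilde d\,\eta+2\rho(1-\eta)$ where $\rho<\tilde d<2\rho$, $d=\tilde d\,\eta-2\rho(1-\eta)$ where $-2\rho<\tilde d<-\rho$, $d=2\rho$ where $\tilde d\ge2\rho$, and $d=-2\rho$ where $\tilde d\le-2\rho$. For $0<\gamma<1$ and $0<\varepsilon<1$ define $$a_\varepsilon(\xi;t,x)=\int_{\{|z|<\gamma/\varepsilon\}}\Big(\phi\Big(\xi+\frac{d(t,x+\varepsilon z)-d(t,x)}{\varepsilon}\Big)-\phi\big(\xi+\nabla d(t,x)\cdot z\big)\Big)\frac{dz}{|z|^{n+1}},$$ $$\bar a_\varepsilon(t,x)=\frac1{\varepsilon|\ln\varepsilon|}\int_{\mathbb R}a_\varepsilon(\xi;t,x)\,\dot\phi(\xi)\,d\xi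 .$$ Dots denote derivatives in $\xi$, $\nabla$ and $\nabla_x$ are gradients in $x$, and $\partial_t$ is one-sided at the endpoints of $[t_0,t_0+h]$. Then there is a constant $C>0$, independent of $\gamma,\varepsilon,\xi,t,x$, such that for every $\gamma\in(0,1)$ the following hold. 1. For all $\varepsilon\in(0,\tfrac12]$ and $(\xi,t,x)\in\mathbb R\times[t_0,t_0+h]\times\mathbb R^n$, the integrals defining $a_\varepsilon$ and $\bar a_\varepsilon$ converge absolutely, $a_\varepsilon$ is $C^2$ in $\xi$, and if $\nabla d(t,x)\ne0$, then $$|a_\varepsilon(\xi;t,x)|,\ |\dot a_\varepsilon(\xi;t,x)|,\ |\ddot a_\varepsilon(\xi;t,x)|\le\frac{C\varepsilon|\ln\varepsilon|}{|\nabla d(t,x)|},\qquad |\bar a_\varepsilon(t,x)|\le\frac{C}{|\nabla d(t,x)|}.$$ 2. For all $\varepsilon\in(0,\tfrac12]$, $\xi\in\mathbb R$ and $(t,x)\in Q_\rho$, the following derivatives exist and satisfy $$|\partial_ta_\varepsilon(\xi;t,x)|,\ |\nabla_xa_\varepsilon(\xi;t,x)|,\ |\nabla_x\dot a_\varepsilon(\xi;t,x)|\le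 C,\qquad |\partial_t\bar a_\varepsilon(t,x)|,\ |\nabla_x\bar a_\varepsilon(t,x)|\le\frac{C}{\varepsilon|\ln\varepsilon|}.$$ 3. There is $\varepsilon_0=\varepsilon_0(\gamma)>0$ such that for all $0<\varepsilon<\varepsilon_0$, $\xi\in\mathbb R$ and $(t,x)\in Q_\rho$, $$|a_\varepsilon(\xi;t,x)|\le\frac{C\gamma}{1+|\xi|}.$$ -/

import Mathlib

open Set Filter Topology MeasureTheory
open scoped ContDiff NNReal

noncomputable section

namespace Dislocation

/-- Multi-well potentials: `W` is one-periodic, of class `C^{4,β}` for some `0 < β < 1`, vanishes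
exactly on the integers, is positive elsewhere, and `W''(0) > 0`. (Boundedness of the derivatives
is automatic by periodicity.) -/
structure IsMultiWell (W : ℝ → ℝ) : Prop where
  contDiff : ContDiff ℝ 4 W
  holder : ∃ β K : ℝ≥0, 0 < β ∧ β < 1 ∧ HolderWith K β (iteratedDeriv 4 W)
  periodic : ∀ u, W (u + 1) = W u
  zero_int : ∀ k : ℤ, W k = 0
  pos : ∀ u : ℝ, (∀ k : ℤ, u ≠ k) → 0 < W u
  second_deriv_pos : 0 < iteratedDeriv 2 W 0

/-- `L` is the value at `x` of the operator `I₁`, that is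
`L = P.V. ∫ (u (x + y) - u x) / |y|² dy`, the principal value being taken at `y = 0`. -/
def HasI1 (u : ℝ → ℝ) (x L : ℝ) : Prop :=
  Tendsto (fun δ : ℝ => ∫ y in {y : ℝ | δ < |y|}, (u (x + y) - u x) / |y| ^ 2)
    (𝓝[>] 0) (𝓝 L)

/-- The constant `C_n = ∫_{ℝ^{n-1}} (|y|² + 1)^{-(n+1)/2} dy` (used for `n ≥ 2`). -/
def layerConst (n : ℕ) : ℝ :=
  ∫ y : EuclideanSpace ℝ (Fin (n - 1)), 1 / (‖y‖ ^ 2 + 1) ^ (((n : ℝ) + 1) / 2)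

/-- `φ` is the layer solution (phase transition) of `C_n I₁[φ] = W'(φ)`: a function of class
`C^{1,1}(ℝ)` (bounded, with bounded and Lipschitz derivative, the class on which `I₁` is defined)
that is strictly increasing with `φ' > 0`, satisfies the equation at every point, has limits
`0` and `1` at `-∞` and `+∞`, and is normalised by `φ(0) = 1/2`. -/
structure IsLayerSolution (n : ℕ) (W φ : ℝ → ℝ) : Prop where
  contDiff : ContDiff ℝ 1 φ
  bounded : ∃ M, ∀ ξ, |φ ξ| ≤ M
  deriv_bounded : ∃ M, ∀ ξ, |deriv φ ξ| ≤ M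
  deriv_lipschitz : ∃ K : ℝ≥0, LipschitzWith K (deriv φ)
  equation : ∀ ξ, ∃ L, HasI1 φ ξ L ∧ layerConst n * L = deriv W (φ ξ)
  deriv_pos : ∀ ξ, 0 < deriv φ ξ
  tendsto_atBot : Tendsto φ atBot (𝓝 0)
  tendsto_atTop : Tendsto φ atTop (𝓝 1)
  normalised : φ 0 = 1 / 2

variable {n : ℕ}

open Classical in
/-- The signed distance function to the front `Γ_t = ∂Ω_t`, nonnegative in `Ω_t`. -/
def signedDist (Ω : ℝ → Set (EuclideanSpace ℝ (Fin n))) (t : ℝ)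
    (x : EuclideanSpace ℝ (Fin n)) : ℝ :=
  if x ∈ Ω t then Metric.infDist x (frontier (Ω t)) else -Metric.infDist x (frontier (Ω t))

/-- The closed tube `{(t,x) : t ∈ [t₀, t₀ + h], |signed distance| ≤ r}` around the front. -/
def tube (Ω : ℝ → Set (EuclideanSpace ℝ (Fin n))) (t₀ h r : ℝ) :
    Set (ℝ × EuclideanSpace ℝ (Fin n)) :=
  {p | p.1 ∈ Icc t₀ (t₀ + h) ∧ |signedDist Ω p.1 p.2| ≤ r}

/-- `(Ω_t)`, `t ∈ [t₀, t₀ + h]`, is a family of nonempty open sets, bounded uniformly in `t`, whose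
signed distance function is smooth (jointly in `(t,x)`) in the closed tube of radius `2ρ` around
the front. Smoothness of the signed distance function across the front makes the boundary of
each `Ω_t` smooth. -/
structure IsSmoothFront (Ω : ℝ → Set (EuclideanSpace ℝ (Fin n))) (t₀ h ρ : ℝ) : Prop where
  isOpen : ∀ t ∈ Icc t₀ (t₀ + h), IsOpen (Ω t)
  nonempty : ∀ t ∈ Icc t₀ (t₀ + h), (Ω t).Nonempty
  bounded : ∃ R, ∀ t ∈ Icc t₀ (t₀ + h), Ω t ⊆ Metric.ball 0 R
  smooth : ContDiffOn ℝ ∞ (fun p : ℝ × EuclideanSpace ℝ (Fin n) => signedDist Ω p.1 p.2)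
    (tube Ω t₀ h (2 * ρ))

/-- A smooth cutoff `η` on `[t₀, t₀ + h] × ℝⁿ` with values in `[0,1]`, equal to `1` at signed
distance at most `ρ` from the front and to `0` at signed distance at least `2ρ`. -/
structure IsCutoff (Ω : ℝ → Set (EuclideanSpace ℝ (Fin n))) (t₀ h ρ : ℝ)
    (η : ℝ → EuclideanSpace ℝ (Fin n) → ℝ) : Prop where
  smooth : ContDiffOn ℝ ∞ (fun p : ℝ × EuclideanSpace ℝ (Fin n) => η p.1 p.2)
    (Icc t₀ (t₀ + h) ×ˢ univ)
  eq_one : ∀ t ∈ Icc t₀ (t₀ + h), ∀ x, |signedDist Ω t x| ≤ ρ → η t x = 1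
  eq_zero : ∀ t ∈ Icc t₀ (t₀ + h), ∀ x, 2 * ρ ≤ |signedDist Ω t x| → η t x = 0
  mem_Icc : ∀ t ∈ Icc t₀ (t₀ + h), ∀ x, η t x ∈ Icc (0 : ℝ) 1

open Classical in
/-- The bounded extension `d` of the signed distance function away from the tube of radius `ρ`,
by means of the cutoff `η`. -/
def extDist (Ω : ℝ → Set (EuclideanSpace ℝ (Fin n))) (ρ : ℝ)
    (η : ℝ → EuclideanSpace ℝ (Fin n) → ℝ) (t : ℝ) (x : EuclideanSpace ℝ (Fin n)) : ℝ :=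
  if |signedDist Ω t x| ≤ ρ then signedDist Ω t x
  else if 2 * ρ ≤ signedDist Ω t x then 2 * ρ
  else if signedDist Ω t x ≤ -(2 * ρ) then -(2 * ρ)
  else if 0 < signedDist Ω t x then signedDist Ω t x * η t x + 2 * ρ * (1 - η t x)
  else signedDist Ω t x * η t x - 2 * ρ * (1 - η t x)

/-- The integrand (including the kernel `1/|z|^{n+1}`) in the definition of `a_ε`. -/
def aIntegrand (φ : ℝ → ℝ) (d : ℝ → EuclideanSpace ℝ (Fin n) → ℝ) (ε ξ t : ℝ)
    (x z : EuclideanSpace ℝ (Fin n)) : ℝ :=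
  (φ (ξ + (d t (x + ε • z) - d t x) / ε) - φ (ξ + inner ℝ (gradient (d t) x) z))
    / ‖z‖ ^ (n + 1)

/-- The auxiliary function `a_ε(ξ; t, x)` with parameter `γ`. -/
def aEps (φ : ℝ → ℝ) (d : ℝ → EuclideanSpace ℝ (Fin n) → ℝ) (γ ε ξ t : ℝ)
    (x : EuclideanSpace ℝ (Fin n)) : ℝ :=
  ∫ z in {z : EuclideanSpace ℝ (Fin n) | ‖z‖ < γ / ε}, aIntegrand φ d ε ξ t x z

/-- The derivative of `a_ε` in the variable `ξ`. -/
def aEpsDot (φ : ℝ → ℝ) (d : ℝ → EuclideanSpace ℝ (Fin n) → ℝ) (γ ε ξ t : ℝ)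
    (x : EuclideanSpace ℝ (Fin n)) : ℝ :=
  deriv (fun ζ => aEps φ d γ ε ζ t x) ξ

/-- The second derivative of `a_ε` in the variable `ξ`. -/
def aEpsDotDot (φ : ℝ → ℝ) (d : ℝ → EuclideanSpace ℝ (Fin n) → ℝ) (γ ε ξ t : ℝ)
    (x : EuclideanSpace ℝ (Fin n)) : ℝ :=
  deriv (fun ζ => aEpsDot φ d γ ε ζ t x) ξ

/-- The auxiliary function `ā_ε(t,x) = (ε |ln ε|)⁻¹ ∫ a_ε(ξ;t,x) φ'(ξ) dξ`. -/
def aBar (φ : ℝ → ℝ) (d : ℝ → EuclideanSpace ℝ (Fin n) → ℝ) (γ ε t : ℝ)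
    (x : EuclideanSpace ℝ (Fin n)) : ℝ :=
  1 / (ε * |Real.log ε|) * ∫ ξ, aEps φ d γ ε ξ t x * deriv φ ξ

end Dislocation

end

/-!
The estimates rest on three independent facts: the layer solution `φ` has bounded *and integrable*
derivatives up to order three, `φ'` decays like `1/|ξ|`, and the increments of the extended distance
`d` differ from linear functions by `O(ε|z|²)`, with a difference that is Lipschitz in `(t, x)`.

*The layer solution.* The equation `C_n I₁[φ] = W'(φ)` is put into the form
`φ = P₁φ - ∫₀¹ P_t f dt` with the Poisson semigroup `P_t` and `f = W'(φ) / (π C_n)`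
(`hasPoisRep_of_hasI1`). As `P_t` smooths at the rate `1/t`, interpolation with the trivial bound
gives the solution half a derivative for a bounded `f` (`HasPoisRep.holder`), and a full derivative
for an `f` that is Hölder continuous of exponent `1/2` (`HasPoisRep.differentiable`). The derivatives
of `φ` have representations of the same kind, so that `φ` is three times differentiable. For
integrability, the representation is paired with functions of modulus at most one: the pairings of
the translates satisfy a representation again, and the choice of the sign of `u(· + s) - u` turns the
pointwise gains into gains in `L¹` (`HasPoisRep.l1Holder`, `HasPoisRep.l1Lipschitz`). Starting from
`φ' ∈ L¹`, which is monotonicity, this yields `φ'', φ''' ∈ L¹` (`exists_isProfile`). Near the wells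
`W''` is positive; testing the equation with rescaled bumps then bounds `φ` and `1 - φ` by `C/|ξ|`
at the two ends (`exists_decay`), and the representation of `φ'` transfers this to `φ'`
(`exists_deriv_le`).

*The distance.* Smoothness of the signed distance is given only on the tube. The cutoff provides,
by its joint continuity, room in time and space around each point of the front, and hence the joint
continuity of the signed distance wherever it is needed. Thus `d` is smooth in the open tube of
radius `2ρ`, with compact closure, and flat outside it; its spatial gradient is globally Lipschitz,
of norm at least one where `|d| ≤ ρ`, and the first order Taylor remainder `R(t, x; v)` is Lipschitz
in `(t, x)` with constant `K|v|²` (`IsCutoff.exists_isIncrementFamily`).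

*The integrals.* Write `D(z)` for the increment of `d` divided by `ε` and `p = ∇d`. On a ball of
radius `r`, the difference `ψ(ξ + D(z)) - ψ(ξ + p·z)` is at most the mass of `ψ'` within distance
`Kεr²` of `ξ + p·z`. The integral over the ball of a function of `p·z` is at most
`C rⁿ⁻¹ / |p|` times its integral over the line, so that the difference has integral at most
`C ε rⁿ⁺¹ ‖ψ'‖₁ / |p|` (`lintegral_ball_profile_le`). A layer-cake argument in `r` turns this into a
logarithmic bound for the weight `|z|⁻ⁿ⁻¹` on `1 ≤ |z| < γ/ε`, and into a bound linear in the radius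
for the weight `|z|⁻ⁿ`. The former, applied to `ψ = φ, φ', φ''`, is the bound by `ε |ln ε| / |∇d|`.
A derivative in `(t, x)` produces an increment whose size is at most linear in `z`, so it costs one
power of `|z|`: the latter bound applies, and `Kε · γ/ε = Kγ` makes it uniform. The decay in `ξ`
follows in the same way: for `|z|` small against `|ξ|` the decay of `φ'` is used, and elsewhere one
power of `|z|` is traded for `1/|ξ|`. No smallness of `ε` beyond `ε < 1` is needed for it.
-/

noncomputable section

namespace Dislocation

/-! ### The Cauchy kernel and its convolutions -/

section

/-- The density `1 / (π (1 + w²))` of the standard Cauchy distribution. -/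
def cauchyKer (w : ℝ) : ℝ := Real.pi⁻¹ * (1 + w ^ 2)⁻¹

/-- The Poisson extension `P_t * u` of `u` to the upper half plane, written in the scaled form
`∫ u (x - t w) / (π (1 + w²)) dw`, which makes sense down to `t = 0`, where it is `u`. -/
def pois (u : ℝ → ℝ) (t x : ℝ) : ℝ := ∫ w, u (x - t * w) * cauchyKer w

theorem cauchyKer_pos (w : ℝ) : 0 < cauchyKer w := by
  unfold cauchyKer; positivity

theorem continuous_cauchyKer : Continuous cauchyKer := by
  unfold cauchyKer
  exact continuous_const.mul ((by fun_prop : Continuous fun w : ℝ => 1 + w ^ 2).inv₀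
    (fun w => by positivity))

theorem integrable_cauchyKer : Integrable cauchyKer :=
  integrable_inv_one_add_sq.const_mul _

theorem integral_cauchyKer : ∫ w, cauchyKer w = 1 := by
  simp only [cauchyKer, integral_const_mul, integral_univ_inv_one_add_sq]
  field_simp

theorem cauchyKer_le (w : ℝ) : cauchyKer w ≤ 1 := by
  unfold cauchyKer
  have h1 : Real.pi⁻¹ ≤ 1 := inv_le_one_of_one_le₀ (by linarith [Real.pi_gt_three])
  have h2 : (1 + w ^ 2)⁻¹ ≤ 1 := inv_le_one_of_one_le₀ (by nlinarith [sq_nonneg w])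
  calc _ ≤ (1 : ℝ) * 1 := by gcongr
    _ = 1 := one_mul 1

/-- The Poisson kernels `P_s` and `P_t` with `s ≠ t` convolve to `P_{s+t}`; partial fractions give
an explicit primitive, whose logarithmic part vanishes at infinity. -/
theorem integral_poisson_conv {s t : ℝ} (hs : 0 < s) (ht : 0 < t) (hst : s ≠ t) (c : ℝ) :
    ∫ b, (b ^ 2 + s ^ 2)⁻¹ * ((b - c) ^ 2 + t ^ 2)⁻¹ =
      Real.pi * (s + t) / (s * t * (c ^ 2 + (s + t) ^ 2)) := by
  set q : ℝ := c ^ 2 + t ^ 2 - s ^ 2 with hq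
  have hN : 0 < q ^ 2 + 4 * c ^ 2 * s ^ 2 := by
    have : q ^ 2 + 4 * c ^ 2 * s ^ 2 = (c ^ 2 + (t + s) ^ 2) * (c ^ 2 + (t - s) ^ 2) := by
      rw [hq]; ring
    rw [this]
    have : 0 < (t - s) ^ 2 := by
      have : t - s ≠ 0 := sub_ne_zero.mpr hst.symm
      positivity
    positivity
  set N : ℝ := q ^ 2 + 4 * c ^ 2 * s ^ 2 with hNdef
  set f : ℝ → ℝ := fun b => c / N * (Real.log (b ^ 2 + s ^ 2) - Real.log ((b - c) ^ 2 + t ^ 2))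
    + q / N / s * Real.arctan (b / s)
    + (2 * c ^ 2 - q) / N / t * Real.arctan ((b - c) / t) with hf
  have hderiv : ∀ b, HasDerivAt f ((b ^ 2 + s ^ 2)⁻¹ * ((b - c) ^ 2 + t ^ 2)⁻¹) b := by
    intro b
    have p1 : 0 < b ^ 2 + s ^ 2 := by positivity
    have p2 : 0 < (b - c) ^ 2 + t ^ 2 := by positivity
    have d1 : HasDerivAt (fun b : ℝ => b ^ 2 + s ^ 2) (2 * b) b := by
      simpa using (hasDerivAt_pow 2 b).add_const (s ^ 2)
    have d2 : HasDerivAt (fun b : ℝ => (b - c) ^ 2 + t ^ 2) (2 * (b - c)) b := by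
      simpa using (((hasDerivAt_id b).sub_const c).pow 2).add_const (t ^ 2)
    have d3 : HasDerivAt (fun b : ℝ => Real.arctan (b / s)) (1 / (1 + (b / s) ^ 2) * (1 / s)) b :=
      ((hasDerivAt_id b).div_const s).arctan
    have d4 : HasDerivAt (fun b : ℝ => Real.arctan ((b - c) / t))
        (1 / (1 + ((b - c) / t) ^ 2) * (1 / t)) b :=
      (((hasDerivAt_id b).sub_const c).div_const t).arctan
    have := ((((d1.log p1.ne').sub (d2.log p2.ne')).const_mul (c / N)).add
      (d3.const_mul (q / N / s))).add (d4.const_mul ((2 * c ^ 2 - q) / N / t))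
    refine this.congr_deriv ?_
    have e3 : 1 / (1 + (b / s) ^ 2) * (1 / s) = s / (b ^ 2 + s ^ 2) := by
      field_simp; ring
    have e4 : 1 / (1 + ((b - c) / t) ^ 2) * (1 / t) = t / ((b - c) ^ 2 + t ^ 2) := by
      field_simp; ring
    rw [e3, e4]
    have e5 : c / N * (2 * b / (b ^ 2 + s ^ 2) - 2 * (b - c) / ((b - c) ^ 2 + t ^ 2))
      + q / N / s * (s / (b ^ 2 + s ^ 2))
      + (2 * c ^ 2 - q) / N / t * (t / ((b - c) ^ 2 + t ^ 2)) =
      ((2 * c * b + q) * ((b - c) ^ 2 + t ^ 2) +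
        ((2 * c ^ 2 - q) - 2 * c * (b - c)) * (b ^ 2 + s ^ 2)) /
        (N * (b ^ 2 + s ^ 2) * ((b - c) ^ 2 + t ^ 2)) := by
      field_simp
      ring
    rw [e5]
    have e6 : (2 * c * b + q) * ((b - c) ^ 2 + t ^ 2) +
        ((2 * c ^ 2 - q) - 2 * c * (b - c)) * (b ^ 2 + s ^ 2) = N := by
      rw [hNdef, hq]; ring
    rw [e6]
    field_simp
  have hlog : ∀ l : Filter ℝ, Tendsto (fun b : ℝ => b⁻¹) l (𝓝 0) → (∀ᶠ b in l, b ≠ 0) →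
      Tendsto (fun b => c / N * (Real.log (b ^ 2 + s ^ 2) - Real.log ((b - c) ^ 2 + t ^ 2)))
        l (𝓝 0) := by
    intro l hl hl0
    have h1 : Tendsto (fun b : ℝ => c / N * (Real.log (1 + s ^ 2 * b⁻¹ ^ 2)
        - Real.log ((1 - c * b⁻¹) ^ 2 + t ^ 2 * b⁻¹ ^ 2))) l (𝓝 (c / N * (Real.log (1 + s ^ 2 * 0 ^ 2)
        - Real.log ((1 - c * 0) ^ 2 + t ^ 2 * 0 ^ 2)))) := by
      refine Tendsto.const_mul _ (Tendsto.sub ?_ ?_)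
      · exact ((hl.pow 2).const_mul _ |>.const_add 1).log (by norm_num)
      · exact ((((hl.const_mul c).const_sub 1).pow 2).add ((hl.pow 2).const_mul _)).log (by norm_num)
    simp only [ne_eq, OfNat.ofNat_ne_zero, not_false_eq_true, zero_pow, mul_zero, add_zero, sub_zero,
      one_pow, Real.log_one] at h1
    refine h1.congr' ?_
    filter_upwards [hl0] with b hb
    have e1 : 1 + s ^ 2 * b⁻¹ ^ 2 = (b ^ 2 + s ^ 2) / b ^ 2 := by field_simp
    have e2 : (1 - c * b⁻¹) ^ 2 + t ^ 2 * b⁻¹ ^ 2 = ((b - c) ^ 2 + t ^ 2) / b ^ 2 := by field_simp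
    rw [e1, e2, Real.log_div (by positivity) (by positivity),
      Real.log_div (by positivity) (by positivity)]
    ring
  have htop : Tendsto f atTop (𝓝 (0 + q / N / s * (Real.pi / 2)
      + (2 * c ^ 2 - q) / N / t * (Real.pi / 2))) := by
    have ha : Tendsto Real.arctan atTop (𝓝 (Real.pi / 2)) :=
      Real.tendsto_arctan_atTop.mono_right nhdsWithin_le_nhds
    refine ((hlog _ tendsto_inv_atTop_zero (eventually_ne_atTop 0)).add
      (Tendsto.const_mul _ (ha.comp ?_))).add (Tendsto.const_mul _ (ha.comp ?_))
    · exact tendsto_id.atTop_div_const hs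
    · exact (tendsto_atTop_add_const_right _ (-c) tendsto_id).atTop_div_const ht
  have hbot : Tendsto f atBot (𝓝 (0 + q / N / s * (-(Real.pi / 2))
      + (2 * c ^ 2 - q) / N / t * (-(Real.pi / 2)))) := by
    have ha : Tendsto Real.arctan atBot (𝓝 (-(Real.pi / 2))) :=
      Real.tendsto_arctan_atBot.mono_right nhdsWithin_le_nhds
    refine ((hlog _ tendsto_inv_atBot_zero (eventually_ne_atBot 0)).add
      (Tendsto.const_mul _ (ha.comp ?_))).add (Tendsto.const_mul _ (ha.comp ?_))
    · exact tendsto_id.atBot_div_const hs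
    · exact (tendsto_atBot_add_const_right _ (-c) tendsto_id).atBot_div_const ht
  have hint : Integrable fun b : ℝ => (b ^ 2 + s ^ 2)⁻¹ * ((b - c) ^ 2 + t ^ 2)⁻¹ := by
    have i1 : Integrable fun b : ℝ => (b ^ 2 + s ^ 2)⁻¹ := by
      have := (integrable_inv_one_add_sq.comp_div hs.ne').const_mul (s ^ 2)⁻¹
      refine this.congr (Eventually.of_forall fun b => ?_)
      simp only
      field_simp
      ring
    refine (i1.const_mul ((t ^ 2)⁻¹)).mono' ?_ (Eventually.of_forall fun b => ?_)
    · have c1 : Continuous fun b : ℝ => (b ^ 2 + s ^ 2)⁻¹ :=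
        (by fun_prop : Continuous fun b : ℝ => b ^ 2 + s ^ 2).inv₀ (fun b => by positivity)
      have c2 : Continuous fun b : ℝ => ((b - c) ^ 2 + t ^ 2)⁻¹ :=
        (by fun_prop : Continuous fun b : ℝ => (b - c) ^ 2 + t ^ 2).inv₀ (fun b => by positivity)
      exact (c1.mul c2).aestronglyMeasurable
    · rw [Real.norm_of_nonneg (by positivity), mul_comm]
      gcongr
      nlinarith [sq_nonneg (b - c)]
  rw [integral_of_hasDerivAt_of_tendsto hderiv hint hbot htop]
  have e7 : N = (c ^ 2 + (s + t) ^ 2) * (c ^ 2 + (t - s) ^ 2) := by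
    rw [hNdef, hq]; ring
  have p3 : 0 < c ^ 2 + (s + t) ^ 2 := by positivity
  have p4 : c ^ 2 + (t - s) ^ 2 ≠ 0 := by
    intro h; rw [h, mul_zero] at e7; exact hN.ne' e7
  have e8 : 0 + q / N / s * (Real.pi / 2) + (2 * c ^ 2 - q) / N / t * (Real.pi / 2)
      - (0 + q / N / s * -(Real.pi / 2) + (2 * c ^ 2 - q) / N / t * -(Real.pi / 2))
      = Real.pi * (q * t + (2 * c ^ 2 - q) * s) / (N * s * t) := by
    field_simp
    ring
  have e9 : q * t + (2 * c ^ 2 - q) * s = (s + t) * (c ^ 2 + (t - s) ^ 2) := by rw [hq]; ring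
  rw [e8, e9, e7]
  field_simp

end

/-! ### The Poisson semigroup and the first regularity gain -/

section

/-- The Poisson kernel `P_t(y) = t / (π (y² + t²))`. -/
def poissonKer (t y : ℝ) : ℝ := Real.pi⁻¹ * t * (y ^ 2 + t ^ 2)⁻¹

theorem measurable_cauchyKer : Measurable cauchyKer := continuous_cauchyKer.measurable

section Pois

variable {u : ℝ → ℝ} {M : ℝ}

theorem integrable_pois (hu : Measurable u) (hM : ∀ x, |u x| ≤ M) (t x : ℝ) :
    Integrable fun w => u (x - t * w) * cauchyKer w := by
  refine (integrable_cauchyKer.const_mul M).mono' ?_ (Eventually.of_forall fun w => ?_)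
  · exact ((hu.comp (by fun_prop)).mul measurable_cauchyKer).aestronglyMeasurable
  · rw [norm_mul, Real.norm_of_nonneg (cauchyKer_pos w).le]
    exact mul_le_mul_of_nonneg_right (hM _) (cauchyKer_pos w).le

theorem abs_pois_le (hM : ∀ x, |u x| ≤ M) (t x : ℝ) : |pois u t x| ≤ M := by
  have := norm_integral_le_of_norm_le (f := fun w => u (x - t * w) * cauchyKer w)
    (integrable_cauchyKer.const_mul M) (Eventually.of_forall fun w => by
      rw [norm_mul, Real.norm_of_nonneg (cauchyKer_pos w).le]
      exact mul_le_mul_of_nonneg_right (hM _) (cauchyKer_pos w).le)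
  rwa [integral_const_mul, integral_cauchyKer, mul_one] at this

theorem pois_zero (x : ℝ) : pois u 0 x = u x := by
  simp [pois, integral_const_mul, integral_cauchyKer]

theorem pois_sub {v : ℝ → ℝ} {M' : ℝ} (hu : Measurable u) (hM : ∀ x, |u x| ≤ M)
    (hv : Measurable v) (hM' : ∀ x, |v x| ≤ M') (t x : ℝ) :
    pois (fun y => u y - v y) t x = pois u t x - pois v t x := by
  unfold pois
  rw [← integral_sub (integrable_pois hu hM t x) (integrable_pois hv hM' t x)]
  congr 1; ext w; ring

theorem pois_const_mul (c : ℝ) (t x : ℝ) :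
    pois (fun y => c * u y) t x = c * pois u t x := by
  unfold pois
  rw [← integral_const_mul]
  congr 1; ext w; ring

theorem continuous_pois_time (hu : Continuous u) (hM : ∀ x, |u x| ≤ M) (x : ℝ) :
    Continuous fun t => pois u t x := by
  refine continuous_of_dominated (bound := fun w => M * cauchyKer w) (fun t => ?_) (fun t => ?_)
    (integrable_cauchyKer.const_mul M) ?_
  · exact (integrable_pois hu.measurable hM t x).aestronglyMeasurable
  · refine Eventually.of_forall fun w => ?_
    rw [norm_mul, Real.norm_of_nonneg (cauchyKer_pos w).le]
    exact mul_le_mul_of_nonneg_right (hM _) (cauchyKer_pos w).le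
  · exact Eventually.of_forall fun w => by fun_prop

theorem measurable_pois (hu : Measurable u) : Measurable fun p : ℝ × ℝ => pois u p.1 p.2 := by
  have : StronglyMeasurable fun p : ℝ × ℝ => ∫ w, u (p.2 - p.1 * w) * cauchyKer w := by
    refine StronglyMeasurable.integral_prod_right
      (f := fun (p : ℝ × ℝ) w => u (p.2 - p.1 * w) * cauchyKer w) ?_
    refine Measurable.stronglyMeasurable ?_
    exact (hu.comp (by fun_prop)).mul (measurable_cauchyKer.comp measurable_snd)
  exact this.measurable

theorem intervalIntegrable_pois (hu : Measurable u) (hM : ∀ x, |u x| ≤ M) (x a b : ℝ) :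
    IntervalIntegrable (fun t => pois u t x) volume a b := by
  rw [intervalIntegrable_iff]
  refine Measure.integrableOn_of_bounded (M := M) (by simp) ?_
    (Eventually.of_forall fun t => abs_pois_le hM t x)
  exact ((measurable_pois hu).comp (by fun_prop : Measurable fun t : ℝ => (t, x))).aestronglyMeasurable

theorem poissonKer_nonneg {t : ℝ} (ht : 0 < t) (y : ℝ) : 0 ≤ poissonKer t y := by
  unfold poissonKer; positivity

theorem poissonKer_neg (t y : ℝ) : poissonKer t (-y) = poissonKer t y := by
  simp [poissonKer]

theorem poissonKer_eq {t : ℝ} (ht : 0 < t) (y : ℝ) :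
    poissonKer t y = t⁻¹ * cauchyKer (t⁻¹ * y) := by
  unfold poissonKer cauchyKer
  field_simp
  ring

theorem integrable_poissonKer {t : ℝ} (ht : 0 < t) : Integrable (poissonKer t) := by
  have := (integrable_cauchyKer.comp_mul_left' (inv_ne_zero ht.ne')).const_mul t⁻¹
  exact this.congr (Eventually.of_forall fun y => (poissonKer_eq ht y).symm)

theorem continuous_poissonKer {t : ℝ} (ht : 0 < t) : Continuous (poissonKer t) := by
  unfold poissonKer
  exact continuous_const.mul ((by fun_prop : Continuous fun y : ℝ => y ^ 2 + t ^ 2).inv₀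
    (fun y => by positivity))

theorem pois_eq_sub {t : ℝ} (ht : 0 < t) (x : ℝ) :
    pois u t x = ∫ y, u (x - y) * poissonKer t y := by
  have := Measure.integral_comp_mul_left (fun y => u (x - y) * poissonKer t y) t
  rw [abs_of_pos (inv_pos.mpr ht), smul_eq_mul] at this
  have h2 : pois u t x = t * ∫ w, u (x - t * w) * poissonKer t (t * w) := by
    unfold pois
    rw [← integral_const_mul]
    congr 1; ext w
    rw [poissonKer_eq ht, inv_mul_cancel_left₀ ht.ne']
    field_simp
  rw [h2, this, mul_inv_cancel_left₀ ht.ne']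

theorem pois_eq {t : ℝ} (ht : 0 < t) (x : ℝ) :
    pois u t x = ∫ y, u y * poissonKer t (x - y) := by
  rw [pois_eq_sub ht, ← integral_sub_left_eq_self _ volume x]
  simp

theorem integral_poissonKer_mul {s t : ℝ} (hs : 0 < s) (ht : 0 < t) (hst : s ≠ t) (x y : ℝ) :
    ∫ a, poissonKer s (a - y) * poissonKer t (x - a) = poissonKer (s + t) (x - y) := by
  rw [← integral_add_right_eq_self _ y]
  have : ∀ b, poissonKer s (b + y - y) * poissonKer t (x - (b + y)) =
      (Real.pi⁻¹ ^ 2 * s * t) * ((b ^ 2 + s ^ 2)⁻¹ * ((b - (x - y)) ^ 2 + t ^ 2)⁻¹) := by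
    intro b
    rw [← poissonKer_neg t]
    unfold poissonKer
    rw [show b + y - y = b by ring, show -(x - (b + y)) = b - (x - y) by ring]
    ring
  simp_rw [this]
  rw [integral_const_mul, integral_poisson_conv hs ht hst]
  unfold poissonKer
  field_simp

/-- The semigroup property of the Poisson extension. -/
theorem pois_pois (hu : Measurable u) (hM : ∀ x, |u x| ≤ M) {s t : ℝ} (hs : 0 < s) (ht : 0 < t)
    (hst : s ≠ t) (x : ℝ) : pois (fun y => pois u s y) t x = pois u (s + t) x := by
  rw [pois_eq ht, pois_eq (add_pos hs ht)]
  have hst' := integral_poissonKer_mul hs ht hst x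
  simp_rw [← hst', pois_eq hs, ← integral_mul_const, ← integral_const_mul]
  rw [integral_integral_swap]
  · congr 1; ext y; congr 1; ext a; ring
  · have h1 : Integrable fun a => poissonKer t (x - a) :=
      (integrable_poissonKer ht).comp_sub_left x
    have h2 := (Integrable.convolution_integrand (ContinuousLinearMap.mul ℝ ℝ) h1
      (integrable_poissonKer hs)).swap
    have h3 := h2.bdd_mul (c := M) (f := fun p : ℝ × ℝ => u p.2)
      (hu.comp measurable_snd).aestronglyMeasurable (Eventually.of_forall fun p => hM _)
    refine h3.congr (Eventually.of_forall fun p => ?_)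
    simp only [Function.comp, Prod.fst_swap, Prod.snd_swap, ContinuousLinearMap.mul_apply',
      Function.uncurry]
    rw [← poissonKer_neg s, neg_sub]
    ring

/-- The logarithmic derivative of the Cauchy kernel is at most one; in this form the bound for
differences needs no estimate between the two points. -/
theorem abs_cauchyKer_sub_le (w h : ℝ) :
    |cauchyKer (w + h) - cauchyKer w| ≤ |h| / 2 * (cauchyKer (w + h) + cauchyKer w) := by
  unfold cauchyKer
  have p1 : 0 < 1 + w ^ 2 := by positivity
  have p2 : 0 < 1 + (w + h) ^ 2 := by positivity
  have e : Real.pi⁻¹ * (1 + (w + h) ^ 2)⁻¹ - Real.pi⁻¹ * (1 + w ^ 2)⁻¹ =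
      Real.pi⁻¹ * ((1 + w ^ 2)⁻¹ * (1 + (w + h) ^ 2)⁻¹) * ((-h) * (w + (w + h))) := by
    field_simp
    ring
  have e2 : |h| / 2 * (Real.pi⁻¹ * (1 + (w + h) ^ 2)⁻¹ + Real.pi⁻¹ * (1 + w ^ 2)⁻¹) =
      Real.pi⁻¹ * ((1 + w ^ 2)⁻¹ * (1 + (w + h) ^ 2)⁻¹) *
        (|h| * ((1 + w ^ 2 + (1 + (w + h) ^ 2)) / 2)) := by
    field_simp
  rw [e, e2, abs_mul, abs_of_pos (by positivity : 0 < Real.pi⁻¹ * ((1 + w ^ 2)⁻¹ *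
    (1 + (w + h) ^ 2)⁻¹)), abs_mul, abs_neg]
  gcongr
  rw [abs_le]
  constructor <;> nlinarith [sq_nonneg (w - 1), sq_nonneg (w + 1), sq_nonneg (w + h - 1),
    sq_nonneg (w + h + 1)]

theorem abs_pois_shift_le (hu : Measurable u) (hM : ∀ x, |u x| ≤ M) {t : ℝ} (ht : 0 < t)
    (x s : ℝ) : |pois u t (x + s) - pois u t x| ≤ M * (|s| / t) := by
  have hM0 : 0 ≤ M := (abs_nonneg _).trans (hM 0)
  set h := s / t with hh
  have h1 : pois u t (x + s) = ∫ w, u (x - t * w) * cauchyKer (w + h) := by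
    unfold pois
    rw [← integral_add_right_eq_self _ h]
    congr 1; ext w
    rw [show x + s - t * (w + h) = x - t * w by rw [hh]; field_simp; ring]
  have i2 : Integrable fun w => cauchyKer (w + h) := integrable_cauchyKer.comp_add_right h
  have i1 : Integrable fun w => u (x - t * w) * cauchyKer (w + h) :=
    i2.bdd_mul (c := M) (hu.comp (by fun_prop)).aestronglyMeasurable
      (Eventually.of_forall fun w => hM _)
  rw [h1, pois, ← integral_sub i1 (integrable_pois hu hM t x)]
  have := norm_integral_le_of_norm_le
    (f := fun w => u (x - t * w) * cauchyKer (w + h) - u (x - t * w) * cauchyKer w)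
    (((i2.add integrable_cauchyKer).const_mul (|h| / 2)).const_mul M)
    (Eventually.of_forall fun w => by
      rw [← mul_sub, norm_mul]
      exact mul_le_mul (hM _) (abs_cauchyKer_sub_le w h) (norm_nonneg _) hM0)
  refine this.trans (le_of_eq ?_)
  rw [integral_const_mul, integral_const_mul]
  simp only [Pi.add_apply]
  rw [integral_add i2 integrable_cauchyKer, integral_add_right_eq_self cauchyKer h,
    integral_cauchyKer, hh, abs_div, abs_of_pos ht]
  ring

/-- Interpolation of the Lipschitz bound of order `|s| / t` with the trivial bound. The power
`t⁻¹ᐟ²` is integrable at `0`. -/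
theorem abs_pois_shift_le_sqrt (hu : Measurable u) (hM : ∀ x, |u x| ≤ M) {t : ℝ} (ht : 0 < t)
    (x s : ℝ) : |pois u t (x + s) - pois u t x| ≤ 2 * M * √|s| * (√t)⁻¹ := by
  have hM0 : 0 ≤ M := (abs_nonneg _).trans (hM 0)
  have h1 := abs_pois_shift_le hu hM ht x s
  have h2 : |pois u t (x + s) - pois u t x| ≤ 2 * M :=
    (abs_sub _ _).trans (by linarith [abs_pois_le hM t (x + s), abs_pois_le hM t x])
  rw [mul_assoc, ← div_eq_mul_inv, ← Real.sqrt_div (abs_nonneg s)]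
  set r := |s| / t with hr
  have hr0 : 0 ≤ r := by positivity
  rcases le_total r 1 with h | h
  · have : r ≤ √r := Real.le_sqrt_of_sq_le (by nlinarith)
    nlinarith
  · have : 1 ≤ √r := Real.one_le_sqrt.mpr h
    nlinarith

theorem intervalIntegrable_inv_sqrt : IntervalIntegrable (fun t : ℝ => (√t)⁻¹) volume 0 1 := by
  have := intervalIntegral.intervalIntegrable_rpow' (a := 0) (b := 1) (r := -(1 / 2 : ℝ))
    (by norm_num)
  refine this.congr ?_
  rw [uIoc_of_le zero_le_one]
  intro t ht
  change t ^ (-(1 / 2 : ℝ)) = (√t)⁻¹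
  rw [Real.rpow_neg ht.1.le, Real.sqrt_eq_rpow]

theorem integral_inv_sqrt : ∫ t in (0 : ℝ)..1, (√t)⁻¹ = 2 := by
  have : ∫ t in (0 : ℝ)..1, (√t)⁻¹ = ∫ t in (0 : ℝ)..1, t ^ (-(1 / 2 : ℝ)) := by
    refine intervalIntegral.integral_congr fun t ht => ?_
    rw [uIcc_of_le zero_le_one] at ht
    rw [Real.rpow_neg ht.1, Real.sqrt_eq_rpow]
  rw [this, integral_rpow (Or.inl (by norm_num))]
  norm_num

end Pois

/-- `u` and `f` satisfy `u = P_1 * u - ∫₀¹ P_t * f dt`, the integrated form of the equation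
`I₁[u] = π f`: the generator of `P_t` is `π⁻¹ I₁`. -/
def HasPoisRep (u f : ℝ → ℝ) : Prop :=
  ∀ x, u x = pois u 1 x - ∫ t in (0 : ℝ)..1, pois f t x

/-- A bounded right-hand side makes the solution Hölder continuous with exponent `1/2`. -/
theorem HasPoisRep.holder {u f : ℝ → ℝ} {M : ℝ} (h : HasPoisRep u f) (hu : Measurable u)
    (hf : Measurable f) (huM : ∀ x, |u x| ≤ M) (hfM : ∀ x, |f x| ≤ M) (x s : ℝ) :
    |u (x + s) - u x| ≤ 6 * M * √|s| := by
  have h1 := abs_pois_shift_le_sqrt hu huM one_pos x s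
  rw [Real.sqrt_one, inv_one, mul_one] at h1
  have h2 : |∫ t in (0 : ℝ)..1, (pois f t (x + s) - pois f t x)| ≤ 2 * M * √|s| * 2 := by
    have e : 2 * M * √|s| * 2 = ∫ t in (0 : ℝ)..1, 2 * M * √|s| * (√t)⁻¹ := by
      rw [intervalIntegral.integral_const_mul, integral_inv_sqrt]
    rw [e]
    refine intervalIntegral.norm_integral_le_of_norm_le
      (f := fun t => pois f t (x + s) - pois f t x) zero_le_one
      (Eventually.of_forall fun t ht => ?_) (intervalIntegrable_inv_sqrt.const_mul _)
    exact abs_pois_shift_le_sqrt hf hfM ht.1 x s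
  rw [intervalIntegral.integral_sub (intervalIntegrable_pois hf hfM _ _ _)
    (intervalIntegrable_pois hf hfM _ _ _)] at h2
  rw [h (x + s), h x]
  rw [abs_le] at *
  constructor <;> linarith [h1.1, h1.2, h2.1, h2.2]

end

/-! ### Differentiability from a Poisson representation -/

section

/-- The derivative in `y` of the Poisson kernel `P_t(y)`. -/
def poissonKerDeriv (t y : ℝ) : ℝ := -(Real.pi⁻¹ * t * (2 * y) * ((y ^ 2 + t ^ 2)⁻¹) ^ 2)

/-- The derivative in `x` of the Poisson extension `pois u t x`. -/
def poisDeriv (u : ℝ → ℝ) (t x : ℝ) : ℝ := ∫ y, u y * poissonKerDeriv t (x - y)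

theorem measurable_pois_time {u : ℝ → ℝ} (hu : Measurable u) (x : ℝ) :
    Measurable fun t => pois u t x :=
  (measurable_pois hu).comp (by fun_prop : Measurable fun t : ℝ => (t, x))

theorem hasDerivAt_poissonKer {t : ℝ} (ht : 0 < t) (y : ℝ) :
    HasDerivAt (poissonKer t) (poissonKerDeriv t y) y := by
  have p : 0 < y ^ 2 + t ^ 2 := by positivity
  have d1 : HasDerivAt (fun y : ℝ => y ^ 2 + t ^ 2) (2 * y) y := by
    simpa using (hasDerivAt_pow 2 y).add_const (t ^ 2)
  have := (d1.inv p.ne').const_mul (Real.pi⁻¹ * t)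
  refine this.congr_deriv ?_
  unfold poissonKerDeriv
  field_simp

theorem continuous_poissonKerDeriv {t : ℝ} (ht : 0 < t) : Continuous (poissonKerDeriv t) := by
  unfold poissonKerDeriv
  have : Continuous fun y : ℝ => (y ^ 2 + t ^ 2)⁻¹ :=
    (by fun_prop : Continuous fun y : ℝ => y ^ 2 + t ^ 2).inv₀ (fun y => by positivity)
  fun_prop

theorem abs_poissonKerDeriv_le {t : ℝ} (ht : 0 < t) (y : ℝ) :
    |poissonKerDeriv t y| ≤ Real.pi⁻¹ * (y ^ 2 + t ^ 2)⁻¹ := by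
  have p : 0 < y ^ 2 + t ^ 2 := by positivity
  have e : poissonKerDeriv t y = (Real.pi⁻¹ * (y ^ 2 + t ^ 2)⁻¹ * (y ^ 2 + t ^ 2)⁻¹) *
    (-(2 * y * t)) := by
    unfold poissonKerDeriv; ring
  have e' : Real.pi⁻¹ * (y ^ 2 + t ^ 2)⁻¹ = (Real.pi⁻¹ * (y ^ 2 + t ^ 2)⁻¹ * (y ^ 2 + t ^ 2)⁻¹) *
      (y ^ 2 + t ^ 2) := by field_simp
  rw [e, abs_mul, abs_of_pos (by positivity)]
  refine le_of_le_of_eq (mul_le_mul_of_nonneg_left ?_ (by positivity)) e'.symm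
  · rw [abs_le]; constructor <;> nlinarith [sq_nonneg (y - t), sq_nonneg (y + t)]

theorem abs_poissonKerDeriv_mul_sqrt_le {t : ℝ} (ht : 0 < t) (y : ℝ) :
    √|y| * |poissonKerDeriv t y| ≤ 2 * (√t)⁻¹ * poissonKer t y := by
  have p : 0 < y ^ 2 + t ^ 2 := by positivity
  set a := √|y| with ha
  set b := √t with hb
  have ha0 : 0 ≤ a := Real.sqrt_nonneg _
  have hb0 : 0 < b := Real.sqrt_pos.mpr ht
  have ha2 : a ^ 2 = |y| := Real.sq_sqrt (abs_nonneg y)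
  have hb2 : b ^ 2 = t := Real.sq_sqrt ht.le
  have e1 : |poissonKerDeriv t y| = Real.pi⁻¹ * t * (2 * |y|) * ((y ^ 2 + t ^ 2)⁻¹) ^ 2 := by
    unfold poissonKerDeriv
    rw [abs_neg, abs_mul, abs_mul, abs_mul, abs_mul, abs_of_pos ht, abs_of_pos (by positivity :
      0 < Real.pi⁻¹), abs_of_pos (by positivity : 0 < ((y ^ 2 + t ^ 2)⁻¹) ^ 2), abs_two]
  have e2 : y ^ 2 + t ^ 2 = a ^ 4 + b ^ 4 := by
    rw [show a ^ 4 = (a ^ 2) ^ 2 by ring, show b ^ 4 = (b ^ 2) ^ 2 by ring, ha2, hb2, sq_abs]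
  have key : a ^ 3 * b ≤ a ^ 4 + b ^ 4 := by
    nlinarith [sq_nonneg (a ^ 2 - a * b), sq_nonneg (a * b - b ^ 2), sq_nonneg (a ^ 2 - b ^ 2),
      sq_nonneg (a ^ 2), sq_nonneg (b ^ 2), mul_nonneg ha0 hb0.le, sq_nonneg (a * b)]
  have e3 : a * |poissonKerDeriv t y| =
      (2 * Real.pi⁻¹ * ((y ^ 2 + t ^ 2)⁻¹) ^ 2 * b) * (a ^ 3 * b) := by
    rw [e1, ← ha2, ← hb2]; ring
  have e4 : 2 * b⁻¹ * poissonKer t y =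
      (2 * Real.pi⁻¹ * ((y ^ 2 + t ^ 2)⁻¹) ^ 2 * b) * (a ^ 4 + b ^ 4) := by
    rw [← e2]
    unfold poissonKer
    rw [show 2 * b⁻¹ * (Real.pi⁻¹ * t * (y ^ 2 + t ^ 2)⁻¹) =
      2 * b⁻¹ * (Real.pi⁻¹ * b ^ 2 * (y ^ 2 + t ^ 2)⁻¹) by rw [hb2]]
    field_simp
  rw [e3, e4]
  gcongr

theorem integral_poissonKer {t : ℝ} (ht : 0 < t) : ∫ y, poissonKer t y = 1 := by
  have := pois_eq_sub (u := fun _ => 1) ht 0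
  simp only [pois, one_mul, integral_cauchyKer] at this
  exact this.symm

theorem integrable_inv_sq_add {t : ℝ} (ht : 0 < t) : Integrable fun y : ℝ => (y ^ 2 + t ^ 2)⁻¹ := by
  refine ((integrable_poissonKer ht).const_mul (Real.pi * t⁻¹)).congr
    (Eventually.of_forall fun y => ?_)
  simp only [poissonKer]
  field_simp

theorem integrable_poissonKerDeriv {t : ℝ} (ht : 0 < t) : Integrable (poissonKerDeriv t) :=
  ((integrable_inv_sq_add ht).const_mul Real.pi⁻¹).mono'
    (continuous_poissonKerDeriv ht).aestronglyMeasurable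
    (Eventually.of_forall fun y => abs_poissonKerDeriv_le ht y)

theorem integral_poissonKerDeriv (t : ℝ) : ∫ y, poissonKerDeriv t y = 0 := by
  have h := integral_neg_eq_self (poissonKerDeriv t) volume
  have : ∀ y, poissonKerDeriv t (-y) = -poissonKerDeriv t y := by
    intro y; simp [poissonKerDeriv]
  simp_rw [this, integral_neg] at h
  linarith

theorem hasDerivAt_pois {u : ℝ → ℝ} {M : ℝ} (hu : Measurable u) (hM : ∀ x, |u x| ≤ M) {t : ℝ}
    (ht : 0 < t) (x : ℝ) : HasDerivAt (pois u t) (poisDeriv u t x) x := by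
  have hM0 : 0 ≤ M := (abs_nonneg _).trans (hM 0)
  have he : pois u t = fun x => ∫ y, u y * poissonKer t (x - y) := by
    ext x; exact pois_eq ht x
  rw [he]
  refine (hasDerivAt_integral_of_dominated_loc_of_deriv_le (Metric.ball_mem_nhds x ht)
    (F' := fun x y => u y * poissonKerDeriv t (x - y))
    (bound := fun y => M * (Real.pi⁻¹ * (3 * ((x - y) ^ 2 + t ^ 2)⁻¹)))
    (Eventually.of_forall fun x => ?_) ?_ ?_ ?_ ?_ ?_).2
  · exact (hu.mul ((continuous_poissonKer ht).measurable.comp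
      (by fun_prop))).aestronglyMeasurable
  · exact ((integrable_poissonKer ht).comp_sub_left x).bdd_mul (c := M) hu.aestronglyMeasurable
      (Eventually.of_forall fun w => hM _)
  · exact (hu.mul ((continuous_poissonKerDeriv ht).measurable.comp
      (by fun_prop))).aestronglyMeasurable
  · refine Eventually.of_forall fun y z hz => ?_
    rw [norm_mul]
    refine mul_le_mul (hM _) ((abs_poissonKerDeriv_le ht _).trans ?_) (norm_nonneg _) hM0
    gcongr
    have : |z - x| < t := by simpa [Real.dist_eq] using hz
    have h2 : (z - x) ^ 2 ≤ t ^ 2 := by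
      rw [← sq_abs]; gcongr
    rw [← div_eq_mul_inv, inv_eq_one_div, div_le_div_iff₀ (by positivity) (by positivity)]
    nlinarith [sq_nonneg ((z - y) + (z - x))]
  · exact ((((integrable_inv_sq_add ht).comp_sub_left x).const_mul 3).const_mul _).const_mul M
  · refine Eventually.of_forall fun y z _ => ?_
    exact ((hasDerivAt_poissonKer ht (z - y)).comp_sub_const z y).const_mul (u y)

theorem abs_poisDeriv_le {u : ℝ → ℝ} {M : ℝ} (hM : ∀ x, |u x| ≤ M) {t : ℝ}
    (ht : 0 < t) (x : ℝ) : |poisDeriv u t x| ≤ M * t⁻¹ := by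
  have hM0 : 0 ≤ M := (abs_nonneg _).trans (hM 0)
  have h1 : Integrable fun y => M * (t⁻¹ * poissonKer t (x - y)) :=
    (((integrable_poissonKer ht).comp_sub_left x).const_mul _).const_mul M
  refine (norm_integral_le_of_norm_le (f := fun y => u y * poissonKerDeriv t (x - y)) h1
    (Eventually.of_forall fun y => ?_)).trans (le_of_eq ?_)
  · rw [norm_mul]
    refine mul_le_mul (hM _) ((abs_poissonKerDeriv_le ht _).trans (le_of_eq ?_)) (norm_nonneg _) hM0
    unfold poissonKer
    field_simp
  · rw [integral_const_mul, integral_const_mul, integral_sub_left_eq_self, integral_poissonKer ht,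
      mul_one]

/-- As the kernel of the derivative has integral zero, `u x` may be subtracted from `u`, and its
Hölder continuity compensates half of the singularity at `t = 0`. -/
theorem abs_poisDeriv_le_of_holder {u : ℝ → ℝ} {M H : ℝ} (hu : Measurable u)
    (hM : ∀ x, |u x| ≤ M) (hH : ∀ x y, |u x - u y| ≤ H * √|x - y|) {t : ℝ}
    (ht : 0 < t) (x : ℝ) : |poisDeriv u t x| ≤ 2 * H * (√t)⁻¹ := by
  have i2 : Integrable fun y => poissonKerDeriv t (x - y) :=
    (integrable_poissonKerDeriv ht).comp_sub_left x
  have i1 : Integrable fun y => u y * poissonKerDeriv t (x - y) :=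
    i2.bdd_mul (c := M) hu.aestronglyMeasurable (Eventually.of_forall fun w => hM _)
  have e : poisDeriv u t x = ∫ y, (u y - u x) * poissonKerDeriv t (x - y) := by
    simp_rw [sub_mul]
    rw [integral_sub i1 (i2.const_mul _), integral_const_mul, integral_sub_left_eq_self,
      integral_poissonKerDeriv, mul_zero, sub_zero]
    rfl
  have hH0 : 0 ≤ H := by
    have := (abs_nonneg _).trans (hH 0 1)
    simpa using this
  have h1 : Integrable fun y => H * (2 * (√t)⁻¹ * poissonKer t (x - y)) :=
    (((integrable_poissonKer ht).comp_sub_left x).const_mul _).const_mul H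
  rw [e]
  refine (norm_integral_le_of_norm_le (f := fun y => (u y - u x) * poissonKerDeriv t (x - y)) h1
    (Eventually.of_forall fun y => ?_)).trans (le_of_eq ?_)
  · rw [norm_mul]
    calc _ ≤ (H * √|y - x|) * |poissonKerDeriv t (x - y)| := by
          gcongr
          · exact hH y x
          · exact le_of_eq rfl
      _ ≤ _ := by
          rw [mul_assoc, abs_sub_comm]
          exact mul_le_mul_of_nonneg_left (abs_poissonKerDeriv_mul_sqrt_le ht _) hH0
  · rw [integral_const_mul, integral_const_mul, integral_sub_left_eq_self, integral_poissonKer ht]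
    ring

theorem measurable_poisDeriv {u : ℝ → ℝ} (hu : Measurable u) :
    Measurable fun p : ℝ × ℝ => poisDeriv u p.1 p.2 := by
  have : StronglyMeasurable fun p : ℝ × ℝ => ∫ y, u y * poissonKerDeriv p.1 (p.2 - y) := by
    refine StronglyMeasurable.integral_prod_right
      (f := fun (p : ℝ × ℝ) y => u y * poissonKerDeriv p.1 (p.2 - y)) ?_
    refine Measurable.stronglyMeasurable ?_
    refine (hu.comp measurable_snd).mul ?_
    unfold poissonKerDeriv
    fun_prop
  exact this.measurable

/-- A Hölder continuous right-hand side makes the solution differentiable: the derivative of the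
Poisson kernel loses a factor `1/t`, of which Hölder continuity recovers the part `√t`. -/
theorem HasPoisRep.differentiable {u f : ℝ → ℝ} {M H : ℝ} (h : HasPoisRep u f) (hu : Measurable u)
    (hf : Measurable f) (huM : ∀ x, |u x| ≤ M) (hfM : ∀ x, |f x| ≤ M)
    (hH : ∀ x y, |f x - f y| ≤ H * √|x - y|) :
    Differentiable ℝ u ∧ ∀ x, |deriv u x| ≤ M + 4 * H := by
  have key : ∀ x, HasDerivAt u (poisDeriv u 1 x - ∫ t in (0 : ℝ)..1, poisDeriv f t x) x := by
    intro x
    have hu' : u = fun x => pois u 1 x - ∫ t in (0 : ℝ)..1, pois f t x := funext h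
    have e := hasDerivAt_pois hu huM one_pos x
    have e2 := (intervalIntegral.hasDerivAt_integral_of_dominated_loc_of_deriv_le
      (F := fun x t => pois f t x) (F' := fun x t => poisDeriv f t x) (x₀ := x) (a := 0) (b := 1)
      (bound := fun t => 2 * H * (√t)⁻¹) (μ := volume) univ_mem
      (Eventually.of_forall fun z => (measurable_pois_time hf z).aestronglyMeasurable)
      (intervalIntegrable_pois hf hfM x 0 1)
      ((measurable_poisDeriv hf).comp
        (by fun_prop : Measurable fun t : ℝ => (t, x))).aestronglyMeasurable
      (Eventually.of_forall fun t ht z _ => by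
        rw [uIoc_of_le zero_le_one] at ht
        exact abs_poisDeriv_le_of_holder hf hfM hH ht.1 z)
      (intervalIntegrable_inv_sqrt.const_mul _)
      (Eventually.of_forall fun t ht z _ => by
        rw [uIoc_of_le zero_le_one] at ht
        exact hasDerivAt_pois hf hfM ht.1 z)).2
    have e3 := e.sub e2
    exact e3.congr_of_eventuallyEq (Eventually.of_forall fun z => h z)
  refine ⟨fun x => (key x).differentiableAt, fun x => ?_⟩
  rw [(key x).deriv]
  have b1 := abs_poisDeriv_le huM one_pos x
  have b2 : |∫ t in (0 : ℝ)..1, poisDeriv f t x| ≤ 4 * H := by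
    have e : 4 * H = ∫ t in (0 : ℝ)..1, 2 * H * (√t)⁻¹ := by
      rw [intervalIntegral.integral_const_mul, integral_inv_sqrt]; ring
    rw [e]
    exact intervalIntegral.norm_integral_le_of_norm_le (f := fun t => poisDeriv f t x) zero_le_one
      (Eventually.of_forall fun t ht => abs_poisDeriv_le_of_holder hf hfM hH ht.1 x)
      (intervalIntegrable_inv_sqrt.const_mul _)
  refine (abs_sub _ _).trans ?_
  rw [inv_one, mul_one] at b1
  linarith

theorem hasDerivAt_pois_of_hasDerivAt {u u' : ℝ → ℝ} {M : ℝ} (hu : ∀ x, HasDerivAt u (u' x) x)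
    (hM : ∀ x, |u x| ≤ M) (hM' : ∀ x, |u' x| ≤ M) (t x : ℝ) :
    HasDerivAt (pois u t) (pois u' t x) x := by
  have hd : Differentiable ℝ u := fun x => (hu x).differentiableAt
  have hm : Measurable u := hd.continuous.measurable
  have hm' : Measurable u' := by
    have : u' = deriv u := funext fun x => (hu x).deriv.symm
    rw [this]; exact measurable_deriv u
  unfold pois
  refine (hasDerivAt_integral_of_dominated_loc_of_deriv_le (univ_mem : univ ∈ 𝓝 x)
    (F' := fun x w => u' (x - t * w) * cauchyKer w)
    (bound := fun w => M * cauchyKer w)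
    (Eventually.of_forall fun x => (integrable_pois hm hM t x).aestronglyMeasurable)
    (integrable_pois hm hM t x) (integrable_pois hm' hM' t x).aestronglyMeasurable ?_
    (integrable_cauchyKer.const_mul M) ?_).2
  · refine Eventually.of_forall fun w z _ => ?_
    rw [norm_mul, Real.norm_of_nonneg (cauchyKer_pos w).le]
    exact mul_le_mul_of_nonneg_right (hM' _) (cauchyKer_pos w).le
  · refine Eventually.of_forall fun w z _ => ?_
    exact ((hu (z - t * w)).comp_sub_const z (t * w)).mul_const (cauchyKer w)

/-- The Poisson representation may be differentiated. -/
theorem HasPoisRep.deriv {u f u' f' : ℝ → ℝ} {M : ℝ} (h : HasPoisRep u f)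
    (hu : ∀ x, HasDerivAt u (u' x) x) (hf : ∀ x, HasDerivAt f (f' x) x)
    (huM : ∀ x, |u x| ≤ M) (huM' : ∀ x, |u' x| ≤ M)
    (hfM : ∀ x, |f x| ≤ M) (hfM' : ∀ x, |f' x| ≤ M) : HasPoisRep u' f' := by
  intro x
  have hm : Measurable f :=
    (Differentiable.continuous fun x => (hf x).differentiableAt : Continuous f).measurable
  have hm' : Measurable f' := by
    have : f' = _root_.deriv f := funext fun x => (hf x).deriv.symm
    rw [this]; exact measurable_deriv f
  have e := hasDerivAt_pois_of_hasDerivAt hu huM huM' 1 x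
  have e2 := (intervalIntegral.hasDerivAt_integral_of_dominated_loc_of_deriv_le
    (F := fun x t => pois f t x) (F' := fun x t => pois f' t x) (x₀ := x) (a := 0) (b := 1)
    (bound := fun t => M) (μ := volume) univ_mem
    (Eventually.of_forall fun z => (measurable_pois_time hm z).aestronglyMeasurable)
    (intervalIntegrable_pois hm hfM x 0 1)
    (measurable_pois_time hm' x).aestronglyMeasurable
    (Eventually.of_forall fun t ht z _ => abs_pois_le hfM' t z)
    intervalIntegrable_const
    (Eventually.of_forall fun t ht z _ => hasDerivAt_pois_of_hasDerivAt hf hfM hfM' t z)).2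
  exact (hu x).unique ((e.sub e2).congr_of_eventuallyEq (Eventually.of_forall fun z => h z))

end

/-! ### The nonlocal equation in Poisson form -/

section

/-- The symmetric second difference `u (x + y) + u (x - y) - 2 u x`. -/
def secondDiff (u : ℝ → ℝ) (x y : ℝ) : ℝ := u (x + y) + u (x - y) - 2 * u x

section SecondDiff

variable {u : ℝ → ℝ} {M : ℝ} {K : ℝ≥0}

theorem abs_secondDiff_le_sq (hu : Differentiable ℝ u) (hK : LipschitzWith K (deriv u))
    (x y : ℝ) : |secondDiff u x y| ≤ 2 * K * y ^ 2 := by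
  have hd : ∀ z, HasDerivAt (fun z => u (x + z) + u (x - z) - 2 * u x)
      (deriv u (x + z) - deriv u (x - z)) z := by
    intro z
    have h1 := ((hu (x + z)).hasDerivAt).comp_const_add x z
    have h2 := ((hu (x - z)).hasDerivAt).comp_const_sub x z
    exact ((h1.add h2).sub_const (2 * u x)).congr_deriv (by ring)
  have hb : ∀ z ∈ Metric.closedBall (0 : ℝ) |y|,
      ‖deriv (fun z => u (x + z) + u (x - z) - 2 * u x) z‖ ≤ 2 * K * |y| := by
    intro z hz
    rw [(hd z).deriv]
    have := hK.dist_le_mul (x + z) (x - z)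
    rw [Real.dist_eq, Real.dist_eq, show x + z - (x - z) = 2 * z by ring, abs_mul, abs_two] at this
    rw [Real.norm_eq_abs]
    have hz' : |z| ≤ |y| := by simpa [Real.dist_eq] using hz
    calc _ ≤ _ := this
      _ ≤ K * (2 * |y|) := by gcongr
      _ = _ := by ring
  have := (convex_closedBall (0 : ℝ) |y|).norm_image_sub_le_of_norm_deriv_le
    (fun z _ => (hd z).differentiableAt) hb (x := 0) (y := y) (by simp) (by simp)
  simp only [add_zero, sub_zero, Real.norm_eq_abs] at this
  have e : secondDiff u x y = u (x + y) + u (x - y) - 2 * u x - (u x + u x - 2 * u x) := by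
    unfold secondDiff; ring
  rw [e]
  refine this.trans (le_of_eq ?_)
  rw [← sq_abs y]; ring

theorem abs_secondDiff_le (hM : ∀ x, |u x| ≤ M) (x y : ℝ) : |secondDiff u x y| ≤ 4 * M := by
  unfold secondDiff
  have h1 := abs_le.mp (hM (x + y))
  have h2 := abs_le.mp (hM (x - y))
  have h3 := abs_le.mp (hM x)
  rw [abs_le]
  constructor <;> linarith

theorem abs_secondDiff_div_le (hu : Differentiable ℝ u) (hK : LipschitzWith K (deriv u))
    (hM : ∀ x, |u x| ≤ M) (x y : ℝ) :
    |secondDiff u x y / y ^ 2| ≤ (4 * K + 8 * M) * (1 + y ^ 2)⁻¹ := by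
  have hM0 : 0 ≤ M := (abs_nonneg _).trans (hM 0)
  rcases eq_or_ne y 0 with rfl | hy
  · simp; positivity
  have hy2 : 0 < y ^ 2 := by positivity
  rw [abs_div, abs_of_pos hy2, ← div_eq_mul_inv, div_le_div_iff₀ hy2 (by positivity)]
  have h1 := abs_secondDiff_le_sq hu hK x y
  have h2 := abs_secondDiff_le hM x y
  have hK0 : (0 : ℝ) ≤ K := K.2
  nlinarith

theorem integrable_secondDiff_div (hu : Differentiable ℝ u) (hK : LipschitzWith K (deriv u))
    (hM : ∀ x, |u x| ≤ M) (x : ℝ) : Integrable fun y => secondDiff u x y / y ^ 2 := by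
  refine (integrable_inv_one_add_sq.const_mul (4 * K + 8 * M)).mono' ?_
    (Eventually.of_forall fun y => abs_secondDiff_div_le hu hK hM x y)
  have := hu.continuous.measurable
  unfold secondDiff
  exact Measurable.aestronglyMeasurable (by fun_prop)

/-- For functions with Lipschitz derivative the principal value is an absolutely convergent
integral of second differences. -/
theorem HasI1.eq_integral (hu : Differentiable ℝ u) (hK : LipschitzWith K (deriv u))
    (hM : ∀ x, |u x| ≤ M) {x L : ℝ} (h : HasI1 u x L) :
    L = 1 / 2 * ∫ y, secondDiff u x y / y ^ 2 := by
  have hM0 : 0 ≤ M := (abs_nonneg _).trans (hM 0)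
  refine tendsto_nhds_unique h ?_
  have hmeas : ∀ δ : ℝ, MeasurableSet {y : ℝ | δ < |y|} := fun δ =>
    measurableSet_lt measurable_const (by fun_prop)
  have hum := hu.continuous.measurable
  have e : ∀ δ > 0, ∫ y in {y : ℝ | δ < |y|}, (u (x + y) - u x) / |y| ^ 2 =
      1 / 2 * ∫ y, {y : ℝ | δ < |y|}.indicator (fun y => secondDiff u x y / y ^ 2) y := by
    intro δ hδ
    set F : ℝ → ℝ := {y : ℝ | δ < |y|}.indicator fun y => (u (x + y) - u x) / |y| ^ 2 with hF
    have hFi : Integrable F := by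
      refine (integrable_inv_one_add_sq.const_mul (2 * M * (1 + 1 / δ ^ 2))).mono'
        ((Measurable.indicator (by fun_prop) (hmeas δ)).aestronglyMeasurable)
        (Eventually.of_forall fun y => ?_)
      by_cases hy : δ < |y|
      · have hy2 : δ ^ 2 < y ^ 2 := by rw [← sq_abs y]; gcongr
        have hy0 : 0 < y ^ 2 := (by positivity : 0 < δ ^ 2).trans hy2
        rw [hF, indicator_of_mem (by exact hy), sq_abs, norm_div, Real.norm_of_nonneg hy0.le,
          ← div_eq_mul_inv, div_le_div_iff₀ hy0 (by positivity)]
        have h1 : ‖u (x + y) - u x‖ ≤ 2 * M :=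
          (abs_sub _ _).trans (by linarith [hM (x + y), hM x])
        have h2 : 1 + y ^ 2 ≤ (1 + 1 / δ ^ 2) * y ^ 2 := by
          have : 1 ≤ 1 / δ ^ 2 * y ^ 2 := by
            rw [one_div_mul_eq_div, one_le_div (by positivity)]; exact hy2.le
          linarith
        calc _ ≤ 2 * M * ((1 + 1 / δ ^ 2) * y ^ 2) := by gcongr
          _ = _ := by ring
      · rw [hF, indicator_of_notMem (by exact hy), norm_zero]
        positivity
    have h1 : ∫ y, F y = ∫ y, F (-y) := (integral_neg_eq_self F volume).symm
    have h2 : ∫ y in {y : ℝ | δ < |y|}, (u (x + y) - u x) / |y| ^ 2 = ∫ y, F y :=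
      (integral_indicator (hmeas δ)).symm
    have h3 : ∫ y, {y : ℝ | δ < |y|}.indicator (fun y => secondDiff u x y / y ^ 2) y
        = (∫ y, F y) + ∫ y, F (-y) := by
      rw [← integral_add hFi hFi.comp_neg]
      congr 1; ext y
      by_cases hy : δ < |y|
      · have hy' : δ < |-y| := by rwa [abs_neg]
        rw [hF, indicator_of_mem (by exact hy), indicator_of_mem (by exact hy),
          indicator_of_mem (by exact hy'), abs_neg, sq_abs]
        unfold secondDiff
        rw [← sub_eq_add_neg]
        ring
      · have hy' : ¬ δ < |-y| := by rwa [abs_neg]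
        rw [hF, indicator_of_notMem (by exact hy), indicator_of_notMem (by exact hy),
          indicator_of_notMem (by exact hy'), add_zero]
    rw [h2, h3, ← h1]; ring
  have hlim : Tendsto (fun δ : ℝ => ∫ y, {y : ℝ | δ < |y|}.indicator
      (fun y => secondDiff u x y / y ^ 2) y) (𝓝[>] 0) (𝓝 (∫ y, secondDiff u x y / y ^ 2)) := by
    refine tendsto_integral_filter_of_dominated_convergence
      (fun y => |secondDiff u x y / y ^ 2|) (Eventually.of_forall fun δ => ?_)
      (Eventually.of_forall fun δ => Eventually.of_forall fun y => ?_)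
      (integrable_secondDiff_div hu hK hM x).abs ?_
    · exact (integrable_secondDiff_div hu hK hM x).aestronglyMeasurable.indicator (hmeas δ)
    · exact norm_indicator_le_norm_self _ _
    · have : ∀ᵐ y : ℝ, y ≠ 0 := by simp [ae_iff, measure_singleton]
      filter_upwards [this] with y hy
      refine tendsto_const_nhds.congr' ?_
      have hy' : ∀ᶠ δ in 𝓝[>] (0 : ℝ), δ < |y| :=
        nhdsWithin_le_nhds (gt_mem_nhds (abs_pos.mpr hy))
      filter_upwards [hy'] with δ hδ
      rw [indicator_of_mem (by exact hδ)]
  refine (hlim.const_mul (1 / 2)).congr' ?_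
  filter_upwards [self_mem_nhdsWithin] with δ hδ
  exact (e δ hδ).symm

theorem pois_sub_self_eq (hu : Continuous u) (hM : ∀ x, |u x| ≤ M) {δ : ℝ} (hδ : 0 < δ) (x : ℝ) :
    pois u δ x - u x = 1 / 2 * ∫ y, secondDiff u x y * poissonKer δ y := by
  have i0 := integrable_poissonKer hδ
  have i1 : ∀ v : ℝ → ℝ, Continuous v → Integrable fun y => u (v y) * poissonKer δ y :=
    fun v hv => i0.bdd_mul (c := M) (hu.comp hv).aestronglyMeasurable
      (Eventually.of_forall fun w => hM _)
  have h1 := pois_eq_sub (u := u) hδ x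
  have h2 : pois u δ x = ∫ y, u (x + y) * poissonKer δ y := by
    rw [h1, ← integral_neg_eq_self]
    simp only [sub_neg_eq_add, poissonKer_neg]
  have h3 : ∫ y, secondDiff u x y * poissonKer δ y =
      (∫ y, u (x + y) * poissonKer δ y) + (∫ y, u (x - y) * poissonKer δ y) - 2 * u x := by
    have : ∀ y, secondDiff u x y * poissonKer δ y = u (x + y) * poissonKer δ y +
        u (x - y) * poissonKer δ y - 2 * u x * poissonKer δ y := fun y => by
      unfold secondDiff; ring
    simp_rw [this]
    have j1 := i1 (fun y => x + y) (by fun_prop)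
    have j2 := i1 (fun y => x - y) (by fun_prop)
    rw [integral_sub (by exact j1.add j2) (i0.const_mul _), integral_add j1 j2,
      integral_const_mul,
      integral_poissonKer hδ, mul_one]
  rw [h3, ← h1, ← h2]; ring

theorem abs_secondDiff_mul_poissonKer_le (hu : Differentiable ℝ u)
    (hK : LipschitzWith K (deriv u)) (hM : ∀ x, |u x| ≤ M) {δ : ℝ} (hδ : 0 < δ) (x y : ℝ) :
    |δ⁻¹ * (secondDiff u x y * poissonKer δ y)| ≤
      Real.pi⁻¹ * ((4 * K + 8 * M) * (1 + y ^ 2)⁻¹) := by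
  have h0 : secondDiff u x 0 = 0 := by unfold secondDiff; simp; ring
  have hM0 : 0 ≤ M := (abs_nonneg _).trans (hM 0)
  rcases eq_or_ne y 0 with rfl | hy
  · rw [h0]; simp; positivity
  have hy2 : 0 < y ^ 2 := by positivity
  have e : δ⁻¹ * (secondDiff u x y * poissonKer δ y) =
      Real.pi⁻¹ * (secondDiff u x y / y ^ 2) * (y ^ 2 * (y ^ 2 + δ ^ 2)⁻¹) := by
    unfold poissonKer; field_simp
  have h1 : y ^ 2 * (y ^ 2 + δ ^ 2)⁻¹ ≤ 1 := by
    rw [← div_eq_mul_inv, div_le_one (by positivity)]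
    nlinarith
  rw [e, abs_mul, abs_mul, abs_of_pos (by positivity : 0 < Real.pi⁻¹),
    abs_of_pos (by positivity : 0 < y ^ 2 * (y ^ 2 + δ ^ 2)⁻¹)]
  calc _ ≤ Real.pi⁻¹ * |secondDiff u x y / y ^ 2| * 1 := by gcongr
    _ ≤ _ := by
      rw [mul_one]
      gcongr
      exact abs_secondDiff_div_le hu hK hM x y

theorem abs_pois_sub_self_le (hu : Differentiable ℝ u) (hK : LipschitzWith K (deriv u))
    (hM : ∀ x, |u x| ≤ M) {δ : ℝ} (hδ : 0 < δ) (x : ℝ) :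
    |δ⁻¹ * (pois u δ x - u x)| ≤ 2 * K + 4 * M := by
  rw [pois_sub_self_eq hu.continuous hM hδ, mul_left_comm, abs_mul]
  have := norm_integral_le_of_norm_le
    (f := fun y => δ⁻¹ * (secondDiff u x y * poissonKer δ y))
    ((integrable_inv_one_add_sq.const_mul (4 * K + 8 * M)).const_mul Real.pi⁻¹)
    (Eventually.of_forall fun y => abs_secondDiff_mul_poissonKer_le hu hK hM hδ x y)
  rw [integral_const_mul, integral_const_mul, integral_const_mul, integral_univ_inv_one_add_sq,
    Real.norm_eq_abs] at this
  have e : Real.pi⁻¹ * ((4 * K + 8 * M) * Real.pi) = 4 * K + 8 * M := by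
    field_simp
  rw [e] at this
  rw [abs_of_pos (by norm_num : (0 : ℝ) < 1 / 2)]
  linarith

theorem tendsto_pois_sub_self (hu : Differentiable ℝ u) (hK : LipschitzWith K (deriv u))
    (hM : ∀ x, |u x| ≤ M) (x : ℝ) :
    Tendsto (fun δ => δ⁻¹ * (pois u δ x - u x)) (𝓝[>] 0)
      (𝓝 (Real.pi⁻¹ * (1 / 2 * ∫ y, secondDiff u x y / y ^ 2))) := by
  have hum := hu.continuous.measurable
  have h1 : Tendsto (fun δ => ∫ y, δ⁻¹ * (secondDiff u x y * poissonKer δ y)) (𝓝[>] 0)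
      (𝓝 (∫ y, Real.pi⁻¹ * (secondDiff u x y / y ^ 2))) := by
    refine tendsto_integral_filter_of_dominated_convergence
      (fun y => Real.pi⁻¹ * ((4 * K + 8 * M) * (1 + y ^ 2)⁻¹)) (Eventually.of_forall fun δ => ?_)
      ?_ ((integrable_inv_one_add_sq.const_mul _).const_mul _) ?_
    · unfold secondDiff poissonKer
      exact Measurable.aestronglyMeasurable (by fun_prop)
    · filter_upwards [self_mem_nhdsWithin] with δ hδ
      exact Eventually.of_forall fun y => abs_secondDiff_mul_poissonKer_le hu hK hM hδ x y
    · have : ∀ᵐ y : ℝ, y ≠ 0 := by simp [ae_iff, measure_singleton]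
      filter_upwards [this] with y hy
      have hy2 : 0 < y ^ 2 := by positivity
      have h2 : Tendsto (fun δ : ℝ => Real.pi⁻¹ * (secondDiff u x y * (y ^ 2 + δ ^ 2)⁻¹)) (𝓝[>] 0)
          (𝓝 (Real.pi⁻¹ * (secondDiff u x y * (y ^ 2 + 0 ^ 2)⁻¹))) := by
        refine Tendsto.mono_left ?_ nhdsWithin_le_nhds
        refine Tendsto.const_mul _ (Tendsto.const_mul _ ?_)
        exact Tendsto.inv₀ (((continuous_id.pow 2).tendsto 0).const_add _) (by positivity)
      simp only [ne_eq, OfNat.ofNat_ne_zero, not_false_eq_true, zero_pow, add_zero] at h2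
      rw [div_eq_mul_inv]
      refine h2.congr' ?_
      filter_upwards [self_mem_nhdsWithin] with δ hδ
      have hδ' : (0 : ℝ) < δ := hδ
      unfold poissonKer
      field_simp
  rw [integral_const_mul] at h1
  refine ((h1.const_mul (1 / 2)).congr' ?_).trans (le_of_eq (by congr 1; ring))
  filter_upwards [self_mem_nhdsWithin] with δ hδ
  rw [pois_sub_self_eq hu.continuous hM hδ, integral_const_mul]
  ring

/-- The right derivative of `P_t u` in `t` is `P_t` of the generator `π⁻¹ I₁[u]`. By the semigroup
law the difference quotient at `t` is `P_t` of the one at `0`; increments `δ < t` avoid the excluded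
case of equal times in that law. -/
theorem hasDerivWithinAt_pois_time (hu : Differentiable ℝ u) (hK : LipschitzWith K (deriv u))
    (hM : ∀ x, |u x| ≤ M) {t : ℝ} (ht : 0 < t) (x : ℝ) :
    HasDerivWithinAt (fun t => pois u t x)
      (pois (fun x => Real.pi⁻¹ * (1 / 2 * ∫ y, secondDiff u x y / y ^ 2)) t x) (Ioi t) t := by
  have hum := hu.continuous.measurable
  have h1 : Tendsto (fun δ => pois (fun x => δ⁻¹ * (pois u δ x - u x)) t x) (𝓝[>] 0)
      (𝓝 (pois (fun x => Real.pi⁻¹ * (1 / 2 * ∫ y, secondDiff u x y / y ^ 2)) t x)) := by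
    unfold pois
    refine tendsto_integral_filter_of_dominated_convergence
      (fun w => (2 * K + 4 * M) * cauchyKer w) (Eventually.of_forall fun δ => ?_)
      ?_ (integrable_cauchyKer.const_mul _) ?_
    · have : Measurable fun x => δ⁻¹ * (pois u δ x - u x) :=
        (((measurable_pois hum).comp (by fun_prop : Measurable fun x : ℝ => (δ, x))).sub
          hum).const_mul _
      exact ((this.comp (by fun_prop : Measurable fun w : ℝ => x - t * w)).mul
        measurable_cauchyKer).aestronglyMeasurable
    · filter_upwards [self_mem_nhdsWithin] with δ hδ
      refine Eventually.of_forall fun w => ?_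
      rw [norm_mul, Real.norm_of_nonneg (cauchyKer_pos w).le]
      exact mul_le_mul_of_nonneg_right (abs_pois_sub_self_le hu hK hM hδ _) (cauchyKer_pos w).le
    · exact Eventually.of_forall fun w => (tendsto_pois_sub_self hu hK hM _).mul_const _
  rw [hasDerivWithinAt_iff_tendsto_slope' (by simp)]
  have h2 : Tendsto (fun s => s - t) (𝓝[>] t) (𝓝[>] 0) := by
    refine tendsto_nhdsWithin_iff.mpr ⟨?_, ?_⟩
    · refine Tendsto.mono_left ?_ nhdsWithin_le_nhds
      have : Tendsto (fun s => s - t) (𝓝 t) (𝓝 (t - t)) := (continuous_id.sub continuous_const).tendsto t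
      rwa [sub_self] at this
    · filter_upwards [self_mem_nhdsWithin] with s hs
      exact sub_pos.mpr (mem_Ioi.mp hs)
  refine (h1.comp h2).congr' ?_
  have h3 : ∀ᶠ s in 𝓝[>] t, s < 2 * t := nhdsWithin_le_nhds (gt_mem_nhds (by linarith))
  filter_upwards [self_mem_nhdsWithin, h3] with s hs hs2
  have hδ : 0 < s - t := sub_pos.mpr hs
  have hp : Measurable fun y => pois u (s - t) y :=
    (measurable_pois hum).comp (by fun_prop : Measurable fun x : ℝ => (s - t, x))
  simp only [Function.comp]
  rw [pois_const_mul, pois_sub hp (fun x => abs_pois_le hM _ x) hum hM,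
    pois_pois hum hM hδ ht (by linarith), sub_add_cancel, slope_def_field, div_eq_inv_mul]

/-- A function with Lipschitz derivative for which `I₁[u] = L` holds everywhere has the Poisson
representation with right-hand side `L/π`, since `∂ₜ P_t = P_t * π⁻¹ I₁`. -/
theorem hasPoisRep_of_hasI1 (hu : Differentiable ℝ u) (hK : LipschitzWith K (deriv u))
    (hM : ∀ x, |u x| ≤ M) {L : ℝ → ℝ} (hL : ∀ x, HasI1 u x (L x)) :
    HasPoisRep u fun x => Real.pi⁻¹ * L x := by
  have hum := hu.continuous.measurable
  have hLe : (fun x => Real.pi⁻¹ * L x) =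
      fun x => Real.pi⁻¹ * (1 / 2 * ∫ y, secondDiff u x y / y ^ 2) := by
    ext x; rw [(hL x).eq_integral hu hK hM]
  have hLm : Measurable fun x => Real.pi⁻¹ * L x := by
    rw [hLe]
    have : StronglyMeasurable fun x => ∫ y, secondDiff u x y / y ^ 2 := by
      refine StronglyMeasurable.integral_prod_right (f := fun x y => secondDiff u x y / y ^ 2) ?_
      refine Measurable.stronglyMeasurable ?_
      unfold secondDiff Function.uncurry
      fun_prop
    exact (this.measurable.const_mul _).const_mul _
  have hLb : ∀ x, |Real.pi⁻¹ * L x| ≤ 2 * K + 4 * M := by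
    intro x
    rw [show Real.pi⁻¹ * L x = Real.pi⁻¹ * (1 / 2 * ∫ y, secondDiff u x y / y ^ 2) from
      congrFun hLe x]
    refine le_of_tendsto (tendsto_pois_sub_self hu hK hM x).abs ?_
    filter_upwards [self_mem_nhdsWithin] with δ hδ
    exact abs_pois_sub_self_le hu hK hM hδ x
  intro x
  have := intervalIntegral.integral_eq_sub_of_hasDeriv_right (a := 0) (b := 1)
    (f := fun t => pois u t x) (f' := fun t => pois (fun x => Real.pi⁻¹ * L x) t x)
    (continuous_pois_time hu.continuous hM x).continuousOn
    (fun t ht => by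
      rw [min_eq_left zero_le_one] at ht
      rw [hLe]
      exact hasDerivWithinAt_pois_time hu hK hM ht.1 x)
    (intervalIntegrable_pois hLm hLb x 0 1)
  rw [this, pois_zero]
  ring

end SecondDiff

end

/-! ### Regularity in the mean -/

section

/-- Bounded functions that are Hölder continuous with exponent `1/2`. -/
def BddHolder (u : ℝ → ℝ) : Prop :=
  ∃ M, (∀ x, |u x| ≤ M) ∧ ∀ x y, |u x - u y| ≤ M * √|x - y|

/-- Integrable functions that are Hölder continuous in `L¹` with exponent `1/2`. -/
def L1Holder (u : ℝ → ℝ) : Prop :=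
  Integrable u ∧ ∃ M, ∀ s, ∫ x, |u (x + s) - u x| ≤ M * √|s|

theorem BddHolder.of_lipschitz {u : ℝ → ℝ} {M L : ℝ} (hM : ∀ x, |u x| ≤ M)
    (hL : ∀ x y, |u x - u y| ≤ L * |x - y|) : BddHolder u := by
  have hM0 : 0 ≤ M := (abs_nonneg _).trans (hM 0)
  have hL0 : 0 ≤ L := by
    have := (abs_nonneg _).trans (hL 1 0)
    simpa using this
  refine ⟨2 * M + L, fun x => (hM x).trans (by linarith), fun x y => ?_⟩
  have h1 := hL x y
  have h2 : |u x - u y| ≤ 2 * M := (abs_sub _ _).trans (by linarith [hM x, hM y])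
  rcases le_total |x - y| 1 with h | h
  · have : |x - y| ≤ √|x - y| := Real.le_sqrt_of_sq_le (by nlinarith [abs_nonneg (x - y)])
    nlinarith [Real.sqrt_nonneg |x - y|]
  · have : 1 ≤ √|x - y| := Real.one_le_sqrt.mpr h
    nlinarith

theorem BddHolder.of_hasDerivAt {u u' : ℝ → ℝ} {M L : ℝ} (hM : ∀ x, |u x| ≤ M)
    (hu : ∀ x, HasDerivAt u (u' x) x) (hL : ∀ x, |u' x| ≤ L) : BddHolder u :=
  .of_lipschitz hM fun x y => convex_univ.norm_image_sub_le_of_norm_hasDerivWithin_le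
    (fun z _ => (hu z).hasDerivWithinAt) (fun z _ => hL z) (mem_univ y) (mem_univ x)

theorem BddHolder.const_mul {u : ℝ → ℝ} (hu : BddHolder u) (c : ℝ) :
    BddHolder fun x => c * u x := by
  obtain ⟨M, h1, h2⟩ := hu
  refine ⟨|c| * M, fun x => ?_, fun x y => ?_⟩
  · rw [abs_mul]; exact mul_le_mul_of_nonneg_left (h1 x) (abs_nonneg c)
  · rw [← mul_sub, abs_mul, mul_assoc]; exact mul_le_mul_of_nonneg_left (h2 x y) (abs_nonneg c)

theorem BddHolder.add {u v : ℝ → ℝ} (hu : BddHolder u) (hv : BddHolder v) :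
    BddHolder fun x => u x + v x := by
  obtain ⟨M, h1, h2⟩ := hu
  obtain ⟨N, h3, h4⟩ := hv
  refine ⟨M + N, fun x => (abs_add_le _ _).trans (add_le_add (h1 x) (h3 x)), fun x y => ?_⟩
  rw [add_sub_add_comm, add_mul]
  exact (abs_add_le _ _).trans (add_le_add (h2 x y) (h4 x y))

theorem abs_mul_sub_mul_le (a b c d : ℝ) : |a * b - c * d| ≤ |a| * |b - d| + |a - c| * |d| := by
  rw [← abs_mul, ← abs_mul]
  refine le_trans (le_of_eq ?_) (abs_add_le _ _)
  congr 1; ring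

theorem BddHolder.mul {u v : ℝ → ℝ} (hu : BddHolder u) (hv : BddHolder v) :
    BddHolder fun x => u x * v x := by
  obtain ⟨M, h1, h2⟩ := hu
  obtain ⟨N, h3, h4⟩ := hv
  have hM0 : 0 ≤ M := (abs_nonneg _).trans (h1 0)
  have hN0 : 0 ≤ N := (abs_nonneg _).trans (h3 0)
  refine ⟨2 * (M * N), fun x => ?_, fun x y => ?_⟩
  · rw [abs_mul]
    have := mul_le_mul (h1 x) (h3 x) (abs_nonneg _) hM0
    nlinarith [mul_nonneg hM0 hN0]
  · calc _ ≤ _ := abs_mul_sub_mul_le _ _ _ _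
      _ ≤ M * (N * √|x - y|) + (M * √|x - y|) * N := by
        gcongr
        · exact h1 x
        · exact h4 x y
        · exact h2 x y
        · exact h3 y
      _ = _ := by ring

theorem L1Holder.add {u v : ℝ → ℝ} (hu : L1Holder u) (hv : L1Holder v) :
    L1Holder fun x => u x + v x := by
  obtain ⟨hui, M, h2⟩ := hu
  obtain ⟨hvi, N, h4⟩ := hv
  refine ⟨hui.add hvi, M + N, fun s => ?_⟩
  have iu := ((hui.comp_add_right s).sub hui).abs
  have iv := ((hvi.comp_add_right s).sub hvi).abs
  have := integral_mono_of_nonneg (Eventually.of_forall fun x => abs_nonneg _) (iu.add iv)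
    (f := fun x => |u (x + s) + v (x + s) - (u x + v x)|) (Eventually.of_forall fun x => by
      simp only [Pi.add_apply, Pi.sub_apply]
      rw [add_sub_add_comm]
      exact abs_add_le _ _)
  simp only [Pi.add_apply] at this
  rw [integral_add iu iv] at this
  simp only [Pi.sub_apply] at this
  linarith [h2 s, h4 s]

theorem BddHolder.mul_L1Holder {u v : ℝ → ℝ} (hu : BddHolder u) (hum : Measurable u)
    (hv : L1Holder v) : L1Holder fun x => u x * v x := by
  obtain ⟨M, h1, h2⟩ := hu
  obtain ⟨hvi, N, h4⟩ := hv
  have hM0 : 0 ≤ M := (abs_nonneg _).trans (h1 0)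
  refine ⟨hvi.bdd_mul (c := M) hum.aestronglyMeasurable (Eventually.of_forall h1),
    M * N + M * ∫ x, |v x|, fun s => ?_⟩
  have iv := ((hvi.comp_add_right s).sub hvi).abs
  have := integral_mono_of_nonneg (Eventually.of_forall fun x => abs_nonneg _)
    ((iv.const_mul M).add (hvi.abs.const_mul (M * √|s|)))
    (f := fun x => |u (x + s) * v (x + s) - u x * v x|) (Eventually.of_forall fun x => by
      simp only [Pi.add_apply, Pi.sub_apply]
      refine (abs_mul_sub_mul_le _ _ _ _).trans ?_
      have := h2 (x + s) x
      rw [add_sub_cancel_left] at this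
      gcongr
      exact h1 _)
  simp only [Pi.add_apply] at this
  rw [integral_add (iv.const_mul M) (hvi.abs.const_mul _), integral_const_mul,
    integral_const_mul] at this
  simp only [Pi.sub_apply] at this
  have h5 := mul_le_mul_of_nonneg_left (h4 s) hM0
  linarith

/-- The pairing `s ↦ ∫ u (x + s) g x dx` of the translates of `u` with `g`. -/
def pairing (u g : ℝ → ℝ) (s : ℝ) : ℝ := ∫ x, u (x + s) * g x

section Pairing

variable {u g : ℝ → ℝ}

theorem integrable_pairing (hui : Integrable u) (hg : Measurable g) (hg1 : ∀ x, |g x| ≤ 1) (s : ℝ) :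
    Integrable fun x => u (x + s) * g x :=
  (hui.comp_add_right s).mul_bdd (c := 1) hg.aestronglyMeasurable (Eventually.of_forall hg1)

theorem abs_pairing_le (hui : Integrable u) (hg1 : ∀ x, |g x| ≤ 1) (s : ℝ) :
    |pairing u g s| ≤ ∫ x, |u x| := by
  rw [← integral_add_right_eq_self (fun x => |u x|) s]
  refine norm_integral_le_of_norm_le (f := fun x => u (x + s) * g x)
    (hui.comp_add_right s).abs (Eventually.of_forall fun x => ?_)
  rw [norm_mul]
  exact mul_le_of_le_one_right (norm_nonneg _) (hg1 x)

theorem measurable_pairing (hu : Measurable u) (hg : Measurable g) : Measurable (pairing u g) := by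
  have : StronglyMeasurable fun s => ∫ x, u (x + s) * g x := by
    refine StronglyMeasurable.integral_prod_right (f := fun s x => u (x + s) * g x) ?_
    refine Measurable.stronglyMeasurable ?_
    exact (hu.comp (by fun_prop)).mul (hg.comp measurable_snd)
  exact this.measurable

theorem integrable_pois_prod (hu : Measurable u) (hui : Integrable u) (t s : ℝ) :
    Integrable (fun p : ℝ × ℝ => u (p.2 + s - t * p.1) * cauchyKer p.1)
      (volume.prod volume) := by
  have hm : Measurable fun p : ℝ × ℝ => u (p.2 + s - t * p.1) * cauchyKer p.1 :=
    (hu.comp (by fun_prop)).mul (measurable_cauchyKer.comp measurable_fst)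
  have e : ∀ w x : ℝ, x + s - t * w = x + (s - t * w) := fun w x => by ring
  refine (integrable_prod_iff hm.aestronglyMeasurable).mpr ⟨Eventually.of_forall fun w => ?_, ?_⟩
  · simp only [e]
    exact (hui.comp_add_right _).mul_const _
  · simp only [e, norm_mul]
    have : ∀ w, ∫ x, ‖u (x + (s - t * w))‖ * ‖cauchyKer w‖ = (∫ x, ‖u x‖) * ‖cauchyKer w‖ := by
      intro w
      rw [integral_mul_const, integral_add_right_eq_self (fun x => ‖u x‖)]
    simp only [this]
    exact integrable_cauchyKer.norm.const_mul _

theorem integrable_pois_space (hu : Measurable u) (hui : Integrable u) (t : ℝ) :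
    Integrable (pois u t) ∧ ∫ x, |pois u t x| ≤ ∫ x, |u x| := by
  have h := integrable_pois_prod hu hui t 0
  simp only [add_zero] at h
  refine ⟨h.integral_prod_right, ?_⟩
  have h2 : ∫ x, |pois u t x| ≤ ∫ x, ∫ w, ‖u (x - t * w) * cauchyKer w‖ :=
    integral_mono h.integral_prod_right.abs h.norm.integral_prod_right
      (fun x => norm_integral_le_integral_norm fun w => u (x - t * w) * cauchyKer w)
  refine h2.trans (le_of_eq ?_)
  rw [integral_integral_swap (f := fun x w => ‖u (x - t * w) * cauchyKer w‖) h.norm.swap]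
  simp only [norm_mul]
  have : ∀ w, ∫ x, ‖u (x - t * w)‖ * ‖cauchyKer w‖ = (∫ x, ‖u x‖) * cauchyKer w := by
    intro w
    rw [integral_mul_const, integral_sub_right_eq_self (fun x => ‖u x‖),
      Real.norm_of_nonneg (cauchyKer_pos w).le]
  simp only [this]
  rw [integral_const_mul, integral_cauchyKer, mul_one]
  rfl

theorem pois_pairing (hu : Measurable u) (hui : Integrable u) (hg : Measurable g)
    (hg1 : ∀ x, |g x| ≤ 1) (t s : ℝ) : pois (pairing u g) t s = pairing (pois u t) g s := by
  unfold pois pairing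
  simp_rw [← integral_mul_const]
  rw [integral_integral_swap]
  · congr 1; ext x; congr 1; ext w
    rw [show x + (s - t * w) = x + s - t * w by ring]; ring
  · have h := (integrable_pois_prod hu hui t s).mul_bdd (c := 1) (g := fun p : ℝ × ℝ => g p.2)
      (hg.comp measurable_snd).aestronglyMeasurable (Eventually.of_forall fun p => hg1 _)
    refine h.congr (Eventually.of_forall fun p => ?_)
    simp only [Function.uncurry]
    rw [show p.2 + (s - t * p.1) = p.2 + s - t * p.1 by ring]; ring

/-- Pairing the translates of a solution with a bounded function `g` gives again a solution. Taking
`g` a sign turns sup-norm estimates into `L¹` estimates. -/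
theorem HasPoisRep.pairing {f : ℝ → ℝ} (h : HasPoisRep u f) (hu : Measurable u)
    (hf : Measurable f) (hui : Integrable u) (hfi : Integrable f)
    (hg : Measurable g) (hg1 : ∀ x, |g x| ≤ 1) :
    HasPoisRep (pairing u g) (pairing f g) := by
  intro s
  simp_rw [pois_pairing hu hui hg hg1, pois_pairing hf hfi hg hg1]
  have hmt : Measurable fun p : ℝ × ℝ => pois f p.1 (p.2 + s) * g p.2 :=
    ((measurable_pois hf).comp (by fun_prop : Measurable fun p : ℝ × ℝ => (p.1, p.2 + s))).mul
      (hg.comp measurable_snd)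
  have hprod : Integrable (fun p : ℝ × ℝ => pois f p.1 (p.2 + s) * g p.2)
      ((volume.restrict (Ioc 0 1)).prod volume) := by
    refine (integrable_prod_iff hmt.aestronglyMeasurable).mpr
      ⟨Eventually.of_forall fun t => ?_, ?_⟩
    · exact integrable_pairing (integrable_pois_space hf hfi t).1 hg hg1 s
    · refine Measure.integrableOn_of_bounded (M := ∫ x, |f x|) (by simp)
        hmt.stronglyMeasurable.norm.integral_prod_right'.aestronglyMeasurable
        (Eventually.of_forall fun t => ?_)
      rw [Real.norm_of_nonneg (integral_nonneg fun _ => norm_nonneg _)]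
      refine le_trans ?_ (integrable_pois_space hf hfi t).2
      rw [← integral_add_right_eq_self (fun x => |pois f t x|) s]
      refine integral_mono (integrable_pairing (integrable_pois_space hf hfi t).1 hg hg1 s).norm
        ((integrable_pois_space hf hfi t).1.comp_add_right s).abs fun x => ?_
      simp only [norm_mul]
      exact mul_le_of_le_one_right (norm_nonneg _) (hg1 x)
  have e1 : ∫ t in (0 : ℝ)..1, Dislocation.pairing (pois f t) g s =
      ∫ x, (∫ t in (0 : ℝ)..1, pois f t (x + s)) * g x := by
    rw [intervalIntegral.integral_of_le zero_le_one]
    unfold Dislocation.pairing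
    rw [integral_integral_swap hprod]
    congr 1; ext x
    rw [integral_mul_const, intervalIntegral.integral_of_le zero_le_one]
  have i2 : Integrable fun x => (∫ t in (0 : ℝ)..1, pois f t (x + s)) * g x := by
    refine hprod.integral_prod_right.congr (Eventually.of_forall fun x => ?_)
    simp only
    rw [integral_mul_const, intervalIntegral.integral_of_le zero_le_one]
  rw [e1]
  unfold Dislocation.pairing
  rw [← integral_sub (integrable_pairing (integrable_pois_space hu hui 1).1 hg hg1 s) i2]
  congr 1; ext x
  rw [h (x + s)]; ring

end Pairing

theorem exists_sign_mul_eq_abs {v : ℝ → ℝ} (hv : Measurable v) :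
    ∃ g : ℝ → ℝ, Measurable g ∧ (∀ x, |g x| ≤ 1) ∧ ∀ x, v x * g x = |v x| := by
  refine ⟨fun x => if 0 ≤ v x then 1 else -1, ?_, fun x => ?_, fun x => ?_⟩
  · exact Measurable.ite (measurableSet_le measurable_const hv) measurable_const measurable_const
  · simp only; split_ifs <;> simp
  · simp only; split_ifs with h
    · rw [abs_of_nonneg h, mul_one]
    · rw [abs_of_neg (not_le.mp h), mul_neg_one]

theorem integral_abs_shift_sub_eq {u g : ℝ → ℝ} (hui : Integrable u) (hg : Measurable g)
    (hg1 : ∀ x, |g x| ≤ 1) {s : ℝ} (hgs : ∀ x, (u (x + s) - u x) * g x = |u (x + s) - u x|) :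
    ∫ x, |u (x + s) - u x| = pairing u g s - pairing u g 0 := by
  unfold pairing
  rw [← integral_sub (integrable_pairing hui hg hg1 s) (integrable_pairing hui hg hg1 0)]
  congr 1; ext x
  rw [← hgs x, add_zero, sub_mul]

/-- The analogue in `L¹` of `HasPoisRep.holder`: pair with the sign of the difference. -/
theorem HasPoisRep.l1Holder {u f : ℝ → ℝ} (h : HasPoisRep u f) (hu : Measurable u)
    (hf : Measurable f) (hui : Integrable u) (hfi : Integrable f) :
    L1Holder u := by
  refine ⟨hui, 6 * max (∫ x, |u x|) (∫ x, |f x|), fun s => ?_⟩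
  obtain ⟨g, hg, hg1, hgs⟩ := exists_sign_mul_eq_abs (v := fun x => u (x + s) - u x)
    ((hu.comp (by fun_prop)).sub hu)
  rw [integral_abs_shift_sub_eq hui hg hg1 hgs]
  have := (h.pairing hu hf hui hfi hg hg1).holder (measurable_pairing hu hg)
    (measurable_pairing hf hg) (fun x => (abs_pairing_le hui hg1 x).trans (le_max_left _ _))
    (fun x => (abs_pairing_le hfi hg1 x).trans (le_max_right _ _)) 0 s
  rw [zero_add] at this
  exact (le_abs_self _).trans this

/-- The analogue in `L¹` of `HasPoisRep.differentiable`. -/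
theorem HasPoisRep.l1Lipschitz {u f : ℝ → ℝ} (h : HasPoisRep u f) (hu : Measurable u)
    (hf : Measurable f) (hui : Integrable u) (hfH : L1Holder f) :
    ∃ C, ∀ s, ∫ x, |u (x + s) - u x| ≤ C * |s| := by
  obtain ⟨hfi, N, hN⟩ := hfH
  refine ⟨max (∫ x, |u x|) (∫ x, |f x|) + 4 * N, fun s => ?_⟩
  obtain ⟨g, hg, hg1, hgs⟩ := exists_sign_mul_eq_abs (v := fun x => u (x + s) - u x)
    ((hu.comp (by fun_prop)).sub hu)
  rw [integral_abs_shift_sub_eq hui hg hg1 hgs]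
  have hH : ∀ x y, |Dislocation.pairing f g x - Dislocation.pairing f g y| ≤ N * √|x - y| := by
    intro a b
    refine le_trans ?_ (hN (a - b))
    unfold Dislocation.pairing
    rw [← integral_sub (integrable_pairing hfi hg hg1 a) (integrable_pairing hfi hg hg1 b),
      ← integral_add_right_eq_self (fun x => |f (x + (a - b)) - f x|) b]
    refine norm_integral_le_of_norm_le (f := fun x => f (x + a) * g x - f (x + b) * g x)
      ((((hfi.comp_add_right (a - b)).sub hfi).abs).comp_add_right b)
      (Eventually.of_forall fun x => ?_)
    rw [← sub_mul, norm_mul]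
    change _ ≤ |f (x + b + (a - b)) - f (x + b)|
    rw [show x + b + (a - b) = x + a by ring]
    exact mul_le_of_le_one_right (norm_nonneg _) (hg1 x)
  obtain ⟨hd, hb⟩ := (h.pairing hu hf hui hfi hg hg1).differentiable (measurable_pairing hu hg)
    (measurable_pairing hf hg) (fun x => (abs_pairing_le hui hg1 x).trans (le_max_left _ _))
    (fun x => (abs_pairing_le hfi hg1 x).trans (le_max_right _ _)) hH
  have := convex_univ.norm_image_sub_le_of_norm_deriv_le (fun z _ => hd z) (fun z _ => hb z)
    (mem_univ 0) (mem_univ s)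
  rw [sub_zero] at this
  exact (le_abs_self _).trans this

/-- A differentiable function that is Lipschitz in `L¹` has an integrable derivative. -/
theorem integrable_deriv_of_l1Lipschitz {u u' : ℝ → ℝ} (hui : Integrable u)
    (hd : ∀ x, HasDerivAt u (u' x) x) {C : ℝ} (hC : ∀ s, ∫ x, |u (x + s) - u x| ≤ C * |s|) :
    Integrable u' := by
  have hum : Measurable u := (Differentiable.continuous fun x => (hd x).differentiableAt).measurable
  set s : ℕ → ℝ := fun k => 1 / ((k : ℝ) + 1) with hs
  have hspos : ∀ k, 0 < s k := fun k => by rw [hs]; positivity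
  have hlim : Tendsto s atTop (𝓝[≠] 0) :=
    tendsto_nhdsWithin_iff.mpr ⟨tendsto_one_div_add_atTop_nhds_zero_nat,
      Eventually.of_forall fun k => (hspos k).ne'⟩
  set F : ℕ → ℝ → ℝ := fun k x => (s k)⁻¹ * (u (x + s k) - u x) with hF
  have hFm : ∀ k, Measurable (F k) := fun k => ((hum.comp (by fun_prop)).sub hum).const_mul _
  have hFl : ∀ x, Tendsto (fun k => F k x) atTop (𝓝 (u' x)) := fun x =>
    ((hd x).tendsto_slope_zero.comp hlim)
  have hFb : ∀ k, ∫⁻ x, ‖F k x‖ₑ ≤ ENNReal.ofReal C := by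
    intro k
    have hi : Integrable (F k) := ((hui.comp_add_right (s k)).sub hui).const_mul _
    rw [← ofReal_integral_norm_eq_lintegral_enorm hi]
    apply ENNReal.ofReal_le_ofReal
    have : ∫ x, ‖F k x‖ = (s k)⁻¹ * ∫ x, |u (x + s k) - u x| := by
      rw [← integral_const_mul]
      congr 1; ext x
      rw [hF]
      simp only [norm_mul, norm_inv]
      rw [Real.norm_of_nonneg (hspos k).le, Real.norm_eq_abs]
    rw [this, inv_mul_le_iff₀ (hspos k)]
    have := hC (s k)
    rwa [abs_of_pos (hspos k), mul_comm] at this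
  refine integrable_of_tendsto (Eventually.of_forall hFl) (fun k => (hFm k).aestronglyMeasurable)
    (ne_top_of_le_ne_top (ENNReal.ofReal_ne_top (r := C)) ?_)
  calc _ ≤ liminf (fun _ : ℕ => ENNReal.ofReal C) atTop :=
        liminf_le_liminf (Eventually.of_forall hFb)
    _ = _ := liminf_const _

end

/-! ### Decay by testing against bumps -/

section

theorem integral_secondDiff_mul_comm {V b : ℝ → ℝ} {M : ℝ} (hV : Continuous V) (hVM : ∀ x, |V x| ≤ M)
    (hb : Integrable b) (y : ℝ) :
    ∫ x, secondDiff V x y * b x = ∫ x, V x * secondDiff b x y := by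
  have i1 : ∀ a c : ℝ, Integrable fun x => V (x + a) * b (x + c) := fun a c =>
    (hb.comp_add_right c).bdd_mul (c := M) (hV.comp (by fun_prop)).aestronglyMeasurable
      (Eventually.of_forall fun x => hVM _)
  have e1 : ∀ x, secondDiff V x y * b x =
      V (x + y) * b (x + 0) + V (x + -y) * b (x + 0) - 2 * (V (x + 0) * b (x + 0)) := by
    intro x; unfold secondDiff; simp only [add_zero, ← sub_eq_add_neg]; ring
  have e2 : ∀ x, V x * secondDiff b x y =
      V (x + 0) * b (x + y) + V (x + 0) * b (x + -y) - 2 * (V (x + 0) * b (x + 0)) := by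
    intro x; unfold secondDiff; simp only [add_zero, ← sub_eq_add_neg]; ring
  simp_rw [e1, e2]
  rw [integral_sub (by exact (i1 _ _).add (i1 _ _)) ((i1 _ _).const_mul _),
    integral_add (i1 _ _) (i1 _ _), integral_sub (by exact (i1 _ _).add (i1 _ _))
    ((i1 _ _).const_mul _), integral_add (i1 _ _) (i1 _ _)]
  have s1 : ∫ x, V (x + y) * b (x + 0) = ∫ x, V (x + 0) * b (x + -y) := by
    rw [← integral_add_right_eq_self _ (-y)]
    congr 1; ext x; rw [neg_add_cancel_right]; simp
  have s2 : ∫ x, V (x + -y) * b (x + 0) = ∫ x, V (x + 0) * b (x + y) := by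
    rw [← integral_add_right_eq_self _ y]
    congr 1; ext x; rw [add_neg_cancel_right]; simp
  rw [s1, s2]; ring

/-- The test function: a smooth bump, equal to `1` on `[-1, 1]` and supported in `[-2, 2]`. -/
def testBump : ContDiffBump (0 : ℝ) := ⟨1, 2, one_pos, one_lt_two⟩

theorem exists_lipschitz_deriv_testBump : ∃ K : ℝ≥0, LipschitzWith K (deriv testBump) := by
  have h : ContDiff ℝ 2 (testBump : ℝ → ℝ) := testBump.contDiff
  have h1 : ContDiff ℝ 1 (deriv testBump) := ((contDiff_succ_iff_deriv (n := 1)).mp (by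
    exact_mod_cast h)).2.2
  exact h1.lipschitzWith_of_hasCompactSupport testBump.hasCompactSupport.deriv one_ne_zero

theorem testBump_eq_zero {x : ℝ} (hx : 2 ≤ |x|) : testBump x = 0 :=
  testBump.zero_of_le_dist (by simpa [Real.dist_eq, testBump] using hx)

theorem testBump_eq_one {x : ℝ} (hx : |x| ≤ 1) : testBump x = 1 :=
  testBump.one_of_mem_closedBall (by simpa [Real.dist_eq, testBump] using hx)

/-- The second differences of the test function are integrable against `dx dy / y²`. -/
theorem integrable_secondDiff_testBump :
    Integrable (fun p : ℝ × ℝ => secondDiff testBump p.2 p.1 / p.1 ^ 2)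
      (volume.prod volume) := by
  obtain ⟨K, hK⟩ := exists_lipschitz_deriv_testBump
  have hc : Continuous (testBump : ℝ → ℝ) := testBump.continuous
  have hd : Differentiable ℝ (testBump : ℝ → ℝ) :=
    (testBump.contDiff (n := 1)).differentiable one_ne_zero
  have hm : Measurable fun p : ℝ × ℝ => secondDiff testBump p.2 p.1 / p.1 ^ 2 := by
    have := hc.measurable
    unfold secondDiff
    fun_prop
  have hi : Integrable (testBump : ℝ → ℝ) := hc.integrable_of_hasCompactSupport
    testBump.hasCompactSupport
  have hiy : ∀ y, Integrable fun x => secondDiff testBump x y := fun y =>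
    ((hi.comp_add_right y).add (hi.comp_sub_right y)).sub (hi.const_mul 2)
  set A : ℝ := ∫ x, |testBump x| with hA
  have hA0 : 0 ≤ A := integral_nonneg fun _ => abs_nonneg _
  have hy1 : ∀ y, ∫ x, |secondDiff testBump x y| ≤ 4 * A := by
    intro y
    have a1 := (hi.comp_add_right y).abs
    have a2 := (hi.comp_sub_right y).abs
    have h := integral_mono_of_nonneg (Eventually.of_forall fun x => abs_nonneg _)
      (((a1.add a2).add (hi.abs.const_mul 2)))
      (f := fun x => |secondDiff testBump x y|) (Eventually.of_forall fun x => by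
        simp only [Pi.add_apply, secondDiff]
        refine (abs_sub _ _).trans ?_
        rw [abs_mul, abs_two]
        gcongr
        exact abs_add_le _ _)
    simp only [Pi.add_apply] at h
    rw [integral_add (by exact a1.add a2) (hi.abs.const_mul 2), integral_add a1 a2,
      integral_const_mul, integral_add_right_eq_self (fun x => |testBump x|),
      integral_sub_right_eq_self (fun x => |testBump x|)] at h
    linarith
  have hy2 : ∀ y, |y| ≤ 1 → ∫ x, |secondDiff testBump x y| ≤ 12 * K * y ^ 2 := by
    intro y hy
    have hI : Integrable ((Icc (-3 : ℝ) 3).indicator fun _ => 2 * (K : ℝ) * y ^ 2) :=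
      (integrable_indicator_iff measurableSet_Icc).mpr (integrableOn_const (by simp))
    have h := integral_mono_of_nonneg (Eventually.of_forall fun x => abs_nonneg _)
      (f := fun x => |secondDiff testBump x y|)
      (g := (Icc (-3 : ℝ) 3).indicator fun _ => 2 * K * y ^ 2)
      hI (Eventually.of_forall fun x => by
        by_cases hx : x ∈ Icc (-3 : ℝ) 3
        · rw [indicator_of_mem hx]
          exact abs_secondDiff_le_sq hd hK x y
        · have hx3 : 3 < |x| := by
            by_contra hle; exact hx (abs_le.mp (not_lt.mp hle))
          have b1 : 2 ≤ |x + y| := by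
            have := abs_sub_abs_le_abs_sub x (-y)
            rw [abs_neg, sub_neg_eq_add] at this; linarith
          have b2 : 2 ≤ |x - y| := by
            have := abs_sub_abs_le_abs_sub x y
            linarith
          rw [indicator_of_notMem hx]
          simp only [secondDiff]
          rw [testBump_eq_zero b1, testBump_eq_zero b2, testBump_eq_zero (by linarith)]
          simp)
    rw [integral_indicator measurableSet_Icc, setIntegral_const] at h
    simp only [Real.volume_real_Icc, smul_eq_mul] at h
    norm_num at h
    linarith
  refine (integrable_prod_iff hm.aestronglyMeasurable).mpr
    ⟨Eventually.of_forall fun y => (hiy y).div_const (y ^ 2), ?_⟩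
  refine (integrable_inv_one_add_sq.const_mul (24 * K + 8 * A)).mono'
    hm.stronglyMeasurable.norm.integral_prod_right'.aestronglyMeasurable
    (Eventually.of_forall fun y => ?_)
  rw [Real.norm_of_nonneg (integral_nonneg fun _ => norm_nonneg _)]
  simp only [norm_div, integral_div, norm_pow, Real.norm_eq_abs, sq_abs]
  have hK0 : (0 : ℝ) ≤ K := K.2
  rcases eq_or_ne y 0 with rfl | hy0
  · simp; positivity
  have hyp : 0 < y ^ 2 := by positivity
  rw [← div_eq_mul_inv, div_le_div_iff₀ hyp (by positivity)]
  rcases le_total |y| 1 with h | h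
  · have hy1' : y ^ 2 ≤ 1 := by rw [← sq_abs]; exact pow_le_one₀ (abs_nonneg y) h
    have := hy2 y h
    have h3 : (∫ x, |secondDiff testBump x y|) * (1 + y ^ 2) ≤ 12 * K * y ^ 2 * 2 := by
      gcongr; linarith
    nlinarith
  · have hy1' : 1 ≤ y ^ 2 := by rw [← sq_abs]; exact one_le_pow₀ h
    have h3 : (∫ x, |secondDiff testBump x y|) * (1 + y ^ 2) ≤ 4 * A * (2 * y ^ 2) := by
      gcongr
      · exact hy1 y
      · linarith
    nlinarith [mul_nonneg hK0 hyp.le]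

/-- Testing `I₁[V]` with the bump function gives a bound that depends only on `sup |V|`. -/
theorem exists_bound_test : ∃ B : ℝ, 0 ≤ B ∧ ∀ (V : ℝ → ℝ) (M : ℝ) (K : ℝ≥0), Differentiable ℝ V →
    LipschitzWith K (deriv V) → (∀ x, |V x| ≤ M) →
    Integrable (fun x => (1 / 2 * ∫ y, secondDiff V x y / y ^ 2) * testBump x) ∧
    ∫ x, (1 / 2 * ∫ y, secondDiff V x y / y ^ 2) * testBump x ≤ B * M := by
  have hint := integrable_secondDiff_testBump
  have hi : Integrable (testBump : ℝ → ℝ) := testBump.continuous.integrable_of_hasCompactSupport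
    testBump.hasCompactSupport
  refine ⟨∫ y, ∫ x, |secondDiff testBump x y / y ^ 2|,
    integral_nonneg fun _ => integral_nonneg fun _ => abs_nonneg _,
    fun V M K hV hK hM => ?_⟩
  have hM0 : 0 ≤ M := (abs_nonneg _).trans (hM 0)
  have hVm := hV.continuous.measurable
  have i1 : Integrable (fun p : ℝ × ℝ => secondDiff V p.1 p.2 / p.2 ^ 2 * testBump p.1)
      (volume.prod volume) := by
    refine ((hi.abs.mul_prod (integrable_inv_one_add_sq.const_mul (4 * K + 8 * M)))).mono' ?_
      (Eventually.of_forall fun p => ?_)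
    · have := testBump.continuous.measurable
      unfold secondDiff
      exact Measurable.aestronglyMeasurable (by fun_prop)
    · rw [norm_mul, mul_comm]
      gcongr
      · exact le_of_eq rfl
      · exact abs_secondDiff_div_le hV hK hM _ _
  have e : (fun x => (1 / 2 * ∫ y, secondDiff V x y / y ^ 2) * testBump x) =
      fun x => 1 / 2 * ∫ y, secondDiff V x y / y ^ 2 * testBump x := by
    ext x; rw [integral_mul_const]; ring
  rw [e]
  refine ⟨i1.integral_prod_left.const_mul _, ?_⟩
  rw [integral_const_mul, integral_integral_swap i1]
  have e2 : ∀ y, ∫ x, secondDiff V x y / y ^ 2 * testBump x =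
      ∫ x, V x * (secondDiff testBump x y / y ^ 2) := by
    intro y
    have := integral_secondDiff_mul_comm hV.continuous hM hi y
    calc _ = ∫ x, (y ^ 2)⁻¹ * (secondDiff V x y * testBump x) := by congr 1; ext x; ring
      _ = ∫ x, (y ^ 2)⁻¹ * (V x * secondDiff testBump x y) := by
        rw [integral_const_mul, this, integral_const_mul]
      _ = _ := by congr 1; ext x; ring
  simp_rw [e2]
  have i2 : Integrable (fun p : ℝ × ℝ => V p.2 * (secondDiff testBump p.2 p.1 / p.1 ^ 2))
      (volume.prod volume) := hint.bdd_mul (c := M)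
    (hVm.comp measurable_snd).aestronglyMeasurable (Eventually.of_forall fun p => hM _)
  have h1 : ∫ y, ∫ x, V x * (secondDiff testBump x y / y ^ 2) ≤
      ∫ y, M * ∫ x, |secondDiff testBump x y / y ^ 2| := by
    refine integral_mono_ae i2.integral_prod_left (hint.abs.integral_prod_left.const_mul M) ?_
    filter_upwards [hint.prod_right_ae, i2.prod_right_ae] with y hy hy2
    rw [← integral_const_mul]
    refine integral_mono hy2 (hy.abs.const_mul M) fun x => ?_
    simp only
    refine (le_abs_self _).trans ?_
    rw [abs_mul]
    gcongr
    exact hM x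
  rw [integral_const_mul] at h1
  have : 0 ≤ (∫ y, ∫ x, |secondDiff testBump x y / y ^ 2|) * M :=
    mul_nonneg (integral_nonneg fun _ => integral_nonneg fun _ => abs_nonneg _) hM0
  linarith

/-- A bounded nonnegative nonincreasing function with `I₁[v] ≥ c v` near `+∞` decays at least like
`1/x`: rescale `v` and test with a fixed bump function. -/
theorem exists_decay {v : ℝ → ℝ} {M c R : ℝ} {K : ℝ≥0} (hv : Differentiable ℝ v)
    (hK : LipschitzWith K (deriv v)) (hM : ∀ x, |v x| ≤ M) (hv0 : ∀ x, 0 ≤ v x)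
    (hanti : Antitone v) (hc : 0 < c)
    (hsub : ∀ x, R ≤ x → c * v x ≤ 1 / 2 * ∫ y, secondDiff v x y / y ^ 2) :
    ∃ C, ∀ x, 0 < x → v x ≤ C / x := by
  obtain ⟨B, hB0, hB⟩ := exists_bound_test
  have hM0 : 0 ≤ M := (abs_nonneg _).trans (hM 0)
  set R' := max R 1 with hR'
  have hR1 : 1 ≤ R' := le_max_right _ _
  have hR0 : R ≤ R' := le_max_left _ _
  have hi : Integrable (testBump : ℝ → ℝ) := testBump.continuous.integrable_of_hasCompactSupport
    testBump.hasCompactSupport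
  have key : ∀ r, R' ≤ r → 2 * c * r * v (4 * r) ≤ B * M := by
    intro r hr
    have hr0 : 0 < r := by linarith
    set V : ℝ → ℝ := fun x => v (r * x + 3 * r) with hV
    have hVd : ∀ x, HasDerivAt V (r * deriv v (r * x + 3 * r)) x := by
      intro x
      have h1 : HasDerivAt (fun x : ℝ => r * x + 3 * r) r x := by
        simpa using ((hasDerivAt_id x).const_mul r).add_const (3 * r)
      have := (hv (r * x + 3 * r)).hasDerivAt.comp x h1
      exact this.congr_deriv (mul_comm _ _)
    have hVdiff : Differentiable ℝ V := fun x => (hVd x).differentiableAt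
    have hVL : LipschitzWith (r.toNNReal * K * r.toNNReal) (deriv V) := by
      refine LipschitzWith.of_dist_le_mul fun x y => ?_
      rw [(hVd x).deriv, (hVd y).deriv, Real.dist_eq, ← mul_sub, abs_mul, abs_of_pos hr0]
      have := hK.dist_le_mul (r * x + 3 * r) (r * y + 3 * r)
      rw [Real.dist_eq, Real.dist_eq, show r * x + 3 * r - (r * y + 3 * r) = r * (x - y) by ring,
        abs_mul, abs_of_pos hr0] at this
      push_cast
      rw [Real.coe_toNNReal r hr0.le, Real.dist_eq]
      calc _ ≤ r * (K * (r * |x - y|)) := by gcongr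
        _ = _ := by ring
    obtain ⟨hint, hle⟩ := hB V M _ hVdiff hVL (fun x => hM _)
    have hscale : ∀ x, ∫ y, secondDiff V x y / y ^ 2 =
        r * ∫ y, secondDiff v (r * x + 3 * r) y / y ^ 2 := by
      intro x
      have h := Measure.integral_comp_mul_left
        (fun y => secondDiff v (r * x + 3 * r) y / y ^ 2) r
      rw [abs_of_pos (inv_pos.mpr hr0), smul_eq_mul] at h
      have : ∀ y, secondDiff V x y / y ^ 2 =
          r ^ 2 * (secondDiff v (r * x + 3 * r) (r * y) / (r * y) ^ 2) := by
        intro y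
        have : secondDiff V x y = secondDiff v (r * x + 3 * r) (r * y) := by
          simp only [secondDiff, hV]
          rw [show r * (x + y) + 3 * r = r * x + 3 * r + r * y by ring,
            show r * (x - y) + 3 * r = r * x + 3 * r - r * y by ring]
        rw [this, mul_pow]
        field_simp
      simp_rw [this]
      rw [integral_const_mul, h]
      field_simp
    have iV : Integrable fun x => c * r * (V x * testBump x) :=
      (hi.bdd_mul (c := M) hVdiff.continuous.aestronglyMeasurable
        (Eventually.of_forall fun x => hM _)).const_mul _
    have h1 : ∫ x, c * r * (V x * testBump x) ≤ B * M := by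
      refine le_trans (integral_mono iV hint fun x => ?_) hle
      simp only
      rcases le_or_gt 2 |x| with hx | hx
      · rw [testBump_eq_zero hx]; simp
      · have hx' := abs_lt.mp hx
        rw [hscale, ← mul_assoc]
        refine mul_le_mul_of_nonneg_right ?_ testBump.nonneg
        have := hsub (r * x + 3 * r) (by nlinarith)
        calc _ = r * (c * v (r * x + 3 * r)) := by rw [hV]; ring
          _ ≤ r * (1 / 2 * ∫ y, secondDiff v (r * x + 3 * r) y / y ^ 2) := by gcongr
          _ = _ := by ring
    have h2 : ∫ x in Icc (-1 : ℝ) 1, c * r * v (4 * r) ≤ ∫ x, c * r * (V x * testBump x) := by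
      rw [← integral_indicator measurableSet_Icc]
      refine integral_mono ((integrable_indicator_iff measurableSet_Icc).mpr
        (integrableOn_const (by simp))) iV fun x => ?_
      by_cases hx : x ∈ Icc (-1 : ℝ) 1
      · rw [indicator_of_mem hx]
        simp only
        rw [testBump_eq_one (abs_le.mpr hx), mul_one]
        gcongr
        refine hanti ?_
        nlinarith [hx.2]
      · rw [indicator_of_notMem hx]
        have := mul_nonneg (hv0 (r * x + 3 * r)) (testBump.nonneg (x := x))
        positivity
    rw [setIntegral_const, Real.volume_real_Icc] at h2
    norm_num at h2
    linarith
  refine ⟨max (2 * (B * M) / c) (4 * R' * M), fun x hx => ?_⟩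
  rw [le_div_iff₀ hx]
  rcases le_total (4 * R') x with h | h
  · refine le_trans ?_ (le_max_left _ _)
    have := key (x / 4) (by linarith)
    rw [show 4 * (x / 4) = x by ring] at this
    rw [le_div_iff₀ hc]
    linarith
  · refine le_trans ?_ (le_max_right _ _)
    have := (le_abs_self _).trans (hM x)
    nlinarith [hv0 x]

end

/-! ### The layer solution: representation and tails -/

section

/-- A bounded differentiable function with bounded and integrable derivative, the constant `M`
controlling all the norms. -/
structure IsProfile (ψ : ℝ → ℝ) (M : ℝ) : Prop where
  differentiable : Differentiable ℝ ψ
  abs_le : ∀ x, |ψ x| ≤ M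
  abs_deriv_le : ∀ x, |deriv ψ x| ≤ M
  integrable_deriv : Integrable (deriv ψ)
  integral_le : ∫ x, |deriv ψ x| ≤ M

theorem layerConst_pos (n : ℕ) : 0 < layerConst n := by
  unfold layerConst
  have e : ∀ y : EuclideanSpace ℝ (Fin (n - 1)), 1 / (‖y‖ ^ 2 + 1) ^ (((n : ℝ) + 1) / 2) =
      ((1 : ℝ) + ‖y‖ ^ 2) ^ (-((n : ℝ) + 1) / 2) := by
    intro y
    rw [neg_div, Real.rpow_neg (by positivity), add_comm, one_div]
  simp_rw [e]
  have hi : Integrable fun y : EuclideanSpace ℝ (Fin (n - 1)) =>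
      ((1 : ℝ) + ‖y‖ ^ 2) ^ (-((n : ℝ) + 1) / 2) := by
    refine integrable_rpow_neg_one_add_norm_sq ?_
    rw [finrank_euclideanSpace, Fintype.card_fin]
    have : ((n - 1 : ℕ) : ℝ) ≤ n := by exact_mod_cast Nat.sub_le n 1
    linarith
  rw [integral_pos_iff_support_of_nonneg (fun y => by positivity) hi]
  have : Function.support (fun y : EuclideanSpace ℝ (Fin (n - 1)) =>
      ((1 : ℝ) + ‖y‖ ^ 2) ^ (-((n : ℝ) + 1) / 2)) = univ := by
    ext y
    simp only [Function.mem_support, mem_univ, iff_true]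
    positivity
  rw [this]
  exact isOpen_univ.measure_pos _ univ_nonempty

namespace IsMultiWell

variable {W : ℝ → ℝ}

theorem hasDerivAt_iter (hW : IsMultiWell W) {k : ℕ} (hk : k < 4) (u : ℝ) :
    HasDerivAt (iteratedDeriv k W) (iteratedDeriv (k + 1) W u) u := by
  rw [iteratedDeriv_succ]
  exact ((hW.contDiff.differentiable_iteratedDeriv k (by exact_mod_cast hk)) u).hasDerivAt

theorem continuous_iter (hW : IsMultiWell W) {k : ℕ} (hk : k ≤ 4) :
    Continuous (iteratedDeriv k W) :=
  hW.contDiff.continuous_iteratedDeriv k (by exact_mod_cast hk)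

theorem iteratedDeriv_add_one (hW : IsMultiWell W) (k : ℕ) (u : ℝ) :
    iteratedDeriv k W (u + 1) = iteratedDeriv k W u := by
  have h := iteratedDeriv_comp_add_const k W 1
  have : (fun z => W (z + 1)) = W := funext hW.periodic
  rw [this] at h
  exact (congrFun h u).symm

theorem nonneg (hW : IsMultiWell W) (u : ℝ) : 0 ≤ W u := by
  by_cases h : ∀ k : ℤ, u ≠ k
  · exact (hW.pos u h).le
  · push Not at h
    obtain ⟨k, rfl⟩ := h
    exact (hW.zero_int k).ge

theorem deriv_zero (hW : IsMultiWell W) : deriv W 0 = 0 := by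
  refine IsLocalMin.deriv_eq_zero (Eventually.of_forall fun u => ?_)
  have := hW.zero_int 0
  simp only [Int.cast_zero] at this
  rw [this]; exact hW.nonneg u

/-- Near the wells `0` and `1` the second derivative of `W` is bounded below, hence `W'` grows
linearly away from them. -/
theorem exists_well (hW : IsMultiWell W) : ∃ c r : ℝ, 0 < c ∧ 0 < r ∧ r < 1 / 2 ∧
    (∀ u ∈ Icc 0 r, c ≤ iteratedDeriv 2 W u ∧ c * u ≤ deriv W u) ∧
    ∀ u ∈ Icc (1 - r) 1, c ≤ iteratedDeriv 2 W u ∧ c * (1 - u) ≤ -deriv W u := by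
  set c := iteratedDeriv 2 W 0 / 2 with hc
  have hc0 : 0 < c := half_pos hW.second_deriv_pos
  have hlt : c < iteratedDeriv 2 W 0 := half_lt_self hW.second_deriv_pos
  have hev := (hW.continuous_iter (k := 2) (by norm_num)).tendsto 0 |>.eventually_const_lt hlt
  obtain ⟨r, hr, hball⟩ := Metric.eventually_nhds_iff.mp hev
  have hsec : ∀ u, |u| < r → c ≤ iteratedDeriv 2 W u := fun u hu =>
    (hball (by simpa [Real.dist_eq] using hu)).le
  have hder : ∀ u, HasDerivAt (deriv W) (iteratedDeriv 2 W u) u := by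
    have := fun u => hW.hasDerivAt_iter (k := 1) (by norm_num) u
    simpa [iteratedDeriv_one] using this
  have hdiff : Differentiable ℝ (deriv W) := fun u => (hder u).differentiableAt
  have hper : ∀ u, deriv W (u + 1) = deriv W u := by
    have := hW.iteratedDeriv_add_one 1
    simpa [iteratedDeriv_one] using this
  have hmv : ∀ a b, a ≤ b → (∀ u ∈ Icc a b, |u| < r) → c * (b - a) ≤ deriv W b - deriv W a := by
    intro a b hab h
    refine (convex_Icc a b).mul_sub_le_image_sub_of_le_deriv hdiff.continuous.continuousOn
      hdiff.differentiableOn (fun u hu => ?_) a (left_mem_Icc.mpr hab) b (right_mem_Icc.mpr hab) hab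
    rw [(hder u).deriv]
    exact hsec u (h u (interior_subset hu))
  refine ⟨c, min (r / 2) (1 / 4), hc0, by positivity, by
    have := min_le_right (r / 2) (1 / 4); linarith, fun u hu => ?_, fun u hu => ?_⟩
  · have h1 : u ≤ r / 2 := hu.2.trans (min_le_left _ _)
    refine ⟨hsec u (by rw [abs_of_nonneg hu.1]; linarith), ?_⟩
    have := hmv 0 u hu.1 (fun z hz => by rw [abs_of_nonneg hz.1]; linarith [hz.2])
    rwa [hW.deriv_zero, sub_zero, sub_zero] at this
  · have h1 : 1 - r / 2 ≤ u := by linarith [hu.1, min_le_left (r / 2) (1 / 4 : ℝ)]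
    have e1 : iteratedDeriv 2 W u = iteratedDeriv 2 W (u - 1) := by
      rw [← hW.iteratedDeriv_add_one 2 (u - 1), sub_add_cancel]
    have e2 : deriv W u = deriv W (u - 1) := by rw [← hper (u - 1), sub_add_cancel]
    refine ⟨?_, ?_⟩
    · rw [e1]
      exact hsec _ (by rw [abs_of_nonpos (by linarith [hu.2])]; linarith)
    · have := hmv (u - 1) 0 (by linarith [hu.2]) (fun z hz => by
        rw [abs_of_nonpos hz.2]; linarith [hz.1])
      rw [hW.deriv_zero] at this
      rw [e2]; linarith

end IsMultiWell

namespace IsLayerSolution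

variable {n : ℕ} {W φ : ℝ → ℝ}

theorem strictMono (hφ : IsLayerSolution n W φ) : StrictMono φ := strictMono_of_deriv_pos hφ.deriv_pos

theorem differentiable (hφ : IsLayerSolution n W φ) : Differentiable ℝ φ :=
  hφ.contDiff.differentiable one_ne_zero

theorem pos (hφ : IsLayerSolution n W φ) (x : ℝ) : 0 < φ x :=
  (hφ.strictMono.monotone.le_of_tendsto hφ.tendsto_atBot (x - 1)).trans_lt
    (hφ.strictMono (by linarith))

theorem lt_one (hφ : IsLayerSolution n W φ) (x : ℝ) : φ x < 1 :=
  (hφ.strictMono (by linarith : x < x + 1)).trans_le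
    (hφ.strictMono.monotone.ge_of_tendsto hφ.tendsto_atTop (x + 1))

theorem abs_le_one (hφ : IsLayerSolution n W φ) (x : ℝ) : |φ x| ≤ 1 := by
  rw [abs_of_pos (hφ.pos x)]; exact (hφ.lt_one x).le

theorem integral_Ioi (hφ : IsLayerSolution n W φ) (a : ℝ) : ∫ x in Ioi a, deriv φ x = 1 - φ a :=
  integral_Ioi_of_hasDerivAt_of_nonneg' (fun x _ => (hφ.differentiable x).hasDerivAt)
    (fun x _ => (hφ.deriv_pos x).le) hφ.tendsto_atTop

theorem integrable_deriv (hφ : IsLayerSolution n W φ) : Integrable (deriv φ) := by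
  have h1 : IntegrableOn (deriv φ) (Ioi 0) :=
    integrableOn_Ioi_deriv_of_nonneg' (fun x _ => (hφ.differentiable x).hasDerivAt)
      (fun x _ => (hφ.deriv_pos x).le) hφ.tendsto_atTop
  have h2 : IntegrableOn (deriv φ) (Iic 0) :=
    integrableOn_Iic_of_intervalIntegral_norm_tendsto (φ 0 - 0) 0
      (fun i => by
        exact ((hφ.contDiff.continuous_deriv le_rfl).integrableOn_Icc (a := i) (b := 0)).mono_set
          Ioc_subset_Icc_self) tendsto_id (by
        have : ∀ i, ∫ x in i..0, ‖deriv φ x‖ = φ 0 - φ i := by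
          intro i
          simp_rw [Real.norm_of_nonneg (hφ.deriv_pos _).le]
          exact intervalIntegral.integral_deriv_eq_sub (fun x _ => hφ.differentiable x)
            ((hφ.contDiff.continuous_deriv le_rfl).intervalIntegrable _ _)
        simp only [id, this]
        exact hφ.tendsto_atBot.const_sub _)
  have := h2.union h1
  rwa [Iic_union_Ioi, integrableOn_univ] at this

theorem integral_Iic (hφ : IsLayerSolution n W φ) (a : ℝ) : ∫ x in Iic a, deriv φ x = φ a := by
  rw [integral_Iic_of_hasDerivAt_of_tendsto' (fun x _ => (hφ.differentiable x).hasDerivAt)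
    hφ.integrable_deriv.integrableOn hφ.tendsto_atBot, sub_zero]

theorem integral_deriv (hφ : IsLayerSolution n W φ) : ∫ x, deriv φ x = 1 := by
  rw [← intervalIntegral.integral_Iic_add_Ioi (b := 0) hφ.integrable_deriv.integrableOn
    hφ.integrable_deriv.integrableOn, hφ.integral_Iic, hφ.integral_Ioi]
  ring

/-- The equation in absolutely convergent form. -/
theorem equation_integral (hφ : IsLayerSolution n W φ) (x : ℝ) :
    1 / 2 * ∫ y, secondDiff φ x y / y ^ 2 = (layerConst n)⁻¹ * deriv W (φ x) := by
  obtain ⟨K, hK⟩ := hφ.deriv_lipschitz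
  obtain ⟨L, hL, heq⟩ := hφ.equation x
  rw [← hL.eq_integral hφ.differentiable hK hφ.abs_le_one, ← heq,
    inv_mul_cancel_left₀ (layerConst_pos n).ne']

theorem hasPoisRep (hφ : IsLayerSolution n W φ) :
    HasPoisRep φ fun x => Real.pi⁻¹ * ((layerConst n)⁻¹ * deriv W (φ x)) := by
  obtain ⟨K, hK⟩ := hφ.deriv_lipschitz
  refine hasPoisRep_of_hasI1 hφ.differentiable hK hφ.abs_le_one
    (L := fun x => (layerConst n)⁻¹ * deriv W (φ x)) fun x => ?_
  obtain ⟨L, hL, heq⟩ := hφ.equation x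
  rwa [← heq, inv_mul_cancel_left₀ (layerConst_pos n).ne']

/-- `1 - φ(x) ≤ C / x` and `φ(-x) ≤ C / x` for `x > 0`. -/
theorem exists_tail (hW : IsMultiWell W) (hφ : IsLayerSolution n W φ) :
    ∃ C, ∀ x, 0 < x → 1 - φ x ≤ C / x ∧ φ (-x) ≤ C / x := by
  obtain ⟨K, hK⟩ := hφ.deriv_lipschitz
  obtain ⟨c, r, hc, hr, hr2, h0, h1⟩ := hW.exists_well
  have hκ := inv_pos.mpr (layerConst_pos n)
  obtain ⟨R1, hR1⟩ := eventually_atTop.mp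
    (hφ.tendsto_atTop.eventually_const_lt (by linarith : 1 - r < 1))
  obtain ⟨R2, hR2⟩ := eventually_atBot.mp (hφ.tendsto_atBot.eventually_lt_const hr)
  obtain ⟨C1, hC1⟩ := exists_decay (v := fun x => 1 - φ x) (M := 1) (c := (layerConst n)⁻¹ * c)
    (R := R1) (K := K) (hφ.differentiable.const_sub 1)
    (by
      have : deriv (fun x => 1 - φ x) = fun x => -deriv φ x := by
        ext x; exact deriv_const_sub 1
      rw [this]
      refine LipschitzWith.of_dist_le_mul fun x y => ?_
      rw [dist_neg_neg]; exact hK.dist_le_mul x y)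
    (fun x => by rw [abs_of_pos (by linarith [hφ.lt_one x])]; linarith [hφ.pos x])
    (fun x => by linarith [hφ.lt_one x])
    (fun x y hxy => by have := hφ.strictMono.monotone hxy; simp only; linarith) (by positivity)
    (fun x hx => by
      have e : ∀ y, secondDiff (fun x => 1 - φ x) x y / y ^ 2 = -(secondDiff φ x y / y ^ 2) := by
        intro y; unfold secondDiff; ring
      simp_rw [e]
      rw [integral_neg, mul_neg, hφ.equation_integral, mul_assoc, ← mul_neg]
      gcongr
      exact (h1 (φ x) ⟨(hR1 x hx).le, (hφ.lt_one x).le⟩).2)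
  obtain ⟨C2, hC2⟩ := exists_decay (v := fun x => φ (-x)) (M := 1) (c := (layerConst n)⁻¹ * c)
    (R := -R2) (K := K) (hφ.differentiable.comp differentiable_neg)
    (by
      have : deriv (fun x => φ (-x)) = fun x => -deriv φ (-x) := by
        ext x; exact deriv_comp_neg φ x
      rw [this]
      refine LipschitzWith.of_dist_le_mul fun x y => ?_
      rw [dist_neg_neg]
      refine (hK.dist_le_mul _ _).trans ?_
      rw [dist_neg_neg])
    (fun x => hφ.abs_le_one _)
    (fun x => (hφ.pos _).le)
    (fun x y hxy => hφ.strictMono.monotone (neg_le_neg hxy)) (by positivity)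
    (fun x hx => by
      have e : ∀ y, secondDiff (fun x => φ (-x)) x y / y ^ 2 = secondDiff φ (-x) y / y ^ 2 := by
        intro y; unfold secondDiff; beta_reduce
        rw [show -(x + y) = -x - y by ring, show -(x - y) = -x + y by ring]; ring
      simp_rw [e]
      rw [hφ.equation_integral, mul_assoc]
      gcongr
      exact (h0 (φ (-x)) ⟨(hφ.pos _).le, (hR2 (-x) (by linarith)).le⟩).2)
  refine ⟨max C1 C2, fun x hx => ⟨(hC1 x hx).trans ?_, (hC2 x hx).trans ?_⟩⟩
  · gcongr; exact le_max_left _ _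
  · gcongr; exact le_max_right _ _

end IsLayerSolution

end

/-! ### The layer solution: profile bounds -/

section

namespace IsLayerSolution

variable {n : ℕ} {W φ : ℝ → ℝ}

theorem exists_bound_iter (hW : IsMultiWell W) (hφ : IsLayerSolution n W φ) {k : ℕ} (hk : k ≤ 4) :
    ∃ B, ∀ x, |iteratedDeriv k W (φ x)| ≤ B := by
  obtain ⟨B, hB⟩ := isCompact_Icc.exists_bound_of_continuousOn (s := Icc (0 : ℝ) 1)
    (hW.continuous_iter hk).continuousOn
  exact ⟨B, fun x => hB _ ⟨(hφ.pos x).le, (hφ.lt_one x).le⟩⟩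

theorem hasDerivAt_iter_comp (hW : IsMultiWell W) (hφ : IsLayerSolution n W φ) {k : ℕ} (hk : k < 4)
    (x : ℝ) : HasDerivAt (fun x => iteratedDeriv k W (φ x))
      (iteratedDeriv (k + 1) W (φ x) * deriv φ x) x :=
  (hW.hasDerivAt_iter hk (φ x)).comp x (hφ.differentiable x).hasDerivAt

theorem bddHolder_iter (hW : IsMultiWell W) (hφ : IsLayerSolution n W φ) {k : ℕ} (hk : k < 4) :
    BddHolder fun x => iteratedDeriv k W (φ x) := by
  obtain ⟨B, hB⟩ := hφ.exists_bound_iter hW hk.le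
  obtain ⟨B', hB'⟩ := hφ.exists_bound_iter hW (k := k + 1) hk
  obtain ⟨M, hM⟩ := hφ.deriv_bounded
  refine .of_hasDerivAt (L := B' * M) hB (hφ.hasDerivAt_iter_comp hW hk) fun x => ?_
  rw [abs_mul]
  exact mul_le_mul (hB' x) (hM x) (abs_nonneg _) ((abs_nonneg _).trans (hB' x))

theorem measurable_iter (hW : IsMultiWell W) (hφ : IsLayerSolution n W φ) {k : ℕ} (hk : k ≤ 4) :
    Measurable fun x => iteratedDeriv k W (φ x) :=
  ((hW.continuous_iter hk).comp hφ.differentiable.continuous).measurable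

/-- The Poisson representation of `φ'`. -/
theorem hasPoisRep_deriv (hW : IsMultiWell W) (hφ : IsLayerSolution n W φ) :
    HasPoisRep (deriv φ)
      fun x => (Real.pi⁻¹ * (layerConst n)⁻¹) * iteratedDeriv 2 W (φ x) * deriv φ x := by
  set κ := Real.pi⁻¹ * (layerConst n)⁻¹ with hκ
  obtain ⟨M1, hM1⟩ := hφ.deriv_bounded
  obtain ⟨B1, hB1⟩ := hφ.exists_bound_iter hW (k := 1) (by norm_num)
  obtain ⟨B2, hB2⟩ := hφ.exists_bound_iter hW (k := 2) (by norm_num)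
  have hM1' : ∀ x, |deriv φ x| ≤ M1 := hM1
  have e : (fun x => Real.pi⁻¹ * ((layerConst n)⁻¹ * deriv W (φ x))) =
      fun x => κ * iteratedDeriv 1 W (φ x) := by
    ext x; rw [iteratedDeriv_one, hκ]; ring
  have hrep := hφ.hasPoisRep
  rw [e] at hrep
  set M := max (max 1 M1) (max (|κ| * B1) (|κ| * B2 * M1)) with hM
  refine hrep.deriv (M := M) (fun x => (hφ.differentiable x).hasDerivAt) (fun x => ?_)
    (fun x => (hφ.abs_le_one x).trans ((le_max_left _ _).trans (le_max_left _ _)))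
    (fun x => (hM1 x).trans ((le_max_right _ _).trans (le_max_left _ _))) (fun x => ?_) fun x => ?_
  · exact ((hφ.hasDerivAt_iter_comp hW (k := 1) (by norm_num) x).const_mul κ).congr_deriv
      (by ring)
  · rw [abs_mul]
    exact (mul_le_mul_of_nonneg_left (hB1 x) (abs_nonneg _)).trans
      ((le_max_left _ _).trans (le_max_right _ _))
  · rw [abs_mul, abs_mul]
    refine le_trans ?_ ((le_max_right _ _).trans (le_max_right _ _))
    have := (abs_nonneg _).trans (hB2 x)
    gcongr
    · exact hB2 x
    · exact hM1 x

/-- The layer solution is three times differentiable, with bounded and integrable derivatives. -/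
theorem exists_isProfile (hW : IsMultiWell W) (hφ : IsLayerSolution n W φ) :
    ∃ M, IsProfile φ M ∧ IsProfile (deriv φ) M ∧ IsProfile (deriv (deriv φ)) M := by
  set κ := Real.pi⁻¹ * (layerConst n)⁻¹ with hκ
  set p1 := deriv φ with hp1
  set p2 := deriv p1 with hp2
  obtain ⟨K, hK⟩ := hφ.deriv_lipschitz
  obtain ⟨M1, hM1⟩ := hφ.deriv_bounded
  have hp1c : Continuous p1 := hφ.contDiff.continuous_deriv le_rfl
  have hp1H : BddHolder p1 := .of_lipschitz hM1 fun x y => by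
    have := hK.dist_le_mul x y
    rwa [Real.dist_eq, Real.dist_eq] at this
  have hw2 := (hφ.bddHolder_iter hW (k := 2) (by norm_num)).const_mul κ
  have hw3 := (hφ.bddHolder_iter hW (k := 3) (by norm_num)).const_mul κ
  have hw2m : Measurable fun x => κ * iteratedDeriv 2 W (φ x) :=
    (hφ.measurable_iter hW (by norm_num)).const_mul κ
  have hw3m : Measurable fun x => κ * iteratedDeriv 3 W (φ x) * p1 x :=
    ((hφ.measurable_iter hW (by norm_num)).const_mul κ).mul hp1c.measurable
  -- `φ'` is Lipschitz, hence its right-hand side is Hölder continuous and `φ''` exists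
  have hrep1 : HasPoisRep p1 fun x => κ * iteratedDeriv 2 W (φ x) * p1 x :=
    hφ.hasPoisRep_deriv hW
  have hF1H := hw2.mul hp1H
  have hF1m := hw2m.mul hp1c.measurable
  obtain ⟨N1, hN1, hN1'⟩ := hF1H
  obtain ⟨hd1, hb1⟩ := hrep1.differentiable (M := max M1 N1) hp1c.measurable hF1m
    (fun x => (hM1 x).trans (le_max_left _ _)) (fun x => (hN1 x).trans (le_max_right _ _)) hN1'
  set M2 := max M1 N1 + 4 * N1 with hM2
  -- `φ''` has a bounded right-hand side, hence is Hölder continuous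
  have hp2m : Measurable p2 := measurable_deriv p1
  have hF1d : ∀ x, HasDerivAt (fun x => κ * iteratedDeriv 2 W (φ x) * p1 x)
      (κ * iteratedDeriv 3 W (φ x) * p1 x * p1 x + κ * iteratedDeriv 2 W (φ x) * p2 x) x := by
    intro x
    have := ((hφ.hasDerivAt_iter_comp hW (k := 2) (by norm_num) x).const_mul κ).mul
      (hd1 x).hasDerivAt
    exact this.congr_deriv (by simp only [hp1, hp2]; ring)
  have hA := (hw3.mul hp1H).mul hp1H
  obtain ⟨NA, hNA, -⟩ := hA
  obtain ⟨NB, hNB, -⟩ := hw2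
  have hF2b : ∀ x, |κ * iteratedDeriv 3 W (φ x) * p1 x * p1 x +
      κ * iteratedDeriv 2 W (φ x) * p2 x| ≤ NA + NB * M2 := by
    intro x
    refine (abs_add_le _ _).trans (add_le_add (hNA x) ?_)
    rw [abs_mul]
    exact mul_le_mul (hNB x) (hb1 x) (abs_nonneg _) ((abs_nonneg _).trans (hNB x))
  set M3 := max (max M1 M2) (max N1 (NA + NB * M2)) with hM3
  have hrep2 : HasPoisRep p2 fun x => κ * iteratedDeriv 3 W (φ x) * p1 x * p1 x +
      κ * iteratedDeriv 2 W (φ x) * p2 x :=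
    hrep1.deriv (M := M3) (fun x => (hd1 x).hasDerivAt) hF1d
      (fun x => (hM1 x).trans ((le_max_left _ _).trans (le_max_left _ _)))
      (fun x => (hb1 x).trans ((le_max_right _ _).trans (le_max_left _ _)))
      (fun x => (hN1 x).trans ((le_max_left _ _).trans (le_max_right _ _)))
      (fun x => (hF2b x).trans ((le_max_right _ _).trans (le_max_right _ _)))
  have hp2b : ∀ x, |p2 x| ≤ M3 :=
    fun x => (hb1 x).trans ((le_max_right _ _).trans (le_max_left _ _))
  have hF2m : Measurable fun x => κ * iteratedDeriv 3 W (φ x) * p1 x * p1 x +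
      κ * iteratedDeriv 2 W (φ x) * p2 x :=
    (hw3m.mul hp1c.measurable).add (hw2m.mul hp2m)
  have hp2H : BddHolder p2 := by
    have hM30 : 0 ≤ M3 := (abs_nonneg _).trans (hp2b 0)
    refine ⟨6 * M3, fun x => (hp2b x).trans (by linarith), fun x y => ?_⟩
    have := hrep2.holder hp2m hF2m hp2b
      (fun x => (hF2b x).trans ((le_max_right _ _).trans (le_max_right _ _))) y (x - y)
    rwa [add_sub_cancel] at this
  have hw2 := (hφ.bddHolder_iter hW (k := 2) (by norm_num)).const_mul κ
  -- now its right-hand side is Hölder continuous as well, and `φ'''` exists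
  have hF2H := ((hw3.mul hp1H).mul hp1H).add (hw2.mul hp2H)
  obtain ⟨N2, hN2, hN2'⟩ := hF2H
  obtain ⟨hd2, hb2⟩ := hrep2.differentiable (M := max M3 N2) hp2m hF2m
    (fun x => (hp2b x).trans (le_max_left _ _)) (fun x => (hN2 x).trans (le_max_right _ _)) hN2'
  -- integrability: the same steps in `L¹`, starting from `φ' ∈ L¹`
  have hi1 : Integrable p1 := hφ.integrable_deriv
  have hF1i : Integrable fun x => κ * iteratedDeriv 2 W (φ x) * p1 x :=
    hi1.bdd_mul hw2m.aestronglyMeasurable (Eventually.of_forall hNB)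
  have hF1L : L1Holder fun x => κ * iteratedDeriv 2 W (φ x) * p1 x :=
    hw2.mul_L1Holder hw2m (hrep1.l1Holder hp1c.measurable hF1m hi1 hF1i)
  obtain ⟨C1, hC1⟩ := hrep1.l1Lipschitz hp1c.measurable hF1m hi1 hF1L
  have hi2 : Integrable p2 :=
    integrable_deriv_of_l1Lipschitz hi1 (fun x => (hd1 x).hasDerivAt) hC1
  have hp1L := hrep1.l1Holder hp1c.measurable hF1m hi1 hF1i
  have hAL := (hw3.mul hp1H).mul_L1Holder hw3m hp1L
  have hF2i : Integrable fun x => κ * iteratedDeriv 3 W (φ x) * p1 x * p1 x +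
      κ * iteratedDeriv 2 W (φ x) * p2 x :=
    hAL.1.add (hi2.bdd_mul hw2m.aestronglyMeasurable (Eventually.of_forall hNB))
  have hF2L := hAL.add (hw2.mul_L1Holder hw2m (hrep2.l1Holder hp2m hF2m hi2 hF2i))
  obtain ⟨C2, hC2⟩ := hrep2.l1Lipschitz hp2m hF2m hi2 hF2L
  have hi3 : Integrable (deriv p2) :=
    integrable_deriv_of_l1Lipschitz hi2 (fun x => (hd2 x).hasDerivAt) hC2
  -- collecting the constants
  set J1 := ∫ x, |p1 x|
  set J2 := ∫ x, |p2 x|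
  set J3 := ∫ x, |deriv p2 x|
  have hJ1 : 0 ≤ J1 := integral_nonneg fun _ => abs_nonneg _
  have hJ2 : 0 ≤ J2 := integral_nonneg fun _ => abs_nonneg _
  have hJ3 : 0 ≤ J3 := integral_nonneg fun _ => abs_nonneg _
  have q1 := (abs_nonneg _).trans (hM1 0)
  have q2 := (abs_nonneg _).trans (hp2b 0)
  set M4 := max M3 N2 + 4 * N2
  have q3 := (abs_nonneg _).trans (hb2 0)
  refine ⟨1 + M1 + M3 + M4 + J1 + J2 + J3,
    ⟨hφ.differentiable, fun x => (hφ.abs_le_one x).trans (by linarith),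
      fun x => (hM1 x).trans (by linarith), hi1, by linarith⟩,
    ⟨hd1, fun x => (hM1 x).trans (by linarith), fun x => (hp2b x).trans (by linarith), hi2,
      by linarith⟩,
    ⟨hd2, fun x => (hp2b x).trans (by linarith), fun x => (hb2 x).trans (by linarith), hi3,
      by linarith⟩⟩

/-- The derivative of the layer solution decays like `1/|x|`: in its Poisson representation the
right-hand side is positive outside a bounded set, whose contribution is `O(1/x²)`, and `P₁φ'` is
controlled by the tails of `φ`. -/
theorem exists_deriv_le (hW : IsMultiWell W) (hφ : IsLayerSolution n W φ) :
    ∃ C, 0 ≤ C ∧ ∀ x, deriv φ x ≤ C / (1 + |x|) := by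
  obtain ⟨C0, hC0⟩ := hφ.exists_tail hW
  obtain ⟨c, r, hc, hr, hr2, h0, h1⟩ := hW.exists_well
  obtain ⟨R1, hR1⟩ := eventually_atTop.mp
    (hφ.tendsto_atTop.eventually_const_lt (by linarith : 1 - r < 1))
  obtain ⟨R2, hR2⟩ := eventually_atBot.mp (hφ.tendsto_atBot.eventually_lt_const hr)
  obtain ⟨M1, hM1⟩ := hφ.deriv_bounded
  obtain ⟨B, hB⟩ := hφ.exists_bound_iter hW (k := 2) (by norm_num)
  have hκ := inv_pos.mpr (layerConst_pos n)
  set κ := Real.pi⁻¹ * (layerConst n)⁻¹ with hκdef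
  have hκ0 : 0 < κ := by positivity
  have hB0 : 0 ≤ B := (abs_nonneg _).trans (hB 0)
  have hM10 : 0 ≤ M1 := (abs_nonneg _).trans (hM1 0)
  have hC00 : 0 ≤ C0 := by
    have := (hC0 1 one_pos).2
    rw [div_one] at this
    exact (hφ.pos _).le.trans this
  set R := max 1 (max |R1| |R2|) with hR
  have hR1' : 1 ≤ R := le_max_left _ _
  have hf := hφ.hasPoisRep_deriv hW
  set f : ℝ → ℝ := fun x => κ * iteratedDeriv 2 W (φ x) * deriv φ x with hfdef
  have hp1c : Continuous (deriv φ) := hφ.contDiff.continuous_deriv le_rfl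
  have hfm : Measurable f :=
    ((hφ.measurable_iter hW (by norm_num)).const_mul κ).mul hp1c.measurable
  have hfb : ∀ x, |f x| ≤ κ * B * M1 := by
    intro x
    rw [hfdef, abs_mul, abs_mul, abs_of_pos hκ0]
    gcongr
    · exact hB x
    · exact hM1 x
  have hfi : Integrable f := by
    refine hφ.integrable_deriv.bdd_mul (c := κ * B)
      ((hφ.measurable_iter hW (by norm_num)).const_mul κ).aestronglyMeasurable
      (Eventually.of_forall fun x => ?_)
    rw [norm_mul, Real.norm_of_nonneg hκ0.le]
    exact mul_le_mul_of_nonneg_left (hB x) hκ0.le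
  have hfpos : ∀ y, R ≤ |y| → 0 ≤ f y := by
    intro y hy
    have hd := (hφ.deriv_pos y).le
    have : c ≤ iteratedDeriv 2 W (φ y) := by
      have a1 : |R1| ≤ R := (le_max_left _ _).trans (le_max_right _ _)
      have a2 : |R2| ≤ R := (le_max_right _ _).trans (le_max_right _ _)
      rcases le_abs.mp hy with h | h
      · exact (h1 (φ y) ⟨(hR1 y (by linarith [le_abs_self R1])).le, (hφ.lt_one y).le⟩).1
      · exact (h0 (φ y) ⟨(hφ.pos y).le, (hR2 y (by linarith [neg_abs_le R2])).le⟩).1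
    have : 0 < iteratedDeriv 2 W (φ y) := hc.trans_le this
    rw [hfdef]; positivity
  set A := ∫ x, |f x| with hA
  have hA0 : 0 ≤ A := integral_nonneg fun _ => abs_nonneg _
  have hpi : Real.pi⁻¹ ≤ 1 := inv_le_one_of_one_le₀ (by linarith [Real.pi_gt_three])
  have hker : ∀ t ∈ Ioc (0 : ℝ) 1, ∀ z x : ℝ, x ≠ 0 → |x| / 2 ≤ |z| →
      poissonKer t z ≤ 4 / x ^ 2 := by
    intro t ht z x hx hz
    have hx2 : 0 < x ^ 2 := by positivity
    have ht0 := ht.1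
    have hz2 : x ^ 2 / 4 ≤ z ^ 2 := by
      rw [← sq_abs z, ← sq_abs x]
      have := pow_le_pow_left₀ (by positivity) hz 2
      linarith
    unfold poissonKer
    have e1 : (z ^ 2 + t ^ 2)⁻¹ ≤ 4 / x ^ 2 := by
      rw [inv_eq_one_div, div_le_div_iff₀ (by positivity) hx2]
      nlinarith [sq_nonneg t]
    calc _ ≤ 1 * 1 * (4 / x ^ 2) := by
          gcongr
          exact ht.2
      _ = _ := by ring
  have hmain : ∀ x, 2 * R ≤ |x| → deriv φ x ≤ (2 * C0 + 4 + 4 * A) / |x| := by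
    intro x hx
    have hx0 : x ≠ 0 := by rintro rfl; simp at hx; linarith
    have hxp : 0 < |x| := abs_pos.mpr hx0
    have hx1 : 1 ≤ |x| := by linarith
    have hsq : 4 / x ^ 2 ≤ 4 / |x| := by
      rw [← sq_abs]
      gcongr
      nlinarith
    have b1 : pois (deriv φ) 1 x ≤ (2 * C0 + 4) / |x| := by
      rw [pois_eq one_pos]
      have hki : Integrable fun y => deriv φ y * poissonKer 1 (x - y) :=
        ((integrable_poissonKer one_pos).comp_sub_left x).bdd_mul hp1c.aestronglyMeasurable
          (Eventually.of_forall hM1)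
      -- split at `x/2`; on the side of `x` the total increment of `φ` is small
      obtain ⟨S, hS, hSi, hSf⟩ : ∃ S : Set ℝ, MeasurableSet S ∧
          ∫ y in S, deriv φ y ≤ 2 * C0 / |x| ∧ ∀ y ∉ S, |x| / 2 ≤ |x - y| := by
        rcases lt_or_gt_of_ne hx0 with hneg | hpos
        · refine ⟨Iic (x / 2), measurableSet_Iic, ?_, fun y hy => ?_⟩
          · rw [hφ.integral_Iic, abs_of_neg hneg]
            have := (hC0 (-(x / 2)) (by linarith)).2
            rw [neg_neg] at this
            refine this.trans (le_of_eq ?_)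
            field_simp
          · rw [mem_Iic, not_le] at hy
            rw [abs_of_neg hneg, abs_of_neg (by linarith)]; linarith
        · refine ⟨Ioi (x / 2), measurableSet_Ioi, ?_, fun y hy => ?_⟩
          · rw [hφ.integral_Ioi, abs_of_pos hpos]
            refine (hC0 (x / 2) (by linarith)).1.trans (le_of_eq ?_)
            field_simp
          · rw [mem_Ioi, not_lt] at hy
            rw [abs_of_pos hpos, abs_of_pos (by linarith)]; linarith
      have hle : ∫ y, deriv φ y * poissonKer 1 (x - y) ≤
          ∫ y, (S.indicator (deriv φ) y + 4 / x ^ 2 * deriv φ y) := by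
        refine integral_mono hki ((hφ.integrable_deriv.indicator hS).add
          (hφ.integrable_deriv.const_mul _)) fun y => ?_
        have hd := (hφ.deriv_pos y).le
        by_cases hy : y ∈ S
        · simp only [indicator_of_mem hy]
          have : poissonKer 1 (x - y) ≤ 1 := by
            rw [poissonKer_eq one_pos, inv_one, one_mul]; exact cauchyKer_le _
          have : 0 ≤ 4 / x ^ 2 * deriv φ y := by positivity
          nlinarith
        · simp only [indicator_of_notMem hy, zero_add]
          rw [mul_comm]
          exact mul_le_mul_of_nonneg_right (hker 1 ⟨one_pos, le_rfl⟩ _ x hx0 (hSf y hy)) hd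
      rw [integral_add (hφ.integrable_deriv.indicator hS) (hφ.integrable_deriv.const_mul _),
        integral_indicator hS, integral_const_mul, hφ.integral_deriv, mul_one] at hle
      rw [add_div]
      linarith
    have b2 : ∀ t ∈ Ioc (0 : ℝ) 1, -(4 * A / |x|) ≤ pois f t x := by
      intro t ht
      rw [pois_eq ht.1]
      have hki : Integrable fun y => f y * poissonKer t (x - y) :=
        ((integrable_poissonKer ht.1).comp_sub_left x).bdd_mul hfm.aestronglyMeasurable
          (Eventually.of_forall hfb)
      have hle : ∫ y, -(4 / x ^ 2 * |f y|) ≤ ∫ y, f y * poissonKer t (x - y) := by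
        refine integral_mono (hfi.abs.const_mul _).neg hki fun y => ?_
        have hk0 := poissonKer_nonneg ht.1 (x - y)
        simp only
        rcases le_or_gt R |y| with hy | hy
        · have := mul_nonneg (hfpos y hy) hk0
          have : 0 ≤ 4 / x ^ 2 * |f y| := by positivity
          linarith
        · have hz : |x| / 2 ≤ |x - y| := by
            have := abs_sub_abs_le_abs_sub x y
            linarith
          have h3 := mul_le_mul_of_nonneg_right (hker t ht _ x hx0 hz) (abs_nonneg (f y))
          have h4 : -(|f y| * poissonKer t (x - y)) ≤ f y * poissonKer t (x - y) := by
            rw [← neg_mul]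
            exact mul_le_mul_of_nonneg_right (neg_abs_le _) hk0
          linarith
      rw [integral_neg, integral_const_mul] at hle
      refine le_trans ?_ hle
      have := mul_le_mul_of_nonneg_right hsq hA0
      rw [neg_le_neg_iff, mul_div_right_comm]
      exact this
    have b3 : -(4 * A / |x|) ≤ ∫ t in (0 : ℝ)..1, pois f t x := by
      have : ∫ t in (0 : ℝ)..1, -(4 * A / |x|) ≤ ∫ t in (0 : ℝ)..1, pois f t x := by
        rw [intervalIntegral.integral_of_le zero_le_one, intervalIntegral.integral_of_le zero_le_one]
        refine setIntegral_mono_on (integrableOn_const (by simp))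
          ((intervalIntegrable_iff_integrableOn_Ioc_of_le zero_le_one).mp
            (intervalIntegrable_pois hfm hfb x 0 1)) measurableSet_Ioc b2
      simpa using this
    rw [hf x, add_div]
    linarith
  refine ⟨max (2 * (2 * C0 + 4 + 4 * A)) (M1 * (1 + 2 * R)), ?_, fun x => ?_⟩
  · exact le_trans (by positivity) (le_max_left _ _)
  · rw [le_div_iff₀ (by positivity)]
    have hd := (hφ.deriv_pos x).le
    rcases le_total (2 * R) |x| with h | h
    · refine le_trans ?_ (le_max_left _ _)
      have := hmain x h
      rw [le_div_iff₀ (by linarith)] at this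
      nlinarith
    · refine le_trans ?_ (le_max_right _ _)
      have := (le_abs_self _).trans (hM1 x)
      gcongr

end IsLayerSolution

end

/-! ### Integrals over balls of functions of one variable -/

section

variable {n : ℕ}

/-- The volume of the unit ball. -/
def unitBallVol (n : ℕ) : ℝ := volume.real {z : EuclideanSpace ℝ (Fin n) | ‖z‖ < 1}

theorem unitBallVol_nonneg : 0 ≤ unitBallVol n := measureReal_nonneg

theorem measurableSet_norm_lt (r : ℝ) :
    MeasurableSet {z : EuclideanSpace ℝ (Fin n) | ‖z‖ < r} :=
  measurableSet_lt measurable_norm measurable_const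

theorem volume_norm_lt {r : ℝ} (hr : 0 < r) :
    volume {z : EuclideanSpace ℝ (Fin n) | ‖z‖ < r} = ENNReal.ofReal (r ^ n * unitBallVol n) := by
  have e : ∀ r : ℝ, {z : EuclideanSpace ℝ (Fin n) | ‖z‖ < r} = Metric.ball 0 r := fun r => by
    ext z; simp
  have h1 := Measure.addHaar_ball_of_pos volume (0 : EuclideanSpace ℝ (Fin n)) hr
  rw [finrank_euclideanSpace, Fintype.card_fin] at h1
  rw [ENNReal.ofReal_mul (by positivity), unitBallVol, measureReal_def, e, e, h1,
    ENNReal.ofReal_toReal measure_ball_lt_top.ne]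

/-- The integral of a function of `p · z` over a ball, in terms of the one-dimensional integral:
average the translates of the ball along `p`. -/
theorem lintegral_ball_inner_le {H : ℝ → ENNReal} (hH : Measurable H)
    {p : EuclideanSpace ℝ (Fin n)} (hp : p ≠ 0) {r : ℝ} (hr : 0 < r) :
    ∫⁻ z in {z : EuclideanSpace ℝ (Fin n) | ‖z‖ < r}, H (inner ℝ p z) ≤
      ENNReal.ofReal ((2 * r) ^ n * unitBallVol n / (r * ‖p‖)) * ∫⁻ s, H s := by
  have hpn : 0 < ‖p‖ := norm_pos_iff.mpr hp
  set e : EuclideanSpace ℝ (Fin n) := (‖p‖)⁻¹ • p with he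
  have hen : ‖e‖ = 1 := by rw [he, norm_smul, norm_inv, norm_norm, inv_mul_cancel₀ hpn.ne']
  have hpe : ∀ s : ℝ, inner ℝ p (s • e) = s * ‖p‖ := by
    intro s
    rw [he, inner_smul_right, inner_smul_right, real_inner_self_eq_norm_sq]
    field_simp
  set B := {z : EuclideanSpace ℝ (Fin n) | ‖z‖ < r} with hB
  set B2 := {z : EuclideanSpace ℝ (Fin n) | ‖z‖ < 2 * r} with hB2
  set I := ∫⁻ z in B, H (inner ℝ p z) with hI
  have hBm : MeasurableSet B := measurableSet_norm_lt r
  have hB2m : MeasurableSet B2 := measurableSet_norm_lt (2 * r)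
  have h1 : ∀ s ∈ Ioo 0 r, I ≤ ∫⁻ z in B2, H (inner ℝ p z + s * ‖p‖) := by
    intro s hs
    rw [hI, ← lintegral_indicator hBm, ← lintegral_indicator hB2m,
      ← lintegral_add_right_eq_self _ (s • e)]
    refine lintegral_mono fun z => ?_
    by_cases hz : z + s • e ∈ B
    · have hz2 : z ∈ B2 := by
        have h3 : ‖s • e‖ < r := by
          rw [norm_smul, hen, mul_one, Real.norm_of_nonneg hs.1.le]; exact hs.2
        have h4 : ‖z + s • e‖ < r := hz
        have h5 : ‖z‖ ≤ ‖z + s • e‖ + ‖s • e‖ := by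
          simpa using norm_sub_le (z + s • e) (s • e)
        change ‖z‖ < 2 * r
        linarith
      rw [indicator_of_mem hz, indicator_of_mem hz2, inner_add_right, hpe]
    · rw [indicator_of_notMem hz]; exact zero_le
  have h2 : ENNReal.ofReal r * I ≤ ∫⁻ s in Ioo 0 r, ∫⁻ z in B2, H (inner ℝ p z + s * ‖p‖) := by
    have : ∫⁻ _ in Ioo 0 r, I = ENNReal.ofReal r * I := by
      rw [setLIntegral_const, Real.volume_Ioo, sub_zero, mul_comm]
    rw [← this]
    exact setLIntegral_mono' measurableSet_Ioo h1
  have h3 : ∫⁻ s in Ioo 0 r, ∫⁻ z in B2, H (inner ℝ p z + s * ‖p‖) ≤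
      ENNReal.ofReal ((2 * r) ^ n * unitBallVol n) * (ENNReal.ofReal (‖p‖⁻¹) * ∫⁻ s, H s) := by
    rw [lintegral_lintegral_swap]
    · rw [← volume_norm_lt (by positivity), mul_comm, ← setLIntegral_const]
      refine lintegral_mono fun z => ?_
      refine (setLIntegral_le_lintegral _ _).trans (le_of_eq ?_)
      have hm := Real.map_volume_mul_right (a := ‖p‖) hpn.ne'
      have hH2 : Measurable fun s => H (inner ℝ p z + s) := hH.comp (by fun_prop)
      rw [← lintegral_map (f := fun s => H (inner ℝ p z + s)) (g := fun s => s * ‖p‖) hH2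
        (by fun_prop), hm, lintegral_smul_measure, lintegral_add_left_eq_self,
        abs_of_pos (inv_pos.mpr hpn)]
      rfl
    · refine Measurable.aemeasurable ?_
      exact hH.comp (by fun_prop)
  have h4 := h2.trans h3
  have h5 : ENNReal.ofReal ((2 * r) ^ n * unitBallVol n / (r * ‖p‖)) = ENNReal.ofReal r⁻¹ *
      (ENNReal.ofReal ((2 * r) ^ n * unitBallVol n) * ENNReal.ofReal (‖p‖⁻¹)) := by
    have := unitBallVol_nonneg (n := n)
    rw [← ENNReal.ofReal_mul (by positivity), ← ENNReal.ofReal_mul (by positivity)]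
    congr 1; field_simp
  calc I = ENNReal.ofReal r⁻¹ * (ENNReal.ofReal r * I) := by
        rw [← mul_assoc, ← ENNReal.ofReal_mul (by positivity), inv_mul_cancel₀ hr.ne',
          ENNReal.ofReal_one, one_mul]
    _ ≤ _ := by
      rw [h5, mul_assoc, mul_assoc]
      gcongr

/-- Layer-cake estimate of a weighted integral by the integrals over balls. -/
theorem lintegral_weight_le {g : EuclideanSpace ℝ (Fin n) → ENNReal} (hg : Measurable g)
    {m : ℕ} (hm : m ≠ 0) {a A : ℝ} :
    ∫⁻ z in {z : EuclideanSpace ℝ (Fin n) | a ≤ ‖z‖ ∧ ‖z‖ < A},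
        g z * ENNReal.ofReal ((‖z‖ ^ m)⁻¹) ≤
      ENNReal.ofReal ((A ^ m)⁻¹) * (∫⁻ z in {z : EuclideanSpace ℝ (Fin n) | ‖z‖ < A}, g z) +
      ∫⁻ r in Ioc a A, ENNReal.ofReal (m * (r ^ (m + 1))⁻¹) *
        ∫⁻ z in {z : EuclideanSpace ℝ (Fin n) | ‖z‖ < r}, g z := by
  set S := {z : EuclideanSpace ℝ (Fin n) | a ≤ ‖z‖ ∧ ‖z‖ < A} with hS
  have hSm : MeasurableSet S :=
    (measurableSet_le measurable_const measurable_norm).inter (measurableSet_norm_lt A)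
  set w : ℝ → ENNReal := fun r => ENNReal.ofReal (m * (r ^ (m + 1))⁻¹) with hw
  have hwm : Measurable w := by fun_prop
  have h1 : ∀ z ∈ S, g z * ENNReal.ofReal ((‖z‖ ^ m)⁻¹) ≤ g z * ENNReal.ofReal ((A ^ m)⁻¹) +
      ∫⁻ r in Ioc a A, w r * {z : EuclideanSpace ℝ (Fin n) | ‖z‖ < r}.indicator g z := by
    intro z hz
    have e : ∫⁻ r in Ioc a A, w r * {z : EuclideanSpace ℝ (Fin n) | ‖z‖ < r}.indicator g z =
        g z * ∫⁻ r in Ioc a A, (Ioi ‖z‖).indicator w r := by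
      rw [← lintegral_const_mul _ (hwm.indicator measurableSet_Ioi)]
      refine lintegral_congr fun r => ?_
      by_cases hr : ‖z‖ < r
      · rw [indicator_of_mem (by exact hr), indicator_of_mem (by exact hr), mul_comm]
      · rw [indicator_of_notMem (by exact hr), indicator_of_notMem (by exact hr), mul_zero,
          mul_zero]
    rw [e, ← mul_add]
    gcongr
    rcases (norm_nonneg z).eq_or_lt with h0 | h0
    · rw [← h0]; simp [hm]
    have hA : 0 < A := h0.trans hz.2
    rw [setLIntegral_indicator measurableSet_Ioi]
    have hset : Ioi ‖z‖ ∩ Ioc a A = Ioc ‖z‖ A := by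
      ext r
      simp only [mem_inter_iff, mem_Ioi, mem_Ioc]
      exact ⟨fun h => ⟨h.1, h.2.2⟩, fun h => ⟨h.1, hz.1.trans_lt h.1, h.2⟩⟩
    rw [hset]
    have hpos : ∀ r ∈ Icc ‖z‖ A, 0 < r := fun r hr => h0.trans_le hr.1
    have hci : ContinuousOn (fun r : ℝ => (m : ℝ) * (r ^ (m + 1))⁻¹) (Icc ‖z‖ A) :=
      continuousOn_const.mul (ContinuousOn.inv₀ (by fun_prop)
        fun r hr => (pow_pos (hpos r hr) _).ne')
    have hi : IntegrableOn (fun r : ℝ => (m : ℝ) * (r ^ (m + 1))⁻¹) (Ioc ‖z‖ A) :=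
      (hci.integrableOn_Icc).mono_set Ioc_subset_Icc_self
    rw [← ofReal_integral_eq_lintegral_ofReal hi, ← ENNReal.ofReal_add]
    · refine ENNReal.ofReal_le_ofReal (le_of_eq ?_)
      rw [← intervalIntegral.integral_of_le hz.2.le]
      have hFTC := intervalIntegral.integral_eq_sub_of_hasDerivAt (a := ‖z‖) (b := A)
        (f := fun r : ℝ => -(r ^ m)⁻¹) (f' := fun r : ℝ => (m : ℝ) * (r ^ (m + 1))⁻¹)
        (fun r hr => by
          rw [uIcc_of_le hz.2.le] at hr
          have hr0 := hpos r hr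
          have := ((hasDerivAt_pow m r).inv (pow_pos hr0 m).ne').neg
          refine this.congr_deriv ?_
          obtain ⟨k, rfl⟩ := Nat.exists_eq_succ_of_ne_zero hm
          simp only [Nat.succ_eq_add_one, Nat.add_sub_cancel]
          field_simp
          ring)
        (by
          rw [intervalIntegrable_iff_integrableOn_Ioc_of_le hz.2.le]
          exact hi)
      rw [hFTC]; ring
    · positivity
    · refine setIntegral_nonneg measurableSet_Ioc fun r hr => ?_
      have := h0.trans hr.1
      positivity
    · refine (ae_restrict_iff' measurableSet_Ioc).mpr (Eventually.of_forall fun r hr => ?_)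
      have := h0.trans hr.1
      simp only [Pi.zero_apply]
      positivity
  refine (setLIntegral_mono' hSm h1).trans ?_
  have hjm : Measurable fun q : EuclideanSpace ℝ (Fin n) × ℝ =>
      w q.2 * {z : EuclideanSpace ℝ (Fin n) | ‖z‖ < q.2}.indicator g q.1 := by
    refine (hwm.comp measurable_snd).mul ?_
    have : (fun q : EuclideanSpace ℝ (Fin n) × ℝ =>
        {z : EuclideanSpace ℝ (Fin n) | ‖z‖ < q.2}.indicator g q.1) =
        {q : EuclideanSpace ℝ (Fin n) × ℝ | ‖q.1‖ < q.2}.indicator fun q => g q.1 := by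
      ext q; simp [indicator]
    rw [this]
    exact (hg.comp measurable_fst).indicator
      (measurableSet_lt (measurable_norm.comp measurable_fst) measurable_snd)
  rw [lintegral_add_left (by fun_prop)]
  refine add_le_add ?_ ?_
  · rw [lintegral_mul_const _ hg, mul_comm]
    gcongr
    exact fun z hz => hz.2
  · refine (setLIntegral_le_lintegral S _).trans ?_
    rw [lintegral_lintegral_swap hjm.aemeasurable]
    refine lintegral_mono fun r => ?_
    rw [lintegral_const_mul _ (hg.indicator (measurableSet_norm_lt r)),
      lintegral_indicator (measurableSet_norm_lt r)]

/-- Integrals of order `rᵐ⁺¹` over balls beat the weight `‖z‖⁻ᵐ` by one power of the radius. -/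
theorem lintegral_weight_le_of_pow_succ {g : EuclideanSpace ℝ (Fin n) → ENNReal}
    (hg : Measurable g) {m : ℕ} (hm : m ≠ 0) {A Λ : ℝ} (hA : 0 < A) (hΛ : 0 ≤ Λ)
    (hball : ∀ r, 0 < r → r ≤ A →
      ∫⁻ z in {z : EuclideanSpace ℝ (Fin n) | ‖z‖ < r}, g z ≤ ENNReal.ofReal (Λ * r ^ (m + 1))) :
    ∫⁻ z in {z : EuclideanSpace ℝ (Fin n) | ‖z‖ < A}, g z * ENNReal.ofReal ((‖z‖ ^ m)⁻¹) ≤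
      ENNReal.ofReal ((m + 1) * Λ * A) := by
  have h := lintegral_weight_le hg hm (a := 0) (A := A)
  simp only [norm_nonneg, true_and] at h
  refine h.trans ?_
  have e1 : ENNReal.ofReal ((A ^ m)⁻¹) * (∫⁻ z in {z : EuclideanSpace ℝ (Fin n) | ‖z‖ < A}, g z) ≤
      ENNReal.ofReal (Λ * A) := by
    refine (mul_le_mul_right (hball A hA le_rfl) _).trans (le_of_eq ?_)
    rw [← ENNReal.ofReal_mul (by positivity)]
    congr 1; field_simp; ring
  have e2 : ∫⁻ r in Ioc 0 A, ENNReal.ofReal (m * (r ^ (m + 1))⁻¹) *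
      (∫⁻ z in {z : EuclideanSpace ℝ (Fin n) | ‖z‖ < r}, g z) ≤ ENNReal.ofReal (m * Λ * A) := by
    calc _ ≤ ∫⁻ _ in Ioc 0 A, ENNReal.ofReal (m * Λ) := by
          refine setLIntegral_mono' measurableSet_Ioc fun r hr => ?_
          have hr0 := hr.1
          refine (mul_le_mul_right (hball r hr.1 hr.2) _).trans (le_of_eq ?_)
          rw [← ENNReal.ofReal_mul (by positivity)]
          congr 1; field_simp
      _ = _ := by
          rw [setLIntegral_const, Real.volume_Ioc, sub_zero, ← ENNReal.ofReal_mul (by positivity)]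
  refine (add_le_add e1 e2).trans (le_of_eq ?_)
  rw [← ENNReal.ofReal_add (by positivity) (by positivity)]
  congr 1; ring

/-- Integrals of order `rᵐ` over balls are critical for the weight `‖z‖⁻ᵐ`, at the cost of a logarithm. -/
theorem lintegral_weight_le_log {g : EuclideanSpace ℝ (Fin n) → ENNReal}
    (hg : Measurable g) {m : ℕ} (hm : m ≠ 0) {A Λ : ℝ} (hA : 1 ≤ A) (hΛ : 0 ≤ Λ)
    (hball : ∀ r, 0 < r → r ≤ A →
      ∫⁻ z in {z : EuclideanSpace ℝ (Fin n) | ‖z‖ < r}, g z ≤ ENNReal.ofReal (Λ * r ^ m)) :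
    ∫⁻ z in {z : EuclideanSpace ℝ (Fin n) | 1 ≤ ‖z‖ ∧ ‖z‖ < A},
        g z * ENNReal.ofReal ((‖z‖ ^ m)⁻¹) ≤ ENNReal.ofReal (Λ * (1 + m * Real.log A)) := by
  have hA0 : 0 < A := one_pos.trans_le hA
  refine (lintegral_weight_le hg hm).trans ?_
  have e1 : ENNReal.ofReal ((A ^ m)⁻¹) * (∫⁻ z in {z : EuclideanSpace ℝ (Fin n) | ‖z‖ < A}, g z) ≤
      ENNReal.ofReal Λ := by
    refine (mul_le_mul_right (hball A hA0 le_rfl) _).trans (le_of_eq ?_)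
    rw [← ENNReal.ofReal_mul (by positivity)]
    congr 1; field_simp
  have hi : IntegrableOn (fun r : ℝ => m * Λ * r⁻¹) (Ioc 1 A) := by
    refine (ContinuousOn.integrableOn_Icc ?_).mono_set Ioc_subset_Icc_self
    exact continuousOn_const.mul (continuousOn_inv₀.mono fun r hr => by
      have : 0 < r := one_pos.trans_le hr.1
      exact this.ne')
  have e2 : ∫⁻ r in Ioc 1 A, ENNReal.ofReal (m * (r ^ (m + 1))⁻¹) *
      (∫⁻ z in {z : EuclideanSpace ℝ (Fin n) | ‖z‖ < r}, g z) ≤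
      ENNReal.ofReal (m * Λ * Real.log A) := by
    calc _ ≤ ∫⁻ r in Ioc 1 A, ENNReal.ofReal (m * Λ * r⁻¹) := by
          refine setLIntegral_mono' measurableSet_Ioc fun r hr => ?_
          have hr0 : 0 < r := one_pos.trans hr.1
          refine (mul_le_mul_right (hball r hr0 hr.2) _).trans (le_of_eq ?_)
          rw [← ENNReal.ofReal_mul (by positivity)]
          congr 1; field_simp; ring
      _ = _ := by
          rw [← ofReal_integral_eq_lintegral_ofReal hi, ← intervalIntegral.integral_of_le hA,
            intervalIntegral.integral_const_mul, integral_inv_of_pos one_pos hA0, div_one]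
          refine (ae_restrict_iff' measurableSet_Ioc).mpr (Eventually.of_forall fun r hr => ?_)
          have : 0 < r := one_pos.trans hr.1
          simp only [Pi.zero_apply]
          positivity
  have hlog := Real.log_nonneg hA
  refine (add_le_add e1 e2).trans (le_of_eq ?_)
  rw [← ENNReal.ofReal_add (by positivity) (by positivity)]
  congr 1; ring

end

/-! ### The integrated kernel difference -/

section

variable {n : ℕ}

theorem IsProfile.nonneg {ψ : ℝ → ℝ} {M : ℝ} (h : IsProfile ψ M) : 0 ≤ M :=
  (abs_nonneg _).trans (h.abs_le 0)

theorem IsProfile.abs_sub_le {ψ : ℝ → ℝ} {M : ℝ} (h : IsProfile ψ M) (a b : ℝ) :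
    |ψ a - ψ b| ≤ M * |a - b| :=
  Convex.norm_image_sub_le_of_norm_deriv_le (s := univ) (fun x _ => h.differentiable x)
    (fun x _ => h.abs_deriv_le x) convex_univ (mem_univ b) (mem_univ a)

/-- `D` is the increment of a function with gradient `p`, up to a quadratic error. -/
structure IsIncrement (D : EuclideanSpace ℝ (Fin n) → ℝ) (p : EuclideanSpace ℝ (Fin n))
    (κ : ℝ) : Prop where
  measurable : Measurable D
  nonneg : 0 ≤ κ
  abs_sub_le : ∀ z, |D z - inner ℝ p z| ≤ κ * ‖z‖ ^ 2

theorem integrableOn_sq_div {A : ℝ} (hA : 0 < A) :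
    IntegrableOn (fun z : EuclideanSpace ℝ (Fin n) => ‖z‖ ^ 2 / ‖z‖ ^ (n + 1)) {z | ‖z‖ < A} ∧
    ∫ z in {z : EuclideanSpace ℝ (Fin n) | ‖z‖ < A}, ‖z‖ ^ 2 / ‖z‖ ^ (n + 1) ≤
      (n + 2) * unitBallVol n * A := by
  have hv := unitBallVol_nonneg (n := n)
  have h := lintegral_weight_le_of_pow_succ (n := n) (g := fun z => ENNReal.ofReal (‖z‖ ^ 2))
    (by fun_prop) (m := n + 1) (by omega) hA hv (fun r hr _ => by
      calc _ ≤ ∫⁻ _ in {z : EuclideanSpace ℝ (Fin n) | ‖z‖ < r}, ENNReal.ofReal (r ^ 2) := by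
            refine setLIntegral_mono' (measurableSet_norm_lt r) fun z hz => ?_
            have hz : ‖z‖ < r := hz
            gcongr
        _ = _ := by
            rw [setLIntegral_const, volume_norm_lt hr, ← ENNReal.ofReal_mul (by positivity)]
            congr 1; ring)
  have e : ∀ z : EuclideanSpace ℝ (Fin n), ENNReal.ofReal (‖z‖ ^ 2) *
      ENNReal.ofReal ((‖z‖ ^ (n + 1))⁻¹) = ENNReal.ofReal (‖z‖ ^ 2 / ‖z‖ ^ (n + 1)) := fun z => by
    rw [← ENNReal.ofReal_mul (by positivity), div_eq_mul_inv]
  simp_rw [e] at h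
  have hm : AEStronglyMeasurable
      (fun z : EuclideanSpace ℝ (Fin n) => ‖z‖ ^ 2 / ‖z‖ ^ (n + 1))
      (volume.restrict {z | ‖z‖ < A}) := by
    refine Measurable.aestronglyMeasurable ?_
    fun_prop
  have h0 : 0 ≤ᵐ[volume.restrict {z : EuclideanSpace ℝ (Fin n) | ‖z‖ < A}]
      (fun z : EuclideanSpace ℝ (Fin n) => ‖z‖ ^ 2 / ‖z‖ ^ (n + 1)) :=
    Eventually.of_forall fun z => by simp only [Pi.zero_apply]; positivity
  refine ⟨⟨hm, ?_⟩, ?_⟩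
  · rw [hasFiniteIntegral_iff_ofReal h0]
    exact h.trans_lt ENNReal.ofReal_lt_top
  · rw [integral_eq_lintegral_of_nonneg_ae h0 hm]
    refine ENNReal.toReal_le_of_le_ofReal (by positivity) (h.trans (le_of_eq ?_))
    congr 1; push_cast; ring

/-- A kernel of order `‖z‖² / ‖z‖ⁿ⁺¹` is integrable on balls. -/
theorem integrableOn_of_le_sq {F : EuclideanSpace ℝ (Fin n) → ℝ} (hF : Measurable F) {c A : ℝ}
    (hA : 0 < A) (hle : ∀ z, ‖z‖ < A → |F z| ≤ c * (‖z‖ ^ 2 / ‖z‖ ^ (n + 1))) :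
    IntegrableOn F {z | ‖z‖ < A} := by
  refine Integrable.mono' ((integrableOn_sq_div hA).1.const_mul c) hF.aestronglyMeasurable ?_
  exact (ae_restrict_iff' (measurableSet_norm_lt A)).mpr (Eventually.of_forall hle)

theorem abs_integral_le_sq {F : EuclideanSpace ℝ (Fin n) → ℝ} {c A : ℝ} (hc : 0 ≤ c)
    (hA : 0 < A) (hle : ∀ z, ‖z‖ < A → |F z| ≤ c * (‖z‖ ^ 2 / ‖z‖ ^ (n + 1))) :
    |∫ z in {z | ‖z‖ < A}, F z| ≤ c * ((n + 2) * unitBallVol n * A) := by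
  have h := norm_integral_le_of_norm_le (f := F)
    ((integrableOn_sq_div (n := n) hA).1.const_mul c)
    ((ae_restrict_iff' (measurableSet_norm_lt A)).mpr (Eventually.of_forall hle))
  refine h.trans ?_
  rw [integral_const_mul]
  exact mul_le_mul_of_nonneg_left (integrableOn_sq_div hA).2 hc

/-- The oscillation of a profile is controlled by the mass of its derivative. -/
theorem IsProfile.enorm_sub_le {ψ : ℝ → ℝ} {M : ℝ} (h : IsProfile ψ M) {u τ δ : ℝ}
    (hτ : |τ| ≤ δ) :
    ‖ψ (u + τ) - ψ u‖ₑ ≤ ∫⁻ σ in Icc (-δ) δ, ‖deriv ψ (u + σ)‖ₑ := by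
  have h1 : ψ (u + τ) - ψ u = ∫ σ in (0 : ℝ)..τ, deriv ψ (u + σ) := by
    rw [intervalIntegral.integral_comp_add_left, add_zero]
    rw [intervalIntegral.integral_eq_sub_of_hasDerivAt
      (fun x _ => (h.differentiable x).hasDerivAt) h.integrable_deriv.intervalIntegrable]
  rw [h1, intervalIntegral.intervalIntegral_eq_integral_uIoc, enorm_smul]
  have h2 : ‖(if 0 ≤ τ then (1 : ℝ) else -1)‖ₑ = 1 := by split_ifs <;> simp
  rw [h2, one_mul]
  refine (enorm_integral_le_lintegral_enorm _).trans (lintegral_mono_set ?_)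
  intro σ hσ
  have h3 := _root_.abs_le.mp hτ
  rcases le_total 0 τ with h0 | h0
  · rw [uIoc_of_le h0] at hσ
    exact ⟨by linarith [hσ.1, h3.1, h3.2], hσ.2.trans h3.2⟩
  · rw [uIoc_of_ge h0] at hσ
    exact ⟨by linarith [hσ.1, h3.1, h3.2], by linarith [hσ.2, h3.1, h3.2]⟩

/-- On a ball of radius `r` the increment is within `κ r²` of `p · z`, so that the oscillation of `ψ`
is at most the mass of `ψ'` within distance `κ r²` of `ξ + p · z`. -/
theorem lintegral_ball_profile_le {ψ : ℝ → ℝ} {M : ℝ} (h : IsProfile ψ M)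
    {D : EuclideanSpace ℝ (Fin n) → ℝ} {p : EuclideanSpace ℝ (Fin n)} {κ : ℝ}
    (hD : IsIncrement D p κ) (hp : p ≠ 0) (ξ : ℝ) {r : ℝ} (hr : 0 < r) :
    ∫⁻ z in {z : EuclideanSpace ℝ (Fin n) | ‖z‖ < r},
        ‖ψ (ξ + D z) - ψ (ξ + inner ℝ p z)‖ₑ ≤
      ENNReal.ofReal (2 ^ (n + 1) * unitBallVol n * M * κ / ‖p‖ * r ^ (n + 1)) := by
  have hv := unitBallVol_nonneg (n := n)
  have hM := h.nonneg
  have hκ := hD.nonneg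
  have hpn : 0 < ‖p‖ := norm_pos_iff.mpr hp
  set δ := κ * r ^ 2 with hδ
  have hδ0 : 0 ≤ δ := by positivity
  set H : ℝ → ENNReal := fun s => ∫⁻ σ in Icc (-δ) δ, ‖deriv ψ (ξ + s + σ)‖ₑ with hH
  have hdm : Measurable (deriv ψ) := measurable_deriv ψ
  have hjm : Measurable fun q : ℝ × ℝ => ‖deriv ψ (ξ + q.1 + q.2)‖ₑ :=
    (hdm.comp (by fun_prop)).enorm
  have hHm : Measurable H := hjm.lintegral_prod_right'
  have hHi : ∫⁻ s, H s ≤ ENNReal.ofReal (2 * δ * M) := by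
    rw [hH, lintegral_lintegral_swap hjm.aemeasurable]
    have e : ∀ σ : ℝ, ∫⁻ s, ‖deriv ψ (ξ + s + σ)‖ₑ ≤ ENNReal.ofReal M := by
      intro σ
      have e1 : ∀ s, ξ + s + σ = s + (ξ + σ) := fun s => by ring
      simp_rw [e1]
      rw [lintegral_add_right_eq_self (fun s => ‖deriv ψ s‖ₑ),
        ← ofReal_integral_norm_eq_lintegral_enorm h.integrable_deriv]
      exact ENNReal.ofReal_le_ofReal h.integral_le
    refine (lintegral_mono e).trans (le_of_eq ?_)
    rw [lintegral_const, Measure.restrict_apply_univ, Real.volume_Icc,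
      ← ENNReal.ofReal_mul hM]
    congr 1; ring
  calc _ ≤ ∫⁻ z in {z : EuclideanSpace ℝ (Fin n) | ‖z‖ < r}, H (inner ℝ p z) := by
        refine setLIntegral_mono' (measurableSet_norm_lt r) fun z hz => ?_
        have hz : ‖z‖ < r := hz
        have e : ξ + D z = ξ + inner ℝ p z + (D z - inner ℝ p z) := by ring
        rw [e]
        refine h.enorm_sub_le ((hD.abs_sub_le z).trans ?_)
        rw [hδ]; gcongr
    _ ≤ _ := lintegral_ball_inner_le hHm hp hr
    _ ≤ ENNReal.ofReal ((2 * r) ^ n * unitBallVol n / (r * ‖p‖)) * ENNReal.ofReal (2 * δ * M) := by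
        gcongr
    _ = _ := by
        rw [← ENNReal.ofReal_mul (by positivity)]
        congr 1
        rw [hδ]
        field_simp
        ring

/-- The kernel difference appearing in `a_ε`. -/
def kerDiff (ψ : ℝ → ℝ) (D : EuclideanSpace ℝ (Fin n) → ℝ) (p : EuclideanSpace ℝ (Fin n))
    (ξ : ℝ) (z : EuclideanSpace ℝ (Fin n)) : ℝ :=
  (ψ (ξ + D z) - ψ (ξ + inner ℝ p z)) / ‖z‖ ^ (n + 1)

section
variable {ψ : ℝ → ℝ} {M : ℝ} {D : EuclideanSpace ℝ (Fin n) → ℝ} {p : EuclideanSpace ℝ (Fin n)}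
  {κ A : ℝ}

theorem IsProfile.measurable_diff (h : IsProfile ψ M) (hD : IsIncrement D p κ) (ξ : ℝ) :
    Measurable fun z => ψ (ξ + D z) - ψ (ξ + inner ℝ p z) := by
  have hc := h.differentiable.continuous.measurable
  have := hD.measurable
  exact (hc.comp (by fun_prop)).sub (hc.comp (by fun_prop))

theorem IsProfile.measurable_kerDiff (h : IsProfile ψ M) (hD : IsIncrement D p κ) (ξ : ℝ) :
    Measurable (kerDiff ψ D p ξ) :=
  (h.measurable_diff hD ξ).div (by fun_prop)

theorem IsProfile.abs_diff_le (h : IsProfile ψ M) (hD : IsIncrement D p κ) (ξ : ℝ)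
    (z : EuclideanSpace ℝ (Fin n)) :
    |ψ (ξ + D z) - ψ (ξ + inner ℝ p z)| ≤ M * κ * ‖z‖ ^ 2 := by
  refine (h.abs_sub_le _ _).trans ?_
  rw [add_sub_add_left_eq_sub, mul_assoc]
  exact mul_le_mul_of_nonneg_left (hD.abs_sub_le z) h.nonneg

theorem IsProfile.abs_kerDiff_le (h : IsProfile ψ M) (hD : IsIncrement D p κ) (ξ : ℝ)
    (z : EuclideanSpace ℝ (Fin n)) :
    |kerDiff ψ D p ξ z| ≤ M * κ * (‖z‖ ^ 2 / ‖z‖ ^ (n + 1)) := by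
  rw [kerDiff, abs_div, abs_of_nonneg (pow_nonneg (norm_nonneg z) _), ← mul_div_assoc]
  exact div_le_div_of_nonneg_right (h.abs_diff_le hD ξ z) (by positivity)

theorem IsProfile.integrableOn_kerDiff (h : IsProfile ψ M) (hD : IsIncrement D p κ) (hA : 0 < A)
    (ξ : ℝ) : IntegrableOn (kerDiff ψ D p ξ) {z | ‖z‖ < A} :=
  integrableOn_of_le_sq (h.measurable_kerDiff hD ξ) hA fun z _ => h.abs_kerDiff_le hD ξ z

theorem IsProfile.abs_integral_kerDiff_le (h : IsProfile ψ M) (hD : IsIncrement D p κ)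
    (hA : 0 < A) (ξ : ℝ) :
    |∫ z in {z | ‖z‖ < A}, kerDiff ψ D p ξ z| ≤ M * κ * ((n + 2) * unitBallVol n * A) :=
  abs_integral_le_sq (mul_nonneg h.nonneg hD.nonneg) hA fun z _ => h.abs_kerDiff_le hD ξ z

/-- A weaker singularity: the kernel `‖z‖⁻ⁿ` gives a bound linear in the radius. -/
theorem IsProfile.integrableOn_diff_div (h : IsProfile ψ M) (hD : IsIncrement D p κ) (hn : n ≠ 0)
    (hp : p ≠ 0) (hA : 0 < A) (ξ : ℝ) :
    IntegrableOn (fun z => |ψ (ξ + D z) - ψ (ξ + inner ℝ p z)| / ‖z‖ ^ n) {z | ‖z‖ < A} ∧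
    ∫ z in {z | ‖z‖ < A}, |ψ (ξ + D z) - ψ (ξ + inner ℝ p z)| / ‖z‖ ^ n ≤
      (n + 1) * (2 ^ (n + 1) * unitBallVol n * M * κ / ‖p‖) * A := by
  have hv := unitBallVol_nonneg (n := n)
  have hM := h.nonneg
  have hκ := hD.nonneg
  have hgm := h.measurable_diff hD ξ
  have hb := lintegral_weight_le_of_pow_succ (n := n) hgm.enorm hn hA
    (Λ := 2 ^ (n + 1) * unitBallVol n * M * κ / ‖p‖) (by positivity)
    (fun r hr _ => lintegral_ball_profile_le h hD hp ξ hr)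
  have e : ∀ z, ‖ψ (ξ + D z) - ψ (ξ + inner ℝ p z)‖ₑ * ENNReal.ofReal ((‖z‖ ^ n)⁻¹) =
      ENNReal.ofReal (|ψ (ξ + D z) - ψ (ξ + inner ℝ p z)| / ‖z‖ ^ n) := fun z => by
    rw [← ofReal_norm, Real.norm_eq_abs, ← ENNReal.ofReal_mul (by positivity), div_eq_mul_inv]
  simp_rw [e] at hb
  have hm : AEStronglyMeasurable
      (fun z : EuclideanSpace ℝ (Fin n) => |ψ (ξ + D z) - ψ (ξ + inner ℝ p z)| / ‖z‖ ^ n)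
      (volume.restrict {z | ‖z‖ < A}) := by
    refine Measurable.aestronglyMeasurable ?_
    exact hgm.abs.div (by fun_prop)
  have h0 : 0 ≤ᵐ[volume.restrict {z : EuclideanSpace ℝ (Fin n) | ‖z‖ < A}]
      (fun z : EuclideanSpace ℝ (Fin n) => |ψ (ξ + D z) - ψ (ξ + inner ℝ p z)| / ‖z‖ ^ n) :=
    Eventually.of_forall fun z => by simp only [Pi.zero_apply]; positivity
  refine ⟨⟨hm, ?_⟩, ?_⟩
  · rw [hasFiniteIntegral_iff_ofReal h0]
    exact hb.trans_lt ENNReal.ofReal_lt_top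
  · rw [integral_eq_lintegral_of_nonneg_ae h0 hm]
    exact ENNReal.toReal_le_of_le_ofReal (by positivity) hb

/-- The logarithmic estimate of the kernel difference where the gradient does not vanish. -/
theorem IsProfile.abs_integral_kerDiff_le_log (h : IsProfile ψ M) (hD : IsIncrement D p κ)
    (hp : p ≠ 0) (hA : 1 ≤ A) (ξ : ℝ) :
    |∫ z in {z | ‖z‖ < A}, kerDiff ψ D p ξ z| ≤ M * κ * ((n + 2) * unitBallVol n) +
      2 ^ (n + 1) * unitBallVol n * M * κ / ‖p‖ * (1 + (n + 1) * Real.log A) := by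
  have hv := unitBallVol_nonneg (n := n)
  have hM := h.nonneg
  have hκ := hD.nonneg
  have hlog := Real.log_nonneg hA
  have hA0 : 0 < A := one_pos.trans_le hA
  have hi := h.integrableOn_kerDiff hD hA0 ξ
  have hset : {z : EuclideanSpace ℝ (Fin n) | ‖z‖ < A} =
      {z | ‖z‖ < 1} ∪ {z | 1 ≤ ‖z‖ ∧ ‖z‖ < A} := by
    ext z
    simp only [mem_ofPred_eq, mem_union]
    constructor
    · intro hz
      rcases lt_or_ge ‖z‖ 1 with h1 | h1
      · exact Or.inl h1
      · exact Or.inr ⟨h1, hz⟩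
    · rintro (h1 | h1)
      · linarith
      · exact h1.2
  have hSm : MeasurableSet {z : EuclideanSpace ℝ (Fin n) | 1 ≤ ‖z‖ ∧ ‖z‖ < A} :=
    (measurableSet_le measurable_const measurable_norm).inter (measurableSet_norm_lt A)
  have hdisj : Disjoint {z : EuclideanSpace ℝ (Fin n) | ‖z‖ < 1}
      {z : EuclideanSpace ℝ (Fin n) | 1 ≤ ‖z‖ ∧ ‖z‖ < A} := by
    rw [Set.disjoint_left]
    intro z h1 h2
    exact absurd h1 (not_lt.mpr h2.1)
  rw [hset] at hi ⊢
  rw [setIntegral_union hdisj hSm (hi.mono_set subset_union_left)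
    (hi.mono_set subset_union_right)]
  refine (abs_add_le _ _).trans (add_le_add ?_ ?_)
  · simpa using h.abs_integral_kerDiff_le hD one_pos ξ
  have hgm := h.measurable_diff hD ξ
  have hb := lintegral_weight_le_log (n := n) hgm.enorm (m := n + 1) (by omega) hA
    (Λ := 2 ^ (n + 1) * unitBallVol n * M * κ / ‖p‖) (by positivity)
    (fun r hr _ => lintegral_ball_profile_le h hD hp ξ hr)
  have e : ∀ z, ‖ψ (ξ + D z) - ψ (ξ + inner ℝ p z)‖ₑ * ENNReal.ofReal ((‖z‖ ^ (n + 1))⁻¹) =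
      ‖kerDiff ψ D p ξ z‖ₑ := fun z => by
    rw [kerDiff, div_eq_mul_inv, enorm_mul]
    congr 1
    rw [← ofReal_norm, Real.norm_of_nonneg (by positivity)]
  simp_rw [e] at hb
  have h1 := (enorm_integral_le_lintegral_enorm (μ := volume.restrict
    {z : EuclideanSpace ℝ (Fin n) | 1 ≤ ‖z‖ ∧ ‖z‖ < A}) (kerDiff ψ D p ξ)).trans hb
  rw [← ofReal_norm, ENNReal.ofReal_le_ofReal_iff (by positivity)] at h1
  push_cast at h1
  exact h1

/-- Decay of the kernel difference in `ξ`, for a profile whose derivative decays: where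
`2 K ‖z‖ ≤ |ξ|` both arguments are at least `|ξ| / 2`, and elsewhere `‖z‖⁻¹ ≤ 4 K / (1 + |ξ|)`. -/
theorem IsProfile.abs_integral_kerDiff_le_decay (h : IsProfile ψ M) (hD : IsIncrement D p κ)
    (hn : n ≠ 0) (hp : p ≠ 0) (hA : 0 < A) {N K : ℝ} (hN : 0 ≤ N)
    (hdec : ∀ x, |deriv ψ x| ≤ N / (1 + |x|)) (hK : 1 ≤ K) (hpK : ‖p‖ ≤ K)
    (hDK : ∀ z, |D z| ≤ K * ‖z‖) (ξ : ℝ) :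
    |∫ z in {z | ‖z‖ < A}, kerDiff ψ D p ξ z| ≤
      (2 * (M + N) * κ * ((n + 2) * unitBallVol n * A) +
        4 * K * ((n + 1) * (2 ^ (n + 1) * unitBallVol n * M * κ / ‖p‖) * A)) / (1 + |ξ|) := by
  have hv := unitBallVol_nonneg (n := n)
  have hM := h.nonneg
  have hκ := hD.nonneg
  have hξ1 : 0 < 1 + |ξ| := by positivity
  have hK0 : 0 < K := one_pos.trans_le hK
  rcases le_total |ξ| 1 with hξ | hξ
  · refine (h.abs_integral_kerDiff_le hD hA ξ).trans ?_
    rw [le_div_iff₀ hξ1]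
    have e1 : M * κ * ((n + 2) * unitBallVol n * A) * (1 + |ξ|) ≤
        M * κ * ((n + 2) * unitBallVol n * A) * 2 :=
      mul_le_mul_of_nonneg_left (by linarith) (by positivity)
    have e2 : 0 ≤ N * κ * ((n + 2) * unitBallVol n * A) := by positivity
    have e3 : 0 ≤ 4 * K * ((n + 1) * (2 ^ (n + 1) * unitBallVol n * M * κ / ‖p‖) * A) := by
      positivity
    nlinarith
  · obtain ⟨hi2, hb2⟩ := h.integrableOn_diff_div hD hn hp hA ξ
    obtain ⟨hi1, hb1⟩ := integrableOn_sq_div (n := n) hA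
    have hpt : ∀ z : EuclideanSpace ℝ (Fin n), ‖kerDiff ψ D p ξ z‖ ≤
        2 * N * κ / (1 + |ξ|) * (‖z‖ ^ 2 / ‖z‖ ^ (n + 1)) +
        4 * K / (1 + |ξ|) * (|ψ (ξ + D z) - ψ (ξ + inner ℝ p z)| / ‖z‖ ^ n) := by
      intro z
      rcases le_total (2 * K * ‖z‖) |ξ| with hz | hz
      · have hD1 := hDK z
        have hp1 : |inner ℝ p z| ≤ K * ‖z‖ := (abs_real_inner_le_norm p z).trans (by gcongr)
        have hseg : ∀ s ∈ uIcc (ξ + inner ℝ p z) (ξ + D z),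
            ‖deriv ψ s‖ ≤ 2 * N / (1 + |ξ|) := by
          intro s hs
          have h1 : |s - ξ| ≤ |ξ| / 2 := by
            rw [_root_.abs_le] at hD1 hp1 ⊢
            rcases le_total (ξ + inner ℝ p z) (ξ + D z) with h2 | h2
            · rw [uIcc_of_le h2] at hs
              constructor <;> linarith [hs.1, hs.2]
            · rw [uIcc_of_ge h2] at hs
              constructor <;> linarith [hs.1, hs.2]
          have h2 : |ξ| / 2 ≤ |s| := by
            have := abs_sub_abs_le_abs_sub ξ s
            rw [abs_sub_comm] at this
            linarith
          refine (hdec s).trans ?_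
          rw [div_le_div_iff₀ (by positivity) hξ1]
          nlinarith
        have h3 := Convex.norm_image_sub_le_of_norm_deriv_le
          (fun x _ => h.differentiable x) hseg (convex_uIcc _ _) left_mem_uIcc right_mem_uIcc
        have h4 : |ψ (ξ + D z) - ψ (ξ + inner ℝ p z)| ≤ 2 * N * κ / (1 + |ξ|) * ‖z‖ ^ 2 := by
          refine h3.trans ?_
          rw [add_sub_add_left_eq_sub]
          calc _ ≤ 2 * N / (1 + |ξ|) * (κ * ‖z‖ ^ 2) :=
                mul_le_mul_of_nonneg_left (hD.abs_sub_le z) (by positivity)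
            _ = _ := by ring
        refine le_add_of_le_of_nonneg ?_ (by positivity)
        rw [kerDiff, norm_div, Real.norm_eq_abs, Real.norm_of_nonneg (pow_nonneg (norm_nonneg z) _),
          ← mul_div_assoc]
        exact div_le_div_of_nonneg_right h4 (by positivity)
      · refine le_add_of_nonneg_of_le (by positivity) ?_
        rcases (norm_nonneg z).eq_or_lt with h0 | h0
        · rw [kerDiff, ← h0]; simp; positivity
        rw [kerDiff, norm_div, Real.norm_eq_abs, Real.norm_of_nonneg (pow_nonneg (norm_nonneg z) _)]
        have h5 : (1 : ℝ) / ‖z‖ ≤ 4 * K / (1 + |ξ|) := by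
          rw [div_le_div_iff₀ h0 hξ1]
          nlinarith
        calc _ = 1 / ‖z‖ * (|ψ (ξ + D z) - ψ (ξ + inner ℝ p z)| / ‖z‖ ^ n) := by
              rw [pow_succ]; field_simp
          _ ≤ _ := mul_le_mul_of_nonneg_right h5 (by positivity)
    have hfin := norm_integral_le_of_norm_le
      ((hi1.const_mul (2 * N * κ / (1 + |ξ|))).add (hi2.const_mul (4 * K / (1 + |ξ|))))
      (Eventually.of_forall hpt)
    refine hfin.trans ?_
    have hadd := integral_add (hi1.const_mul (2 * N * κ / (1 + |ξ|)))
      (hi2.const_mul (4 * K / (1 + |ξ|)))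
    simp only [Pi.add_apply]
    rw [hadd, integral_const_mul, integral_const_mul]
    have e1 := mul_le_mul_of_nonneg_left hb1
      (show 0 ≤ 2 * N * κ / (1 + |ξ|) by positivity)
    have e2 := mul_le_mul_of_nonneg_left hb2 (show 0 ≤ 4 * K / (1 + |ξ|) by positivity)
    refine (add_le_add e1 e2).trans ?_
    rw [le_div_iff₀ hξ1]
    have e3 : 0 ≤ M * κ * ((n + 2) * unitBallVol n * A) := by positivity
    have e4 : (2 * N * κ / (1 + |ξ|) * ((n + 2) * unitBallVol n * A) +
        4 * K / (1 + |ξ|) * ((n + 1) * (2 ^ (n + 1) * unitBallVol n * M * κ / ‖p‖) * A)) *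
        (1 + |ξ|) = 2 * N * κ * ((n + 2) * unitBallVol n * A) +
        4 * K * ((n + 1) * (2 ^ (n + 1) * unitBallVol n * M * κ / ‖p‖) * A) := by
      field_simp
    rw [e4]
    nlinarith
end

end

/-! ### Differentiation of the integrated kernel difference -/

section

variable {n : ℕ}

/-- Differentiation under the integral sign, within a set: dominated convergence, with a
domination of the difference quotients at the base point only. -/
theorem hasFDerivWithinAt_integral {α : Type*} [MeasurableSpace α] {μ : Measure α} {V : Type*}
    [NormedAddCommGroup V] [NormedSpace ℝ V] {F : V → α → ℝ} {F' : α → V →L[ℝ] ℝ} {S : Set V}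
    {w₀ : V} {b : α → ℝ} (hF : ∀ᶠ w in 𝓝[S] w₀, AEStronglyMeasurable (F w) μ)
    (hF₀ : Integrable (F w₀) μ) (hF' : AEStronglyMeasurable F' μ) (hb : Integrable b μ)
    (hF'b : ∀ᵐ a ∂μ, ‖F' a‖ ≤ b a)
    (hlip : ∀ᶠ w in 𝓝[S] w₀, ∀ᵐ a ∂μ, |F w a - F w₀ a| ≤ b a * ‖w - w₀‖)
    (hdiff : ∀ᵐ a ∂μ, HasFDerivWithinAt (F · a) (F' a) S w₀) :
    HasFDerivWithinAt (fun w => ∫ a, F w a ∂μ) (∫ a, F' a ∂μ) S w₀ := by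
  have hF'i : Integrable F' μ := hb.mono' hF' hF'b
  have hFi : ∀ᶠ w in 𝓝[S] w₀, Integrable (F w) μ := by
    filter_upwards [hF, hlip] with w h1 h2
    exact integrable_of_norm_sub_le h1 hF₀ (hb.mul_const ‖w - w₀‖) (h2.mono fun a ha => by
      rwa [norm_sub_rev])
  rw [hasFDerivWithinAt_iff_tendsto]
  have hlim : Tendsto (fun w => ∫ a, ‖w - w₀‖⁻¹ * ‖F w a - F w₀ a - F' a (w - w₀)‖ ∂μ) (𝓝[S] w₀)
      (𝓝 (∫ _, (0 : ℝ) ∂μ)) := by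
    · refine tendsto_integral_filter_of_dominated_convergence (fun a => 2 * b a) ?_ ?_
        (hb.const_mul 2) ?_
      · filter_upwards [hF] with w h1
        exact (((h1.sub hF₀.1).sub (hF'.apply_continuousLinearMap _)).norm).const_mul _
      · filter_upwards [hlip] with w h1
        filter_upwards [h1, hF'b] with a h2 h3
        rw [norm_mul, norm_inv, norm_norm, norm_norm]
        rcases (norm_nonneg (w - w₀)).eq_or_lt with h0 | h0
        · rw [← h0]
          have := (norm_nonneg _).trans h3
          simp [this]
        rw [inv_mul_le_iff₀ h0]
        have h4 := (F' a).le_opNorm (w - w₀)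
        have h5 : ‖F' a‖ * ‖w - w₀‖ ≤ b a * ‖w - w₀‖ := by gcongr
        have h6 := norm_sub_le (F w a - F w₀ a) (F' a (w - w₀))
        rw [Real.norm_eq_abs (F w a - F w₀ a)] at h6
        linarith
      · filter_upwards [hdiff] with a ha
        exact hasFDerivWithinAt_iff_tendsto.mp ha
  rw [integral_zero] at hlim
  refine squeeze_zero' (Eventually.of_forall fun w => by positivity) ?_ hlim
  filter_upwards [hFi] with w hw
  rw [integral_const_mul]
  refine mul_le_mul_of_nonneg_left ?_ (by positivity)
  rw [ContinuousLinearMap.integral_apply hF'i, ← integral_sub hw hF₀,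
    ← integral_sub (f := fun a => F w a - F w₀ a) (hw.sub hF₀)
      (hF'i.apply_continuousLinearMap _)]
  exact norm_integral_le_integral_norm _

/-- A family of increments `D w` with gradients `p w`, differentiable at `w₀` within `S`, the
derivative of the quadratic remainder `D w z - p w · z` being itself quadratic in `z`. -/
structure IsIncrementFamily {V : Type*} [NormedAddCommGroup V] [NormedSpace ℝ V] (S : Set V)
    (w₀ : V) (D : V → EuclideanSpace ℝ (Fin n) → ℝ) (p : V → EuclideanSpace ℝ (Fin n))
    (D' : EuclideanSpace ℝ (Fin n) → V →L[ℝ] ℝ) (p' : V →L[ℝ] EuclideanSpace ℝ (Fin n))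
    (κ L : ℝ) : Prop where
  isIncrement_self : IsIncrement (D w₀) (p w₀) κ
  isIncrement : ∀ᶠ w in 𝓝[S] w₀, IsIncrement (D w) (p w) κ
  lipschitz : ∀ᶠ w in 𝓝[S] w₀, ∀ z, |(D w z - inner ℝ (p w) z) - (D w₀ z - inner ℝ (p w₀) z)| ≤
    κ * ‖z‖ ^ 2 * ‖w - w₀‖
  lipschitz_grad : ∀ᶠ w in 𝓝[S] w₀, ‖p w - p w₀‖ ≤ L * ‖w - w₀‖
  hasFDeriv : ∀ z, HasFDerivWithinAt (fun w => D w z) (D' z) S w₀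
  hasFDeriv_grad : HasFDerivWithinAt p p' S w₀
  measurable_deriv : StronglyMeasurable D'
  norm_deriv_le : ∀ z, ‖D' z - (innerSL ℝ z).comp p'‖ ≤ κ * ‖z‖ ^ 2
  norm_deriv_grad_le : ‖p'‖ ≤ L

/-- The derivative of the kernel difference along a family of increments. -/
def kerDeriv {V : Type*} [NormedAddCommGroup V] [NormedSpace ℝ V] (ψ : ℝ → ℝ)
    (D : EuclideanSpace ℝ (Fin n) → ℝ) (p : EuclideanSpace ℝ (Fin n))
    (D' : EuclideanSpace ℝ (Fin n) → V →L[ℝ] ℝ) (p' : V →L[ℝ] EuclideanSpace ℝ (Fin n))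
    (ξ : ℝ) (z : EuclideanSpace ℝ (Fin n)) : V →L[ℝ] ℝ :=
  (‖z‖ ^ (n + 1))⁻¹ • (deriv ψ (ξ + D z) • D' z -
    deriv ψ (ξ + inner ℝ p z) • (innerSL ℝ z).comp p')

/-- The second difference of a `C^{1,1}` profile. -/
theorem IsProfile.abs_second_diff_le {ψ : ℝ → ℝ} {M : ℝ} (h : IsProfile ψ M)
    (h' : IsProfile (deriv ψ) M) (b b₀ θ θ₀ : ℝ) :
    |(ψ (b + θ) - ψ b) - (ψ (b₀ + θ₀) - ψ b₀)| ≤ M * |θ - θ₀| + M * |θ₀| * |b - b₀| := by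
  have e : (ψ (b + θ) - ψ b) - (ψ (b₀ + θ₀) - ψ b₀) =
      (ψ (b + θ) - ψ (b + θ₀)) + ((ψ (b + θ₀) - ψ b) - (ψ (b₀ + θ₀) - ψ b₀)) := by ring
  rw [e]
  refine (abs_add_le _ _).trans (add_le_add ?_ ?_)
  · refine (h.abs_sub_le _ _).trans (le_of_eq ?_)
    rw [add_sub_add_left_eq_sub]
  · have hd : ∀ s, HasDerivAt (fun s => ψ (s + θ₀) - ψ s) (deriv ψ (s + θ₀) - deriv ψ s) s :=
      fun s => ((h.differentiable _).hasDerivAt.comp_add_const s θ₀).sub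
        (h.differentiable s).hasDerivAt
    refine Convex.norm_image_sub_le_of_norm_hasDerivWithin_le (s := univ)
      (f := fun s => ψ (s + θ₀) - ψ s) (fun s _ => (hd s).hasDerivWithinAt) (fun s _ => ?_)
      convex_univ (mem_univ b₀) (mem_univ b)
    have := h'.abs_sub_le (s + θ₀) s
    rwa [add_sub_cancel_left] at this

section
variable {V : Type*} [NormedAddCommGroup V] [NormedSpace ℝ V] {S : Set V} {w₀ : V}
  {D : V → EuclideanSpace ℝ (Fin n) → ℝ} {p : V → EuclideanSpace ℝ (Fin n)}
  {D' : EuclideanSpace ℝ (Fin n) → V →L[ℝ] ℝ} {p' : V →L[ℝ] EuclideanSpace ℝ (Fin n)}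
  {κ L A M : ℝ} {ψ : ℝ → ℝ}

theorem IsIncrementFamily.abs_kerDiff_sub_le (hF : IsIncrementFamily S w₀ D p D' p' κ L)
    (h : IsProfile ψ M) (h' : IsProfile (deriv ψ) M) :
    ∀ᶠ w in 𝓝[S] w₀, ∀ ξ z, ‖z‖ < A → |kerDiff ψ (D w) (p w) ξ z - kerDiff ψ (D w₀) (p w₀) ξ z| ≤
      M * (κ + κ * L * A) * ‖w - w₀‖ * (‖z‖ ^ 2 / ‖z‖ ^ (n + 1)) := by
  have hM := h.nonneg
  have hκ := hF.isIncrement_self.nonneg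
  filter_upwards [hF.lipschitz, hF.lipschitz_grad] with w h1 h2 ξ z hz
  have hL : 0 ≤ L := (norm_nonneg _).trans hF.norm_deriv_grad_le
  have e := h.abs_second_diff_le h' (ξ + inner ℝ (p w) z) (ξ + inner ℝ (p w₀) z)
    (D w z - inner ℝ (p w) z) (D w₀ z - inner ℝ (p w₀) z)
  have e1 : ∀ w, ξ + inner ℝ (p w) z + (D w z - inner ℝ (p w) z) = ξ + D w z := fun w => by ring
  rw [e1, e1] at e
  rw [kerDiff, kerDiff, ← sub_div, abs_div, abs_of_nonneg (pow_nonneg (norm_nonneg z) _),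
    ← mul_div_assoc]
  refine div_le_div_of_nonneg_right (e.trans ?_) (by positivity)
  have e2 : |(ξ + inner ℝ (p w) z) - (ξ + inner ℝ (p w₀) z)| ≤ L * ‖w - w₀‖ * A := by
    rw [add_sub_add_left_eq_sub, ← inner_sub_left]
    refine (abs_real_inner_le_norm _ _).trans ?_
    gcongr
  calc _ ≤ M * (κ * ‖z‖ ^ 2 * ‖w - w₀‖) + M * (κ * ‖z‖ ^ 2) * (L * ‖w - w₀‖ * A) := by
        gcongr
        · exact h1 z
        · exact hF.isIncrement_self.abs_sub_le z
    _ = _ := by ring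

theorem IsIncrementFamily.norm_kerDeriv_le (hF : IsIncrementFamily S w₀ D p D' p' κ L)
    (h : IsProfile ψ M) (ξ : ℝ) (z : EuclideanSpace ℝ (Fin n)) :
    ‖kerDeriv ψ (D w₀) (p w₀) D' p' ξ z‖ ≤ M * κ * (‖z‖ ^ 2 / ‖z‖ ^ (n + 1)) +
      L * (|deriv ψ (ξ + D w₀ z) - deriv ψ (ξ + inner ℝ (p w₀) z)| / ‖z‖ ^ n) := by
  have hM := h.nonneg
  have hκ := hF.isIncrement_self.nonneg
  have hL : 0 ≤ L := (norm_nonneg _).trans hF.norm_deriv_grad_le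
  have e : deriv ψ (ξ + D w₀ z) • D' z - deriv ψ (ξ + inner ℝ (p w₀) z) • (innerSL ℝ z).comp p' =
      deriv ψ (ξ + D w₀ z) • (D' z - (innerSL ℝ z).comp p') +
      (deriv ψ (ξ + D w₀ z) - deriv ψ (ξ + inner ℝ (p w₀) z)) • (innerSL ℝ z).comp p' := by
    rw [smul_sub, sub_smul]; abel
  have e2 : ‖(innerSL ℝ z).comp p'‖ ≤ ‖z‖ * L := by
    refine (ContinuousLinearMap.opNorm_comp_le _ _).trans ?_
    rw [innerSL_apply_norm]
    gcongr
    exact hF.norm_deriv_grad_le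
  have e3 : ‖deriv ψ (ξ + D w₀ z) • D' z -
      deriv ψ (ξ + inner ℝ (p w₀) z) • (innerSL ℝ z).comp p'‖ ≤ M * (κ * ‖z‖ ^ 2) +
      |deriv ψ (ξ + D w₀ z) - deriv ψ (ξ + inner ℝ (p w₀) z)| * (‖z‖ * L) := by
    rw [e]
    refine (norm_add_le _ _).trans ?_
    rw [norm_smul, norm_smul, Real.norm_eq_abs, Real.norm_eq_abs]
    gcongr
    · exact h.abs_deriv_le _
    · exact hF.norm_deriv_le z
  rw [kerDeriv, norm_smul, norm_inv, norm_pow, norm_norm]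
  refine (mul_le_mul_of_nonneg_left e3 (by positivity)).trans (le_of_eq ?_)
  rcases (norm_nonneg z).eq_or_lt with h0 | h0
  · rw [← h0]
    rcases Nat.eq_zero_or_pos n with rfl | hn
    · have : z = 0 := norm_eq_zero.mp h0.symm
      subst this
      have h1 := hF.isIncrement_self.abs_sub_le 0
      simp at h1
      simp [h1]
    · simp [hn.ne']
  · rw [pow_succ]
    field_simp

theorem IsIncrementFamily.stronglyMeasurable_kerDeriv
    (hF : IsIncrementFamily S w₀ D p D' p' κ L) (ψ : ℝ → ℝ) :
    StronglyMeasurable fun q : ℝ × EuclideanSpace ℝ (Fin n) =>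
      kerDeriv ψ (D w₀) (p w₀) D' p' q.1 q.2 := by
  have hm : Measurable (deriv ψ) := _root_.measurable_deriv ψ
  have hD := hF.isIncrement_self.measurable
  have h0 : StronglyMeasurable fun q : ℝ × EuclideanSpace ℝ (Fin n) => (‖q.2‖ ^ (n + 1))⁻¹ :=
    Measurable.stronglyMeasurable (by fun_prop)
  have h1 : StronglyMeasurable fun q : ℝ × EuclideanSpace ℝ (Fin n) =>
      deriv ψ (q.1 + D w₀ q.2) := (hm.comp (by fun_prop)).stronglyMeasurable
  have h2 : StronglyMeasurable fun q : ℝ × EuclideanSpace ℝ (Fin n) =>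
      deriv ψ (q.1 + inner ℝ (p w₀) q.2) := (hm.comp (by fun_prop)).stronglyMeasurable
  have h3 : Continuous fun z : EuclideanSpace ℝ (Fin n) => (innerSL ℝ z).comp p' :=
    (innerSL ℝ (E := EuclideanSpace ℝ (Fin n))).continuous.clm_comp continuous_const
  have h4 : StronglyMeasurable fun q : ℝ × EuclideanSpace ℝ (Fin n) => (innerSL ℝ q.2).comp p' :=
    haveI := secondCountableTopologyEither_of_left (EuclideanSpace ℝ (Fin n)) (V →L[ℝ] ℝ)
    h3.stronglyMeasurable.comp_measurable measurable_snd
  exact h0.smul ((h1.smul (hF.measurable_deriv.comp_measurable measurable_snd)).sub (h2.smul h4))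

theorem IsIncrementFamily.hasFDerivWithinAt_kerDiff
    (hF : IsIncrementFamily S w₀ D p D' p' κ L) (h : IsProfile ψ M) (ξ : ℝ)
    (z : EuclideanSpace ℝ (Fin n)) :
    HasFDerivWithinAt (fun w => kerDiff ψ (D w) (p w) ξ z)
      (kerDeriv ψ (D w₀) (p w₀) D' p' ξ z) S w₀ := by
  have h1 := (h.differentiable (ξ + D w₀ z)).hasDerivAt.comp_hasFDerivWithinAt w₀
    ((hF.hasFDeriv z).const_add ξ)
  have h2 : HasFDerivWithinAt (fun w => inner ℝ (p w) z) ((innerSL ℝ z).comp p') S w₀ := by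
    have := (innerSL ℝ z).hasFDerivAt.comp_hasFDerivWithinAt w₀ hF.hasFDeriv_grad
    refine this.congr_of_eventuallyEq (Eventually.of_forall fun w => ?_) ?_ <;>
    simp [real_inner_comm]
  have h3 := (h.differentiable (ξ + inner ℝ (p w₀) z)).hasDerivAt.comp_hasFDerivWithinAt w₀
    (h2.const_add ξ)
  have h4 := (h1.sub h3).const_mul ((‖z‖ ^ (n + 1))⁻¹)
  unfold kerDiff kerDeriv
  refine h4.congr_of_eventuallyEq (Eventually.of_forall fun w => ?_) ?_ <;>
  simp [div_eq_inv_mul]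

/-- Differentiability of the integrated kernel difference along a family of increments. -/
theorem IsIncrementFamily.hasFDerivWithinAt_integral_kerDiff
    (hF : IsIncrementFamily S w₀ D p D' p' κ L) (h : IsProfile ψ M)
    (h' : IsProfile (deriv ψ) M) (hn : n ≠ 0) (hp : p w₀ ≠ 0) (hA : 0 < A) (ξ : ℝ) :
    HasFDerivWithinAt (fun w => ∫ z in {z | ‖z‖ < A}, kerDiff ψ (D w) (p w) ξ z)
      (∫ z in {z | ‖z‖ < A}, kerDeriv ψ (D w₀) (p w₀) D' p' ξ z) S w₀ ∧
    ‖∫ z in {z | ‖z‖ < A}, kerDeriv ψ (D w₀) (p w₀) D' p' ξ z‖ ≤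
      M * κ * ((n + 2) * unitBallVol n * A) +
      L * ((n + 1) * (2 ^ (n + 1) * unitBallVol n * M * κ / ‖p w₀‖) * A) := by
  have hM := h.nonneg
  have hκ := hF.isIncrement_self.nonneg
  have hL : 0 ≤ L := (norm_nonneg _).trans hF.norm_deriv_grad_le
  obtain ⟨hi1, hb1⟩ := integrableOn_sq_div (n := n) hA
  obtain ⟨hi2, hb2⟩ := h'.integrableOn_diff_div hF.isIncrement_self hn hp hA ξ
  have hsum := (hi1.const_mul (M * κ)).add (hi2.const_mul L)
  have hall := hsum.add (hi1.const_mul (M * (κ + κ * L * A)))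
  refine ⟨?_, ?_⟩
  · refine hasFDerivWithinAt_integral ?_ (h.integrableOn_kerDiff hF.isIncrement_self hA ξ) ?_ hall
      ?_ ?_ ?_
    · filter_upwards [hF.isIncrement] with w hw
      exact (h.measurable_kerDiff hw ξ).aestronglyMeasurable
    · exact ((hF.stronglyMeasurable_kerDeriv ψ).comp_measurable
        (measurable_const.prodMk measurable_id)).aestronglyMeasurable
    · refine Eventually.of_forall fun z => ?_
      refine (hF.norm_kerDeriv_le h ξ z).trans ?_
      simp only [Pi.add_apply]
      exact le_add_of_nonneg_right (by positivity)
    · filter_upwards [hF.abs_kerDiff_sub_le (A := A) h h'] with w hw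
      refine (ae_restrict_iff' (measurableSet_norm_lt A)).mpr (Eventually.of_forall fun z hz => ?_)
      refine (hw ξ z hz).trans ?_
      simp only [Pi.add_apply]
      rw [mul_right_comm]
      refine mul_le_mul_of_nonneg_right ?_ (norm_nonneg _)
      exact le_add_of_nonneg_left (by positivity)
    · exact Eventually.of_forall fun z => hF.hasFDerivWithinAt_kerDiff h ξ z
  · refine (norm_integral_le_of_norm_le hsum
      (Eventually.of_forall fun z => hF.norm_kerDeriv_le h ξ z)).trans ?_
    have hadd := integral_add (hi1.const_mul (M * κ)) (hi2.const_mul L)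
    simp only [Pi.add_apply]
    rw [hadd, integral_const_mul, integral_const_mul]
    gcongr

theorem IsProfile.hasDerivAt_integral_kerDiff {D : EuclideanSpace ℝ (Fin n) → ℝ}
    {p : EuclideanSpace ℝ (Fin n)} (h : IsProfile ψ M) (h' : IsProfile (deriv ψ) M)
    (hD : IsIncrement D p κ) (hA : 0 < A) (ξ : ℝ) :
    HasDerivAt (fun ξ => ∫ z in {z | ‖z‖ < A}, kerDiff ψ D p ξ z)
      (∫ z in {z | ‖z‖ < A}, kerDiff (deriv ψ) D p ξ z) ξ := by
  refine (hasDerivAt_integral_of_dominated_loc_of_deriv_le (s := univ) univ_mem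
    (Eventually.of_forall fun ζ => (h.measurable_kerDiff hD ζ).aestronglyMeasurable)
    (h.integrableOn_kerDiff hD hA ξ) (h'.measurable_kerDiff hD ξ).aestronglyMeasurable
    (Eventually.of_forall fun z ζ _ => h'.abs_kerDiff_le hD ζ z)
    ((integrableOn_sq_div hA).1.const_mul (M * κ)) (Eventually.of_forall fun z ζ _ => ?_)).2
  unfold kerDiff
  exact (((h.differentiable _).hasDerivAt.comp_add_const ζ (D z)).sub
    ((h.differentiable _).hasDerivAt.comp_add_const ζ (inner ℝ p z))).div_const _

theorem IsProfile.continuous_integral_kerDiff {D : EuclideanSpace ℝ (Fin n) → ℝ}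
    {p : EuclideanSpace ℝ (Fin n)} (h : IsProfile ψ M) (hD : IsIncrement D p κ) (hA : 0 < A) :
    Continuous fun ξ => ∫ z in {z | ‖z‖ < A}, kerDiff ψ D p ξ z := by
  refine continuous_of_dominated
    (fun ζ => (h.measurable_kerDiff hD ζ).aestronglyMeasurable)
    (fun ζ => Eventually.of_forall fun z => h.abs_kerDiff_le hD ζ z)
    ((integrableOn_sq_div hA).1.const_mul (M * κ)) (Eventually.of_forall fun z => ?_)
  have := h.differentiable.continuous
  unfold kerDiff
  fun_prop

/-- Averaging the integrated kernel difference against an integrable weight keeps the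
differentiability and the bound. -/
theorem IsIncrementFamily.hasFDerivWithinAt_average
    (hF : IsIncrementFamily S w₀ D p D' p' κ L) (h : IsProfile ψ M)
    (h' : IsProfile (deriv ψ) M) (hn : n ≠ 0) (hp : p w₀ ≠ 0) (hA : 0 < A) {g : ℝ → ℝ}
    (hg : Integrable g) (hg0 : ∀ ξ, 0 ≤ g ξ) :
    ∃ B : V →L[ℝ] ℝ, HasFDerivWithinAt
      (fun w => ∫ ξ, (∫ z in {z | ‖z‖ < A}, kerDiff ψ (D w) (p w) ξ z) * g ξ) B S w₀ ∧
    ‖B‖ ≤ (M * κ * ((n + 2) * unitBallVol n * A) +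
      L * ((n + 1) * (2 ^ (n + 1) * unitBallVol n * M * κ / ‖p w₀‖) * A)) * ∫ ξ, g ξ := by
  have hv := unitBallVol_nonneg (n := n)
  have hM := h.nonneg
  have hκ := hF.isIncrement_self.nonneg
  have hL : 0 ≤ L := (norm_nonneg _).trans hF.norm_deriv_grad_le
  set Q : ℝ := M * κ * ((n + 2) * unitBallVol n * A) +
      L * ((n + 1) * (2 ^ (n + 1) * unitBallVol n * M * κ / ‖p w₀‖) * A) with hQ
  set R : ℝ := M * (κ + κ * L * A) * ((n + 2) * unitBallVol n * A) with hR
  have hQ0 : 0 ≤ Q := by positivity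
  have hR0 : 0 ≤ R := by positivity
  have hJ := fun ξ => hF.hasFDerivWithinAt_integral_kerDiff h h' hn hp hA ξ
  have hcont : ∀ w, IsIncrement (D w) (p w) κ →
      Continuous fun ξ => ∫ z in {z | ‖z‖ < A}, kerDiff ψ (D w) (p w) ξ z :=
    fun w hw => h.continuous_integral_kerDiff hw hA
  have hbound : ∀ ξ, ‖g ξ • ∫ z in {z | ‖z‖ < A}, kerDeriv ψ (D w₀) (p w₀) D' p' ξ z‖ ≤
      Q * g ξ := fun ξ => by
    rw [norm_smul, Real.norm_of_nonneg (hg0 ξ), mul_comm]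
    exact mul_le_mul_of_nonneg_right (hJ ξ).2 (hg0 ξ)
  refine ⟨∫ ξ, g ξ • ∫ z in {z | ‖z‖ < A}, kerDeriv ψ (D w₀) (p w₀) D' p' ξ z, ?_, ?_⟩
  · refine hasFDerivWithinAt_integral (b := fun ξ => (Q + R) * g ξ) ?_ ?_ ?_ (hg.const_mul _)
      (Eventually.of_forall fun ξ => (hbound ξ).trans ?_) ?_ (Eventually.of_forall fun ξ => ?_)
    · filter_upwards [hF.isIncrement] with w hw
      exact (hcont w hw).aestronglyMeasurable.mul hg.1
    · exact hg.bdd_mul (hcont w₀ hF.isIncrement_self).aestronglyMeasurable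
        (Eventually.of_forall fun ξ =>
          h.abs_integral_kerDiff_le hF.isIncrement_self hA ξ)
    · refine hg.1.smul ?_
      exact (hF.stronglyMeasurable_kerDeriv ψ).integral_prod_right.aestronglyMeasurable
    · have := mul_nonneg hR0 (hg0 ξ)
      linarith
    · filter_upwards [hF.abs_kerDiff_sub_le (A := A) h h', hF.isIncrement] with w hw hw2
      refine Eventually.of_forall fun ξ => ?_
      rw [← sub_mul, ← integral_sub (h.integrableOn_kerDiff hw2 hA ξ)
        (h.integrableOn_kerDiff hF.isIncrement_self hA ξ), abs_mul, abs_of_nonneg (hg0 ξ)]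
      have e := abs_integral_le_sq (by positivity) hA fun z hz => hw ξ z hz
      calc _ ≤ M * (κ + κ * L * A) * ‖w - w₀‖ * ((n + 2) * unitBallVol n * A) * g ξ :=
            mul_le_mul_of_nonneg_right e (hg0 ξ)
        _ = R * (g ξ * ‖w - w₀‖) := by rw [hR]; ring
        _ ≤ _ := by
            have := mul_nonneg (mul_nonneg hQ0 (hg0 ξ)) (norm_nonneg (w - w₀))
            linarith
    · have := (hJ ξ).1.mul_const (g ξ)
      exact this
  · refine (norm_integral_le_of_norm_le (hg.const_mul Q) (Eventually.of_forall hbound)).trans ?_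
    rw [integral_const_mul]

end

end

/-! ### The signed distance at a fixed time -/

section

variable {n : ℕ} {Ω : ℝ → Set (EuclideanSpace ℝ (Fin n))} {t₀ h ρ : ℝ}

theorem abs_signedDist (Ω : ℝ → Set (EuclideanSpace ℝ (Fin n))) (t : ℝ)
    (x : EuclideanSpace ℝ (Fin n)) :
    |signedDist Ω t x| = Metric.infDist x (frontier (Ω t)) := by
  unfold signedDist
  split_ifs
  · exact abs_of_nonneg Metric.infDist_nonneg
  · rw [abs_neg, abs_of_nonneg Metric.infDist_nonneg]

theorem IsSmoothFront.frontier_nonempty (hΩ : IsSmoothFront Ω t₀ h ρ) (hn : n ≠ 0) {t : ℝ}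
    (ht : t ∈ Icc t₀ (t₀ + h)) : (frontier (Ω t)).Nonempty := by
  rw [nonempty_frontier_iff]
  refine ⟨hΩ.nonempty t ht, fun huniv => ?_⟩
  obtain ⟨R, hR⟩ := hΩ.bounded
  have hsub := hR t ht
  rw [huniv] at hsub
  have : Nonempty (Fin n) := ⟨⟨0, Nat.pos_of_ne_zero hn⟩⟩
  have : Nontrivial (EuclideanSpace ℝ (Fin n)) := inferInstance
  exact NormedSpace.unbounded_univ ℝ (EuclideanSpace ℝ (Fin n))
    (Metric.isBounded_ball.subset hsub)

theorem IsSmoothFront.exists_frontier_subset (hΩ : IsSmoothFront Ω t₀ h ρ) :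
    ∃ R, ∀ t ∈ Icc t₀ (t₀ + h), frontier (Ω t) ⊆ Metric.closedBall 0 R := by
  obtain ⟨R, hR⟩ := hΩ.bounded
  exact ⟨R, fun t ht => frontier_subset_closure.trans
    ((closure_mono (hR t ht)).trans Metric.closure_ball_subset_closedBall)⟩

theorem IsSmoothFront.signedDist_eq_zero_iff (hΩ : IsSmoothFront Ω t₀ h ρ) (hn : n ≠ 0) {t : ℝ}
    (ht : t ∈ Icc t₀ (t₀ + h)) {x : EuclideanSpace ℝ (Fin n)} :
    signedDist Ω t x = 0 ↔ x ∈ frontier (Ω t) := by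
  rw [← abs_eq_zero, abs_signedDist, isClosed_frontier.mem_iff_infDist_zero
    (hΩ.frontier_nonempty hn ht)]

theorem IsSmoothFront.signedDist_pos_of_mem (hΩ : IsSmoothFront Ω t₀ h ρ) (hn : n ≠ 0) {t : ℝ}
    (ht : t ∈ Icc t₀ (t₀ + h)) {x : EuclideanSpace ℝ (Fin n)} (hx : x ∈ Ω t) :
    0 < signedDist Ω t x := by
  have h1 : signedDist Ω t x ≠ 0 := by
    rw [Ne, hΩ.signedDist_eq_zero_iff hn ht, frontier, (hΩ.isOpen t ht).interior_eq]
    exact fun h => h.2 hx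
  refine lt_of_le_of_ne ?_ h1.symm
  unfold signedDist
  rw [if_pos hx]
  exact Metric.infDist_nonneg

theorem signedDist_sub_le {t : ℝ} (x y : EuclideanSpace ℝ (Fin n)) :
    signedDist Ω t x - signedDist Ω t y ≤ dist x y := by
  unfold signedDist
  split_ifs with hx hy hy
  · have := Metric.infDist_le_infDist_add_dist (s := frontier (Ω t)) (x := x) (y := y)
    linarith
  · obtain ⟨z, hz, hzf⟩ : ∃ z ∈ segment ℝ x y, z ∈ frontier (Ω t) := by
      have hc : IsPreconnected (segment ℝ x y) := (convex_segment x y).isPreconnected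
      by_contra! hcon
      have h1 := hc.subset_left_of_subset_union (u := interior (Ω t)) (v := (closure (Ω t))ᶜ)
        isOpen_interior isClosed_closure.isOpen_compl
        (disjoint_compl_right.mono_left (interior_subset.trans subset_closure))
        (fun w hw => by
          by_cases h2 : w ∈ interior (Ω t)
          · exact Or.inl h2
          · exact Or.inr fun h3 => hcon w hw ⟨h3, h2⟩)
        ⟨x, left_mem_segment ℝ x y, by
          by_contra h2
          exact hcon x (left_mem_segment ℝ x y) ⟨subset_closure hx, h2⟩⟩
      exact hy (interior_subset (h1 (right_mem_segment ℝ x y)))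
    have h1 := Metric.infDist_le_dist_of_mem (x := x) hzf
    have h2 := Metric.infDist_le_dist_of_mem (x := y) hzf
    have h3 := dist_add_dist_of_mem_segment hz
    rw [dist_comm z y] at h3
    linarith
  · have h1 := Metric.infDist_nonneg (x := x) (s := frontier (Ω t))
    have h2 := Metric.infDist_nonneg (x := y) (s := frontier (Ω t))
    have h3 := dist_nonneg (x := x) (y := y)
    linarith
  · have := Metric.infDist_le_infDist_add_dist (s := frontier (Ω t)) (x := y) (y := x)
    rw [dist_comm] at this
    linarith

theorem abs_signedDist_sub_le {t : ℝ} (x y : EuclideanSpace ℝ (Fin n)) :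
    |signedDist Ω t x - signedDist Ω t y| ≤ dist x y := by
  rw [abs_sub_le_iff]
  exact ⟨signedDist_sub_le x y, dist_comm x y ▸ signedDist_sub_le y x⟩

theorem continuous_signedDist (Ω : ℝ → Set (EuclideanSpace ℝ (Fin n))) (t : ℝ) :
    Continuous (signedDist Ω t) :=
  (LipschitzWith.of_dist_le_mul (K := 1) fun x y => by
    rw [Real.dist_eq, NNReal.coe_one, one_mul]
    exact abs_signedDist_sub_le x y).continuous

/-- Along the segment to a nearest point of the front the signed distance is affine. -/
theorem IsSmoothFront.exists_nearest (hΩ : IsSmoothFront Ω t₀ h ρ) (hn : n ≠ 0) {t : ℝ}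
    (ht : t ∈ Icc t₀ (t₀ + h)) (x : EuclideanSpace ℝ (Fin n)) :
    ∃ z ∈ frontier (Ω t), dist x z = |signedDist Ω t x| ∧
      ∀ τ ∈ Icc (0 : ℝ) 1, signedDist Ω t (x + τ • (z - x)) = (1 - τ) * signedDist Ω t x := by
  obtain ⟨z, hz, hxz⟩ := isClosed_frontier.exists_infDist_eq_dist
    (hΩ.frontier_nonempty hn ht) x
  rw [← abs_signedDist] at hxz
  refine ⟨z, hz, hxz.symm, fun τ hτ => ?_⟩
  have hz0 := (hΩ.signedDist_eq_zero_iff hn ht).mpr hz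
  set y := x + τ • (z - x) with hy
  have h1 : dist x y = τ * dist x z := by
    rw [hy, dist_self_add_right, norm_smul, Real.norm_of_nonneg hτ.1, dist_comm x z, dist_eq_norm]
  have h2 : dist y z = (1 - τ) * dist x z := by
    rw [hy, dist_eq_norm, dist_eq_norm]
    have : x + τ • (z - x) - z = (1 - τ) • (x - z) := by module
    rw [this, norm_smul, Real.norm_of_nonneg (by linarith [hτ.2])]
  have h3 := abs_signedDist_sub_le (Ω := Ω) (t := t) x y
  have h4 := abs_signedDist_sub_le (Ω := Ω) (t := t) y z
  rw [hz0, sub_zero, h2, ← hxz] at h4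
  rw [h1, ← hxz] at h3
  rcases le_total 0 (signedDist Ω t x) with h0 | h0
  · rw [abs_of_nonneg h0] at h3 h4
    rw [abs_le] at h3 h4
    linarith [h3.1, h3.2, h4.1, h4.2]
  · rw [abs_of_nonpos h0] at h3 h4
    rw [abs_le] at h3 h4
    linarith [h3.1, h3.2, h4.1, h4.2]

end

/-! ### Joint continuity of the signed distance -/

section

variable {n : ℕ} {Ω : ℝ → Set (EuclideanSpace ℝ (Fin n))} {t₀ h ρ : ℝ}
  {η : ℝ → EuclideanSpace ℝ (Fin n) → ℝ}

theorem IsCutoff.tube_mem_nhdsWithin (hη : IsCutoff Ω t₀ h ρ η)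
    {q : ℝ × EuclideanSpace ℝ (Fin n)} (hq : q ∈ Icc t₀ (t₀ + h) ×ˢ univ) (hq0 : η q.1 q.2 ≠ 0) :
    tube Ω t₀ h (2 * ρ) ∈ 𝓝[Icc t₀ (t₀ + h) ×ˢ univ] q := by
  have hc := hη.smooth.continuousOn q hq
  filter_upwards [hc.eventually_ne hq0, self_mem_nhdsWithin] with q' h1 h2
  refine ⟨h2.1, ?_⟩
  by_contra h3
  exact h1 (hη.eq_zero q'.1 h2.1 q'.2 (not_le.mp h3).le)

theorem IsSmoothFront.continuousWithinAt_signedDist (hΩ : IsSmoothFront Ω t₀ h ρ)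
    {q : ℝ × EuclideanSpace ℝ (Fin n)} (hq : q ∈ Icc t₀ (t₀ + h) ×ˢ univ)
    (hT : tube Ω t₀ h (2 * ρ) ∈ 𝓝[Icc t₀ (t₀ + h) ×ˢ univ] q) :
    ContinuousWithinAt (fun p : ℝ × EuclideanSpace ℝ (Fin n) => signedDist Ω p.1 p.2)
      (Icc t₀ (t₀ + h) ×ˢ univ) q :=
  (hΩ.smooth.continuousOn q (mem_of_mem_nhdsWithin hq hT)).mono_of_mem_nhdsWithin hT

/-- The graph of the front is closed. -/
theorem IsCutoff.eventually_notMem_frontier (hη : IsCutoff Ω t₀ h ρ η)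
    (hΩ : IsSmoothFront Ω t₀ h ρ) (hn : n ≠ 0) (hρ : 0 < ρ)
    {q : ℝ × EuclideanSpace ℝ (Fin n)} (hq : q ∈ Icc t₀ (t₀ + h) ×ˢ univ)
    (hqf : q.2 ∉ frontier (Ω q.1)) :
    ∀ᶠ q' in 𝓝[Icc t₀ (t₀ + h) ×ˢ univ] q, q'.2 ∉ frontier (Ω q'.1) := by
  by_cases h0 : η q.1 q.2 = 0
  · have hc := hη.smooth.continuousOn q hq
    have h1 : η q.1 q.2 ≠ 1 := by rw [h0]; exact zero_ne_one
    filter_upwards [hc.eventually_ne h1, self_mem_nhdsWithin] with q' h2 h3 h4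
    refine h2 (hη.eq_one q'.1 h3.1 q'.2 ?_)
    rw [(hΩ.signedDist_eq_zero_iff hn h3.1).mpr h4, abs_zero]
    exact hρ.le
  · have hc := hΩ.continuousWithinAt_signedDist hq (hη.tube_mem_nhdsWithin hq h0)
    have h1 : signedDist Ω q.1 q.2 ≠ 0 := fun h2 =>
      hqf ((hΩ.signedDist_eq_zero_iff hn hq.1).mp h2)
    filter_upwards [hc.eventually_ne h1, self_mem_nhdsWithin] with q' h2 h3 h4
    exact h2 ((hΩ.signedDist_eq_zero_iff hn h3.1).mpr h4)

theorem tendsto_slice {I : Set ℝ} {t : ℝ} (x : EuclideanSpace ℝ (Fin n)) :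
    Tendsto (fun s : ℝ => (s, x)) (𝓝[I] t) (𝓝[I ×ˢ univ] (t, x)) :=
  tendsto_nhdsWithin_iff.mpr
    ⟨(Continuous.tendsto (f := fun s : ℝ => (s, x)) (by fun_prop) t).mono_left nhdsWithin_le_nhds,
      eventually_mem_nhdsWithin.mono fun _ hs => ⟨hs, mem_univ _⟩⟩

theorem IsCutoff.continuousOn_abs_signedDist (hη : IsCutoff Ω t₀ h ρ η)
    (hΩ : IsSmoothFront Ω t₀ h ρ) (hn : n ≠ 0) (hρ : 0 < ρ) :
    ContinuousOn (fun p : ℝ × EuclideanSpace ℝ (Fin n) => |signedDist Ω p.1 p.2|)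
      (Icc t₀ (t₀ + h) ×ˢ univ) := by
  intro q hq
  refine tendsto_order.mpr ⟨fun c hc => ?_, fun c hc => ?_⟩
  · obtain ⟨R, hR⟩ := hΩ.exists_frontier_subset
    have hK : IsCompact (Metric.closedBall (0 : EuclideanSpace ℝ (Fin n)) R) :=
      isCompact_closedBall 0 R
    have hev : ∀ᶠ q' in 𝓝 q, ∀ z ∈ Metric.closedBall (0 : EuclideanSpace ℝ (Fin n)) R,
        q' ∈ Icc t₀ (t₀ + h) ×ˢ (univ : Set (EuclideanSpace ℝ (Fin n))) →
        z ∈ frontier (Ω q'.1) → c + (|signedDist Ω q.1 q.2| - c) / 2 < dist q'.2 z := by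
      refine hK.eventually_forall_of_forall_eventually fun z _ => ?_
      by_cases hzf : z ∈ frontier (Ω q.1)
      · have h1 : c + (|signedDist Ω q.1 q.2| - c) / 2 < dist q.2 z := by
          have := Metric.infDist_le_dist_of_mem (x := q.2) hzf
          rw [← abs_signedDist] at this
          linarith
        have h2 : Tendsto (fun r : (ℝ × EuclideanSpace ℝ (Fin n)) × EuclideanSpace ℝ (Fin n) =>
            dist r.1.2 r.2) (𝓝 (q, z)) (𝓝 (dist q.2 z)) :=
          Continuous.tendsto (by fun_prop) (q, z)
        filter_upwards [h2.eventually (lt_mem_nhds h1)] with r hr _ _ using hr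
      · have h1 := hη.eventually_notMem_frontier hΩ hn hρ (q := (q.1, z)) ⟨hq.1, mem_univ _⟩ hzf
        rw [eventually_nhdsWithin_iff] at h1
        have h2 : Tendsto (fun r : (ℝ × EuclideanSpace ℝ (Fin n)) × EuclideanSpace ℝ (Fin n) =>
            (r.1.1, r.2)) (𝓝 (q, z)) (𝓝 (q.1, z)) :=
          Continuous.tendsto (f := fun r : (ℝ × EuclideanSpace ℝ (Fin n)) ×
            EuclideanSpace ℝ (Fin n) => (r.1.1, r.2)) (by fun_prop) (q, z)
        filter_upwards [h2.eventually h1] with r hr h3 h4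
        exact absurd h4 (hr ⟨h3.1, mem_univ _⟩)
    filter_upwards [hev.filter_mono nhdsWithin_le_nhds, self_mem_nhdsWithin] with q' h1 h2
    obtain ⟨z, hz, hz2, -⟩ := hΩ.exists_nearest hn h2.1 q'.2
    rw [← hz2]
    have := h1 z (hR q'.1 h2.1 hz) h2 hz
    linarith
  · obtain ⟨z, hz, hz2, -⟩ := hΩ.exists_nearest hn hq.1 q.2
    have hz0 := (hΩ.signedDist_eq_zero_iff hn hq.1).mpr hz
    have hη1 : η q.1 z ≠ 0 := by
      rw [hη.eq_one q.1 hq.1 z (by rw [hz0, abs_zero]; exact hρ.le)]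
      exact one_ne_zero
    have hqz : (q.1, z) ∈ Icc t₀ (t₀ + h) ×ˢ (univ : Set (EuclideanSpace ℝ (Fin n))) :=
      ⟨hq.1, mem_univ _⟩
    have hcz := hΩ.continuousWithinAt_signedDist hqz (hη.tube_mem_nhdsWithin hqz hη1)
    have h1 : Tendsto (fun q' : ℝ × EuclideanSpace ℝ (Fin n) => (q'.1, z))
        (𝓝[Icc t₀ (t₀ + h) ×ˢ univ] q) (𝓝[Icc t₀ (t₀ + h) ×ˢ univ] (q.1, z)) :=
      tendsto_nhdsWithin_iff.mpr
        ⟨(Continuous.tendsto (f := fun q' : ℝ × EuclideanSpace ℝ (Fin n) => (q'.1, z))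
          (by fun_prop) q).mono_left nhdsWithin_le_nhds,
          eventually_mem_nhdsWithin.mono fun _ hs => ⟨hs.1, mem_univ _⟩⟩
    have h2 : Tendsto (fun q' : ℝ × EuclideanSpace ℝ (Fin n) => |signedDist Ω q'.1 z| +
        dist q'.2 z) (𝓝[Icc t₀ (t₀ + h) ×ˢ univ] q) (𝓝 (|signedDist Ω q.1 z| + dist q.2 z)) := by
      refine Tendsto.add (Tendsto.abs (Tendsto.comp hcz h1)) ?_
      exact (Continuous.tendsto (by fun_prop) q).mono_left nhdsWithin_le_nhds
    rw [hz0, abs_zero, zero_add, hz2] at h2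
    filter_upwards [h2.eventually (gt_mem_nhds hc)] with q' h3
    have h4 := abs_signedDist_sub_le (Ω := Ω) (t := q'.1) q'.2 z
    have h5 := abs_sub_abs_le_abs_sub (signedDist Ω q'.1 q'.2) (signedDist Ω q'.1 z)
    linarith

theorem IsCutoff.tube_mem_nhdsWithin_of_lt (hη : IsCutoff Ω t₀ h ρ η)
    (hΩ : IsSmoothFront Ω t₀ h ρ) (hn : n ≠ 0) (hρ : 0 < ρ)
    {q : ℝ × EuclideanSpace ℝ (Fin n)} (hq : q ∈ Icc t₀ (t₀ + h) ×ˢ univ) {r : ℝ}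
    (hqr : |signedDist Ω q.1 q.2| < r) :
    {p : ℝ × EuclideanSpace ℝ (Fin n) | p.1 ∈ Icc t₀ (t₀ + h) ∧ |signedDist Ω p.1 p.2| < r} ∈
      𝓝[Icc t₀ (t₀ + h) ×ˢ univ] q := by
  filter_upwards [(hη.continuousOn_abs_signedDist hΩ hn hρ q hq).eventually (gt_mem_nhds hqr),
    self_mem_nhdsWithin] with q' h1 h2 using ⟨h2.1, h1⟩

/-- The sign of the signed distance does not jump off the front, as `Ω_t` can be followed along
the segment to a nearest point of the front, near which the signed distance is continuous. -/
theorem IsCutoff.continuousOn_signedDist (hη : IsCutoff Ω t₀ h ρ η)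
    (hΩ : IsSmoothFront Ω t₀ h ρ) (hn : n ≠ 0) (hρ : 0 < ρ) :
    ContinuousOn (fun p : ℝ × EuclideanSpace ℝ (Fin n) => signedDist Ω p.1 p.2)
      (Icc t₀ (t₀ + h) ×ˢ univ) := by
  have hcont := hη.continuousOn_abs_signedDist hΩ hn hρ
  have hsmall : ∀ q ∈ Icc t₀ (t₀ + h) ×ˢ (univ : Set (EuclideanSpace ℝ (Fin n))),
      |signedDist Ω q.1 q.2| < 2 * ρ → ContinuousWithinAt
        (fun p : ℝ × EuclideanSpace ℝ (Fin n) => signedDist Ω p.1 p.2)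
        (Icc t₀ (t₀ + h) ×ˢ univ) q := fun q hq hlt =>
    hΩ.continuousWithinAt_signedDist hq
      (mem_of_superset (hη.tube_mem_nhdsWithin_of_lt hΩ hn hρ hq hlt) fun p hp => ⟨hp.1, hp.2.le⟩)
  rintro ⟨t, x⟩ hq
  by_cases hlt : |signedDist Ω t x| < 2 * ρ
  · exact hsmall _ hq hlt
  have hpos : 0 < |signedDist Ω t x| := by linarith [not_lt.mp hlt]
  have hne : signedDist Ω t x ≠ 0 := abs_pos.mp hpos
  obtain ⟨z, -, -, hseg⟩ := hΩ.exists_nearest hn hq.1 x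
  -- a point of the segment inside the tube of radius `2ρ`
  set τ : ℝ := 1 - ρ / |signedDist Ω t x| with hτ
  have hρle : ρ / |signedDist Ω t x| ≤ 1 / 2 := by
    rw [div_le_iff₀ hpos]; linarith [not_lt.mp hlt]
  have hρpos : 0 < ρ / |signedDist Ω t x| := by positivity
  have hτ0 : 0 ≤ τ := by rw [hτ]; linarith
  have hτ1 : τ ≤ 1 := by rw [hτ]; linarith
  have hmemI : ∀ y : EuclideanSpace ℝ (Fin n),
      (t, y) ∈ Icc t₀ (t₀ + h) ×ˢ (univ : Set (EuclideanSpace ℝ (Fin n))) :=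
    fun y => ⟨hq.1, mem_univ _⟩
  have hnz : ∀ᶠ s in 𝓝[Icc t₀ (t₀ + h)] t, ∀ a ∈ Icc 0 τ,
      0 < |signedDist Ω s (x + a • (z - x))| := by
    have h1 : ∀ᶠ s in 𝓝 t, ∀ a ∈ Icc 0 τ, s ∈ Icc t₀ (t₀ + h) →
        0 < |signedDist Ω s (x + a • (z - x))| := by
      refine isCompact_Icc.eventually_forall_of_forall_eventually fun a ha => ?_
      have hp : 0 < |signedDist Ω t (x + a • (z - x))| := by
        rw [hseg a ⟨ha.1, ha.2.trans hτ1⟩, abs_mul]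
        have : 0 < 1 - a := by linarith [ha.2]
        exact mul_pos (abs_pos.mpr this.ne') hpos
      have h2 := (hcont (t, x + a • (z - x)) (hmemI _)).eventually (lt_mem_nhds hp)
      rw [eventually_nhdsWithin_iff] at h2
      have h3 : Tendsto (fun r : ℝ × ℝ => (r.1, x + r.2 • (z - x))) (𝓝 (t, a))
          (𝓝 (t, x + a • (z - x))) :=
        Continuous.tendsto (f := fun r : ℝ × ℝ => (r.1, x + r.2 • (z - x))) (by fun_prop) (t, a)
      filter_upwards [h3.eventually h2] with r hr hr1 using hr ⟨hr1, mem_univ _⟩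
    exact eventually_nhdsWithin_iff.mpr (h1.mono fun s hs hsI a ha => hs a ha hsI)
  have hend : ∀ᶠ s in 𝓝[Icc t₀ (t₀ + h)] t,
      0 < signedDist Ω s (x + τ • (z - x)) * signedDist Ω t x := by
    have e := hseg τ ⟨hτ0, hτ1⟩
    have h1 := hsmall (t, x + τ • (z - x)) (hmemI _) (by
      change |signedDist Ω t (x + τ • (z - x))| < 2 * ρ
      rw [e, abs_mul, hτ, sub_sub_cancel, abs_of_pos hρpos, div_mul_cancel₀ _ hpos.ne']
      linarith)
    have h2 := (Tendsto.comp h1 (tendsto_slice (x + τ • (z - x)))).mul_const (signedDist Ω t x)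
    refine h2.eventually (lt_mem_nhds ?_)
    change 0 < signedDist Ω t (x + τ • (z - x)) * signedDist Ω t x
    rw [e, hτ, sub_sub_cancel, mul_assoc]
    exact mul_pos hρpos (mul_self_pos.mpr hne)
  have hsign : ∀ᶠ s in 𝓝[Icc t₀ (t₀ + h)] t, 0 < signedDist Ω s x * signedDist Ω t x := by
    filter_upwards [hnz, hend] with s h1 h2
    by_contra h3
    have hcf : Continuous fun a : ℝ => signedDist Ω s (x + a • (z - x)) * signedDist Ω t x :=
      ((continuous_signedDist Ω s).comp (by fun_prop)).mul continuous_const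
    have h4 := intermediate_value_Icc hτ0 hcf.continuousOn
    obtain ⟨a, ha, ha0⟩ := h4 (show (0 : ℝ) ∈ _ by
      refine ⟨?_, h2.le⟩
      simpa using not_lt.mp h3)
    have := h1 a ha
    rcases mul_eq_zero.mp ha0 with h5 | h5
    · rw [h5, abs_zero] at this
      exact lt_irrefl _ this
    · exact hne h5
  have htime : Tendsto (fun s => signedDist Ω s x) (𝓝[Icc t₀ (t₀ + h)] t)
      (𝓝 (signedDist Ω t x)) := by
    have h1 := (Tendsto.comp (hcont (t, x) hq) (tendsto_slice x)).const_mul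
      (signedDist Ω t x / |signedDist Ω t x|)
    have e : signedDist Ω t x / |signedDist Ω t x| * |signedDist Ω t x| = signedDist Ω t x :=
      div_mul_cancel₀ _ hpos.ne'
    change Tendsto _ _ (𝓝 (signedDist Ω t x / |signedDist Ω t x| * |signedDist Ω t x|)) at h1
    rw [e] at h1
    refine h1.congr' ?_
    filter_upwards [hsign] with s hs
    change signedDist Ω t x / |signedDist Ω t x| * |signedDist Ω s x| = _
    rcases lt_or_gt_of_ne hne with h2 | h2
    · have h3 : signedDist Ω s x < 0 := by nlinarith
      rw [abs_of_neg h2, abs_of_neg h3]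
      field_simp
    · have h3 : 0 < signedDist Ω s x := by nlinarith
      rw [abs_of_pos h2, abs_of_pos h3]
      field_simp
  have hfst : Tendsto (fun q' : ℝ × EuclideanSpace ℝ (Fin n) => q'.1)
      (𝓝[Icc t₀ (t₀ + h) ×ˢ univ] (t, x)) (𝓝[Icc t₀ (t₀ + h)] t) :=
    tendsto_nhdsWithin_iff.mpr ⟨(continuous_fst.tendsto (t, x)).mono_left nhdsWithin_le_nhds,
      eventually_mem_nhdsWithin.mono fun _ hs => hs.1⟩
  have h1 := htime.comp hfst
  have h2 : Tendsto (fun q' : ℝ × EuclideanSpace ℝ (Fin n) =>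
      signedDist Ω q'.1 q'.2 - signedDist Ω q'.1 x)
      (𝓝[Icc t₀ (t₀ + h) ×ˢ univ] (t, x)) (𝓝 0) := by
    refine squeeze_zero_norm (fun q' => abs_signedDist_sub_le q'.2 x) ?_
    have : Tendsto (fun q' : ℝ × EuclideanSpace ℝ (Fin n) => dist q'.2 x) (𝓝 (t, x))
        (𝓝 (dist x x)) := Continuous.tendsto (by fun_prop) (t, x)
    rw [dist_self] at this
    exact this.mono_left nhdsWithin_le_nhds
  have h3 := h2.add h1
  rw [zero_add] at h3
  refine h3.congr fun q' => ?_
  simp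

theorem IsCutoff.isCompact_tube (hη : IsCutoff Ω t₀ h ρ η)
    (hΩ : IsSmoothFront Ω t₀ h ρ) (hn : n ≠ 0) (hρ : 0 < ρ) (r : ℝ) :
    ∃ R, tube Ω t₀ h r ⊆ Icc t₀ (t₀ + h) ×ˢ Metric.closedBall 0 R ∧
      IsCompact (tube Ω t₀ h r) := by
  obtain ⟨R, hR⟩ := hΩ.exists_frontier_subset
  have hsub : tube Ω t₀ h r ⊆ Icc t₀ (t₀ + h) ×ˢ Metric.closedBall 0 (r + R) := by
    rintro ⟨t, x⟩ ⟨ht, hx⟩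
    obtain ⟨z, hz, hz2, -⟩ := hΩ.exists_nearest hn ht x
    refine ⟨ht, ?_⟩
    have h1 := hR t ht hz
    rw [Metric.mem_closedBall] at h1 ⊢
    have h2 := dist_triangle x z 0
    have hx : |signedDist Ω t x| ≤ r := hx
    change dist x 0 ≤ r + R
    linarith
  refine ⟨r + R, hsub, ?_⟩
  have hcomp : IsCompact (Icc t₀ (t₀ + h) ×ˢ
      Metric.closedBall (0 : EuclideanSpace ℝ (Fin n)) (r + R)) :=
    isCompact_Icc.prod (isCompact_closedBall 0 _)
  refine hcomp.of_isClosed_subset ?_ hsub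
  have hcl : IsClosed (Icc t₀ (t₀ + h) ×ˢ (univ : Set (EuclideanSpace ℝ (Fin n)))) :=
    isClosed_Icc.prod isClosed_univ
  have := (hη.continuousOn_abs_signedDist hΩ hn hρ).preimage_isClosed_of_isClosed hcl
    (isClosed_Iic (a := r))
  convert this using 1
  ext ⟨t, x⟩
  simp [tube]

end

/-! ### The extended distance and its derivatives up to the boundary of the tube -/

section

theorem exists_norm_le_of_continuousWithinAt {X F : Type*} [TopologicalSpace X]
    [NormedAddCommGroup F] {T : Set X} {g : X → F} {q : X} (hg : ContinuousWithinAt g T q) :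
    ∃ O, IsOpen O ∧ q ∈ O ∧ ∀ y ∈ O ∩ T, ‖g y‖ ≤ ‖g q‖ + 1 := by
  have h1 := hg.norm.eventually (gt_mem_nhds (lt_add_one ‖g q‖))
  obtain ⟨O, hO, hqO, h2⟩ := mem_nhdsWithin.mp h1
  exact ⟨O, hO, hqO, fun y hy => (h2 hy).le⟩

section
variable {X : Type*} [NormedAddCommGroup X] [NormedSpace ℝ X] {X₀ T T₀ : Set X}

theorem exists_fderivWithin_eq {F : Type*} [NormedAddCommGroup F] [NormedSpace ℝ F]
    (hX₀ : UniqueDiffOn ℝ X₀) (hT₀X : T₀ ⊆ X₀) (hT₀ : ∀ y ∈ T₀, T₀ ∈ 𝓝[X₀] y) (hT₀T : T₀ ⊆ T)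
    {q : X} (hq : q ∈ T) {f : X → F} {m : ℕ} (hf : ContDiffWithinAt ℝ (m + 1 : ℕ) f T q) :
    ∃ g : X → X →L[ℝ] F, ContDiffWithinAt ℝ m g T q ∧
      ∃ O, IsOpen O ∧ q ∈ O ∧ ∀ y ∈ O ∩ T₀, fderivWithin ℝ f X₀ y = g y := by
  push_cast at hf
  obtain ⟨u, hu, -, g, hg, hgc⟩ := (contDiffWithinAt_succ_iff_hasFDerivWithinAt (by simp)).mp hf
  rw [insert_eq_of_mem hq] at hu
  refine ⟨g, hgc.mono_of_mem_nhdsWithin hu, ?_⟩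
  obtain ⟨O, hO, hqO, hOu⟩ := mem_nhdsWithin.mp hu
  refine ⟨O, hO, hqO, fun y hy => ?_⟩
  have hyu : y ∈ u := hOu ⟨hy.1, hT₀T hy.2⟩
  have h1 : u ∈ 𝓝[X₀] y := by
    filter_upwards [hT₀ y hy.2, mem_nhdsWithin_of_mem_nhds (hO.mem_nhds hy.1)] with w h1 h2
    exact hOu ⟨h2, hT₀T h1⟩
  exact ((hg y hyu).mono_of_mem_nhdsWithin h1).fderivWithin (hX₀ y (hT₀X hy.2))

set_option maxSynthPendingDepth 3 in
/-- A function smooth on a compact set `T` has bounded derivatives on the part `T₀` of `T` where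
they are determined by the values of the function in the ambient set `X₀`. -/
theorem exists_bound_fderivWithin_of_isCompact {F : Type*} [NormedAddCommGroup F] [NormedSpace ℝ F]
    (hX₀ : UniqueDiffOn ℝ X₀) (hT₀X : T₀ ⊆ X₀) (hT₀ : ∀ y ∈ T₀, T₀ ∈ 𝓝[X₀] y) (hT₀T : T₀ ⊆ T)
    (hT : IsCompact T) {f : X → F} (hf : ContDiffOn ℝ 3 f T) :
    ∃ C, 0 ≤ C ∧ ∀ y ∈ T₀, ‖fderivWithin ℝ f X₀ y‖ ≤ C ∧
      ‖fderivWithin ℝ (fderivWithin ℝ f X₀) X₀ y‖ ≤ C ∧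
      ‖fderivWithin ℝ (fderivWithin ℝ (fderivWithin ℝ f X₀) X₀) X₀ y‖ ≤ C := by
  suffices H : ∃ C, 0 ≤ C ∧ ∀ y ∈ T ∩ T₀, ‖fderivWithin ℝ f X₀ y‖ ≤ C ∧
      ‖fderivWithin ℝ (fderivWithin ℝ f X₀) X₀ y‖ ≤ C ∧
      ‖fderivWithin ℝ (fderivWithin ℝ (fderivWithin ℝ f X₀) X₀) X₀ y‖ ≤ C by
    obtain ⟨C, hC0, hC⟩ := H
    exact ⟨C, hC0, fun y hy => hC y ⟨hT₀T hy, hy⟩⟩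
  refine hT.induction_on (p := fun s => ∃ C, 0 ≤ C ∧ ∀ y ∈ s ∩ T₀, ‖fderivWithin ℝ f X₀ y‖ ≤ C ∧
      ‖fderivWithin ℝ (fderivWithin ℝ f X₀) X₀ y‖ ≤ C ∧
      ‖fderivWithin ℝ (fderivWithin ℝ (fderivWithin ℝ f X₀) X₀) X₀ y‖ ≤ C)
    ⟨0, le_rfl, fun y hy => absurd hy.1 (notMem_empty y)⟩ ?_ ?_ ?_
  · rintro s t hst ⟨C, hC0, hC⟩
    exact ⟨C, hC0, fun y hy => hC y ⟨hst hy.1, hy.2⟩⟩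
  · rintro s t ⟨C, hC0, hC⟩ ⟨C', hC'0, hC'⟩
    refine ⟨max C C', hC0.trans (le_max_left _ _), fun y hy => ?_⟩
    rcases hy.1 with h1 | h1
    · obtain ⟨a, b, c⟩ := hC y ⟨h1, hy.2⟩
      exact ⟨a.trans (le_max_left _ _), b.trans (le_max_left _ _), c.trans (le_max_left _ _)⟩
    · obtain ⟨a, b, c⟩ := hC' y ⟨h1, hy.2⟩
      exact ⟨a.trans (le_max_right _ _), b.trans (le_max_right _ _), c.trans (le_max_right _ _)⟩
  · intro q hq
    obtain ⟨g₁, hg₁, O₁, hO₁, hqO₁, he₁⟩ :=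
      exists_fderivWithin_eq hX₀ hT₀X hT₀ hT₀T hq (m := 2) (hf q hq)
    obtain ⟨g₂, hg₂, O₂, hO₂, hqO₂, he₂⟩ :=
      exists_fderivWithin_eq hX₀ hT₀X hT₀ hT₀T hq (m := 1) hg₁
    obtain ⟨g₃, hg₃, O₃, hO₃, hqO₃, he₃⟩ :=
      exists_fderivWithin_eq hX₀ hT₀X hT₀ hT₀T hq (m := 0) hg₂
    obtain ⟨U₁, hU₁, hqU₁, hb₁⟩ := exists_norm_le_of_continuousWithinAt hg₁.continuousWithinAt
    obtain ⟨U₂, hU₂, hqU₂, hb₂⟩ := exists_norm_le_of_continuousWithinAt hg₂.continuousWithinAt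
    obtain ⟨U₃, hU₃, hqU₃, hb₃⟩ := exists_norm_le_of_continuousWithinAt hg₃.continuousWithinAt
    have hnear : ∀ {G : Type _} {a b : X → G} {O : Set X}, IsOpen O →
        (∀ y ∈ O ∩ T₀, a y = b y) → ∀ y ∈ O ∩ T₀, a =ᶠ[𝓝[X₀] y] b := by
      intro G a b O hO hab y hy
      filter_upwards [hT₀ y hy.2, mem_nhdsWithin_of_mem_nhds (hO.mem_nhds hy.1)] with w h1 h2
      exact hab w ⟨h2, h1⟩
    have he₂' : ∀ y ∈ (O₁ ∩ O₂) ∩ T₀, fderivWithin ℝ (fderivWithin ℝ f X₀) X₀ y = g₂ y := by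
      intro y hy
      rw [(hnear hO₁ he₁ y ⟨hy.1.1, hy.2⟩).fderivWithin_eq (he₁ y ⟨hy.1.1, hy.2⟩)]
      exact he₂ y ⟨hy.1.2, hy.2⟩
    have he₃' : ∀ y ∈ ((O₁ ∩ O₂) ∩ O₃) ∩ T₀,
        fderivWithin ℝ (fderivWithin ℝ (fderivWithin ℝ f X₀) X₀) X₀ y = g₃ y := by
      intro y hy
      rw [(hnear (hO₁.inter hO₂) he₂' y ⟨hy.1.1, hy.2⟩).fderivWithin_eq
        (he₂' y ⟨hy.1.1, hy.2⟩)]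
      exact he₃ y ⟨hy.1.2, hy.2⟩
    refine ⟨((O₁ ∩ O₂) ∩ O₃) ∩ (U₁ ∩ U₂ ∩ U₃), mem_nhdsWithin_of_mem_nhds
      ((((hO₁.inter hO₂).inter hO₃).inter ((hU₁.inter hU₂).inter hU₃)).mem_nhds
        ⟨⟨⟨hqO₁, hqO₂⟩, hqO₃⟩, ⟨hqU₁, hqU₂⟩, hqU₃⟩),
      ‖g₁ q‖ + 1 + (‖g₂ q‖ + 1) + (‖g₃ q‖ + 1), by positivity, fun y hy => ?_⟩
    obtain ⟨⟨⟨⟨y1, y2⟩, y3⟩, ⟨u1, u2⟩, u3⟩, hy0⟩ := hy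
    have n1 := norm_nonneg (g₁ q)
    have n2 := norm_nonneg (g₂ q)
    have n3 := norm_nonneg (g₃ q)
    rw [he₁ y ⟨y1, hy0⟩, he₂' y ⟨⟨y1, y2⟩, hy0⟩, he₃' y ⟨⟨⟨y1, y2⟩, y3⟩, hy0⟩]
    refine ⟨(hb₁ y ⟨u1, hT₀T hy0⟩).trans ?_, (hb₂ y ⟨u2, hT₀T hy0⟩).trans ?_,
      (hb₃ y ⟨u3, hT₀T hy0⟩).trans ?_⟩ <;> linarith

end

variable {n : ℕ} {Ω : ℝ → Set (EuclideanSpace ℝ (Fin n))} {t₀ h ρ : ℝ}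
  {η : ℝ → EuclideanSpace ℝ (Fin n) → ℝ}

theorem extDist_of_abs_le {t : ℝ} {x : EuclideanSpace ℝ (Fin n)} (hx : |signedDist Ω t x| ≤ ρ) :
    extDist Ω ρ η t x = signedDist Ω t x := by
  rw [extDist, if_pos hx]

theorem IsCutoff.extDist_of_pos (hη : IsCutoff Ω t₀ h ρ η) {t : ℝ} (ht : t ∈ Icc t₀ (t₀ + h))
    {x : EuclideanSpace ℝ (Fin n)} (hx : 0 < signedDist Ω t x) :
    extDist Ω ρ η t x = 2 * ρ - (2 * ρ - signedDist Ω t x) * η t x := by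
  unfold extDist
  split_ifs with h1 h2 h3
  · rw [hη.eq_one t ht x h1]; ring
  · rw [hη.eq_zero t ht x (h2.trans (le_abs_self _))]; ring
  · rw [hη.eq_zero t ht x (by rw [abs_of_pos hx]; linarith [not_le.mp h2])]; linarith
  · ring

theorem IsCutoff.extDist_of_neg (hη : IsCutoff Ω t₀ h ρ η) (hρ : 0 < ρ) {t : ℝ} (ht : t ∈ Icc t₀ (t₀ + h))
    {x : EuclideanSpace ℝ (Fin n)} (hx : signedDist Ω t x < 0) :
    extDist Ω ρ η t x = -(2 * ρ - (2 * ρ + signedDist Ω t x) * η t x) := by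
  unfold extDist
  split_ifs with h1 h2 h3 h4
  · rw [hη.eq_one t ht x h1]; ring
  · rw [hη.eq_zero t ht x (by rw [abs_of_neg hx]; linarith)]; linarith
  · rw [hη.eq_zero t ht x (by rw [abs_of_neg hx]; linarith)]; ring
  · linarith
  · ring

/-- The open tube of radius `2ρ`. -/
def openTube (Ω : ℝ → Set (EuclideanSpace ℝ (Fin n))) (t₀ h ρ : ℝ) :
    Set (ℝ × EuclideanSpace ℝ (Fin n)) :=
  {p | p.1 ∈ Icc t₀ (t₀ + h) ∧ |signedDist Ω p.1 p.2| < 2 * ρ}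

theorem IsCutoff.contDiffOn_extDist (hη : IsCutoff Ω t₀ h ρ η) (hΩ : IsSmoothFront Ω t₀ h ρ)
    (hρ : 0 < ρ) :
    ContDiffOn ℝ ∞ (fun p : ℝ × EuclideanSpace ℝ (Fin n) => extDist Ω ρ η p.1 p.2)
      (tube Ω t₀ h (2 * ρ)) := by
  intro q hq
  have hS := hΩ.smooth q hq
  have hηq : ContDiffWithinAt ℝ ∞ (fun p : ℝ × EuclideanSpace ℝ (Fin n) => η p.1 p.2)
      (tube Ω t₀ h (2 * ρ)) q :=
    (hη.smooth q ⟨hq.1, mem_univ _⟩).mono fun p hp => ⟨hp.1, mem_univ _⟩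
  have hSc := hS.continuousWithinAt
  have hmem : ∀ᶠ p in 𝓝[tube Ω t₀ h (2 * ρ)] q, p ∈ tube Ω t₀ h (2 * ρ) :=
    eventually_mem_nhdsWithin
  rcases lt_trichotomy (signedDist Ω q.1 q.2) 0 with h0 | h0 | h0
  · have h1 := (contDiffWithinAt_const (c := 2 * ρ)).add hS |>.mul hηq
    refine ((contDiffWithinAt_const (c := 2 * ρ)).sub h1).neg.congr_of_eventuallyEq ?_
      (hη.extDist_of_neg hρ hq.1 h0)
    filter_upwards [hSc.eventually (gt_mem_nhds h0), hmem] with p h2 h3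
    exact hη.extDist_of_neg hρ h3.1 h2
  · refine hS.congr_of_eventuallyEq ?_ (extDist_of_abs_le (by rw [h0, abs_zero]; exact hρ.le))
    have h1 : |signedDist Ω q.1 q.2| < ρ := by rw [h0, abs_zero]; exact hρ
    filter_upwards [hSc.abs.eventually (gt_mem_nhds h1)] with p h2
    exact extDist_of_abs_le h2.le
  · have h1 := (contDiffWithinAt_const (c := 2 * ρ)).sub hS |>.mul hηq
    refine ((contDiffWithinAt_const (c := 2 * ρ)).sub h1).congr_of_eventuallyEq ?_
      (hη.extDist_of_pos hq.1 h0)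
    filter_upwards [hSc.eventually (lt_mem_nhds h0), hmem] with p h2 h3
    exact hη.extDist_of_pos h3.1 h2

/-- Outside the open tube the extended distance has vanishing derivative, as the cutoff is
Lipschitz and the factor `2ρ - |signedDist|` tends to zero. -/
theorem IsCutoff.hasFDerivWithinAt_extDist_zero (hη : IsCutoff Ω t₀ h ρ η)
    (hΩ : IsSmoothFront Ω t₀ h ρ) (hn : n ≠ 0) (hρ : 0 < ρ) {q : ℝ × EuclideanSpace ℝ (Fin n)}
    (hq : q ∈ Icc t₀ (t₀ + h) ×ˢ univ) (hq2 : q ∉ openTube Ω t₀ h ρ) :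
    HasFDerivWithinAt (fun p : ℝ × EuclideanSpace ℝ (Fin n) => extDist Ω ρ η p.1 p.2)
      (0 : ℝ × EuclideanSpace ℝ (Fin n) →L[ℝ] ℝ) (Icc t₀ (t₀ + h) ×ˢ univ) q := by
  have hge : 2 * ρ ≤ |signedDist Ω q.1 q.2| := by
    by_contra h1
    exact hq2 ⟨hq.1, not_le.mp h1⟩
  have hηq := hη.eq_zero q.1 hq.1 q.2 hge
  have hSc := hη.continuousOn_signedDist hΩ hn hρ q hq
  have hSa := hη.continuousOn_abs_signedDist hΩ hn hρ q hq
  have hmem : ∀ᶠ p in 𝓝[Icc t₀ (t₀ + h) ×ˢ univ] q,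
      p ∈ Icc t₀ (t₀ + h) ×ˢ (univ : Set (EuclideanSpace ℝ (Fin n))) :=
    eventually_mem_nhdsWithin
  have hηO : (fun p : ℝ × EuclideanSpace ℝ (Fin n) => η p.1 p.2)
      =O[𝓝[Icc t₀ (t₀ + h) ×ˢ univ] q] fun p => p - q := by
    have h1 := (((hη.smooth q hq).differentiableWithinAt (by simp)).hasFDerivWithinAt).isBigO_sub
    simpa [hηq] using h1
  have hm : (fun p : ℝ × EuclideanSpace ℝ (Fin n) => max (2 * ρ - |signedDist Ω p.1 p.2|) 0)
      =o[𝓝[Icc t₀ (t₀ + h) ×ˢ univ] q] fun _ => (1 : ℝ) := by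
    rw [Asymptotics.isLittleO_one_iff]
    have h1 := (hSa.const_sub (2 * ρ)).max (tendsto_const_nhds (x := (0 : ℝ)))
    have h2 : max (2 * ρ - |signedDist Ω q.1 q.2|) 0 = 0 := max_eq_right (by linarith)
    rwa [h2] at h1
  have hprod := hm.mul_isBigO hηO.norm_right
  simp only [one_mul] at hprod
  rw [hasFDerivWithinAt_iff_isLittleO]
  rcases lt_or_gt_of_ne (show signedDist Ω q.1 q.2 ≠ 0 from fun h0 => by
    rw [h0, abs_zero] at hge; linarith) with h0 | h0
  · refine hprod.of_norm_right.congr' ?_ EventuallyEq.rfl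
    filter_upwards [hSc.eventually (gt_mem_nhds h0), hmem] with p h1 h2
    rw [hη.extDist_of_neg hρ h2.1 h1, hη.extDist_of_neg hρ hq.1 h0, hηq, abs_of_neg h1]
    rcases le_total (2 * ρ) (-signedDist Ω p.1 p.2) with h3 | h3
    · rw [hη.eq_zero p.1 h2.1 p.2 (by rwa [abs_of_neg h1])]; simp
    · rw [max_eq_left (by linarith)]; simp
  · refine hprod.of_norm_right.neg_left.congr' ?_ EventuallyEq.rfl
    filter_upwards [hSc.eventually (lt_mem_nhds h0), hmem] with p h1 h2
    rw [hη.extDist_of_pos h2.1 h1, hη.extDist_of_pos hq.1 h0, hηq, abs_of_pos h1]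
    rcases le_total (2 * ρ) (signedDist Ω p.1 p.2) with h3 | h3
    · rw [hη.eq_zero p.1 h2.1 p.2 (by rwa [abs_of_pos h1])]; simp
    · rw [max_eq_left (by linarith)]; simp

end

/-! ### Taylor remainders and bounds on the space-time derivatives -/

section

/-- A pointwise Lipschitz bound with a uniform constant is a global Lipschitz bound. -/
theorem norm_sub_le_of_eventually {E F : Type*} [NormedAddCommGroup E]
    [NormedSpace ℝ E] [NormedAddCommGroup F] {f : E → F} {K : ℝ}
    (hf : ∀ x, ∀ᶠ y in 𝓝 x, ‖f y - f x‖ ≤ K * ‖y - x‖) (x y : E) :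
    ‖f y - f x‖ ≤ K * ‖y - x‖ := by
  have hc : Continuous f := continuous_iff_continuousAt.mpr fun x => by
    rw [ContinuousAt, tendsto_iff_norm_sub_tendsto_zero]
    refine squeeze_zero' (Eventually.of_forall fun _ => norm_nonneg _) (hf x) ?_
    have : Tendsto (fun y => K * ‖y - x‖) (𝓝 x) (𝓝 (K * ‖x - x‖)) :=
      Continuous.tendsto (by fun_prop) x
    simpa using this
  refine le_of_forall_pos_le_add fun e he => ?_
  set g : ℝ → F := fun τ => f (x + τ • (y - x)) - f x with hg
  have hgc : ContinuousOn g (Icc 0 1) := by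
    refine Continuous.continuousOn ?_
    exact (hc.comp (by fun_prop)).sub continuous_const
  have hB : ∀ τ : ℝ, HasDerivAt (fun τ : ℝ => (K * ‖y - x‖ + e) * τ) (K * ‖y - x‖ + e) τ :=
    fun τ => by simpa using (hasDerivAt_id τ).const_mul (K * ‖y - x‖ + e)
  have hmain := image_norm_le_of_liminf_right_slope_norm_lt_deriv_boundary (f := g)
    (f' := fun _ => K * ‖y - x‖) hgc (fun τ _ r hr => ?_) (B := fun τ => (K * ‖y - x‖ + e) * τ)
    (B' := fun _ => K * ‖y - x‖ + e) (by simp [hg])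
    (fun τ _ => (hB τ).continuousAt.continuousWithinAt) (fun τ _ => (hB τ).hasDerivWithinAt)
    (fun _ _ _ => by linarith)
    (show (1 : ℝ) ∈ Icc 0 1 from ⟨zero_le_one, le_rfl⟩)
  · simpa [hg] using hmain
  · have hl : Tendsto (fun σ : ℝ => x + σ • (y - x)) (𝓝[>] τ) (𝓝 (x + τ • (y - x))) :=
      (Continuous.tendsto (by fun_prop) τ).mono_left nhdsWithin_le_nhds
    refine Eventually.frequently ?_
    filter_upwards [hl.eventually (hf _), self_mem_nhdsWithin] with σ h1 h2
    have h2 : τ < σ := h2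
    have h3 : 0 < σ - τ := by linarith
    refine lt_of_le_of_lt ?_ hr
    rw [slope_def_field, div_le_iff₀ h3]
    have h4 : x + σ • (y - x) - (x + τ • (y - x)) = (σ - τ) • (y - x) := by module
    rw [h4, norm_smul, Real.norm_of_nonneg h3.le] at h1
    have h5 : ‖g σ‖ - ‖g τ‖ ≤ ‖f (x + σ • (y - x)) - f (x + τ • (y - x))‖ := by
      refine (norm_sub_norm_le _ _).trans (le_of_eq ?_)
      rw [hg]; congr 1; simp
    simp only [Function.comp]
    linarith

section
variable {E F : Type*} [NormedAddCommGroup E] [NormedSpace ℝ E] [NormedAddCommGroup F]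
  [NormedSpace ℝ F]

theorem eventually_norm_sub_le_of_hasFDerivAt {f : E → F} {f' : E →L[ℝ] F} {x : E} {C : ℝ}
    (hf : HasFDerivAt f f' x) (hC : ‖f'‖ ≤ C) :
    ∀ᶠ y in 𝓝 x, ‖f y - f x‖ ≤ (C + 1) * ‖y - x‖ := by
  filter_upwards [(hasFDerivAt_iff_isLittleO.mp hf).def one_pos] with y hy
  have h1 : ‖f' (y - x)‖ ≤ C * ‖y - x‖ := (f'.le_opNorm _).trans (by gcongr)
  have h2 := norm_add_le (f y - f x - f' (y - x)) (f' (y - x))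
  rw [sub_add_cancel] at h2
  linarith

theorem abs_sub_sub_le_sq {f : E → ℝ} {f' : E → E →L[ℝ] ℝ} {K : ℝ}
    (hf : ∀ x, HasFDerivAt f (f' x) x) (hf' : ∀ x y, ‖f' y - f' x‖ ≤ K * ‖y - x‖) (hK : 0 ≤ K)
    (x v : E) : |f (x + v) - f x - f' x v| ≤ K * ‖v‖ ^ 2 := by
  have h1 := Convex.norm_image_sub_le_of_norm_hasFDerivWithin_le' (f := f) (f' := f') (φ := f' x)
    (C := K * ‖v‖) (s := segment ℝ x (x + v)) (fun y _ => (hf y).hasFDerivWithinAt) (fun y hy => by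
      refine (hf' x y).trans ?_
      gcongr
      have := norm_sub_le_of_mem_segment hy
      simpa using this) (convex_segment _ _) (left_mem_segment ℝ _ _) (right_mem_segment ℝ _ _)
  rw [add_sub_cancel_left] at h1
  rw [sq, ← mul_assoc]
  exact h1

/-- The first order Taylor remainder of a function with Lipschitz second derivative, compared at
two base points. -/
theorem abs_remainder_sub_le {f : E → ℝ} {f' : E → E →L[ℝ] ℝ} {f'' : E → E →L[ℝ] E →L[ℝ] ℝ}
    {C : Set E} {K : ℝ} (hC : Convex ℝ C) (hK : 0 ≤ K)
    (hf : ∀ x ∈ C, HasFDerivWithinAt f (f' x) C x)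
    (hf' : ∀ x ∈ C, HasFDerivWithinAt f' (f'' x) C x)
    (hf'' : ∀ x ∈ C, ∀ y ∈ C, ‖f'' y - f'' x‖ ≤ K * ‖y - x‖) {q q' v : E} (hq : q ∈ C)
    (hq' : q' ∈ C) (hqv : q + v ∈ C) (hqv' : q' + v ∈ C) :
    |(f (q' + v) - f q' - f' q' v) - (f (q + v) - f q - f' q v)| ≤ K * ‖v‖ ^ 2 * ‖q' - q‖ := by
  have hmem : ∀ {a : E}, a ∈ C → a + v ∈ C → ∀ τ ∈ Icc (0 : ℝ) 1, a + τ • v ∈ C := by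
    intro a ha hav τ hτ
    have := hC.add_smul_sub_mem ha hav hτ
    simpa using this
  have h1 : ∀ τ ∈ Icc (0 : ℝ) 1,
      ‖(f' (q' + τ • v) - f' q') - (f' (q + τ • v) - f' q)‖ ≤ K * ‖v‖ * ‖q' - q‖ := by
    intro τ hτ
    refine Convex.norm_image_sub_le_of_norm_hasFDerivWithin_le (s := segment ℝ q q')
      (f := fun a => f' (a + τ • v) - f' a) (f' := fun a => f'' (a + τ • v) - f'' a)
      (fun a ha => ?_) (fun a ha => ?_) (convex_segment _ _) (left_mem_segment ℝ _ _)
      (right_mem_segment ℝ _ _)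
    · have hsub : segment ℝ q q' ⊆ C := hC.segment_subset hq hq'
      have hmaps : MapsTo (fun a => a + τ • v) (segment ℝ q q') C := by
        intro b hb
        have hb' : b + τ • v ∈ segment ℝ (q + τ • v) (q' + τ • v) := by
          rw [add_comm b, add_comm q, add_comm q']
          exact (mem_segment_translate ℝ _).mpr hb
        exact hC.segment_subset (hmem hq hqv τ hτ) (hmem hq' hqv' τ hτ) hb'
      refine HasFDerivWithinAt.sub ?_ ((hf' a (hsub ha)).mono hsub)
      have := (hf' _ (hmaps ha)).comp a ((hasFDerivWithinAt_id a (segment ℝ q q')).add_const _)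
        hmaps
      rwa [ContinuousLinearMap.comp_id] at this
    · have hsub : segment ℝ q q' ⊆ C := hC.segment_subset hq hq'
      have hmaps : a + τ • v ∈ C := by
        have hb' : a + τ • v ∈ segment ℝ (q + τ • v) (q' + τ • v) := by
          rw [add_comm a, add_comm q, add_comm q']
          exact (mem_segment_translate ℝ _).mpr ha
        exact hC.segment_subset (hmem hq hqv τ hτ) (hmem hq' hqv' τ hτ) hb'
      refine (hf'' a (hsub ha) _ hmaps).trans ?_
      rw [add_sub_cancel_left, norm_smul, Real.norm_of_nonneg hτ.1]
      have : τ * ‖v‖ ≤ 1 * ‖v‖ := by gcongr; exact hτ.2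
      rw [one_mul] at this
      gcongr
  have hd : ∀ a, a ∈ C → a + v ∈ C → ∀ τ ∈ Icc (0 : ℝ) 1,
      HasDerivWithinAt (fun τ : ℝ => f (a + τ • v) - f a - τ * f' a v)
        (f' (a + τ • v) v - f' a v) (Icc 0 1) τ := by
    intro a ha hav τ hτ
    have h2 : HasDerivWithinAt (fun τ : ℝ => a + τ • v) v (Icc 0 1) τ := by
      have := ((hasDerivAt_id τ).smul_const v).const_add a
      simpa using this.hasDerivWithinAt
    have h3 := (hf _ (hmem ha hav τ hτ)).comp_hasDerivWithinAt τ h2 (fun σ hσ => hmem ha hav σ hσ)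
    have h4 : HasDerivWithinAt (fun τ : ℝ => τ * f' a v) (f' a v) (Icc 0 1) τ := by
      simpa using ((hasDerivAt_id τ).mul_const (f' a v)).hasDerivWithinAt
    exact (h3.sub_const _).sub h4
  have h5 := norm_image_sub_le_of_norm_deriv_le_segment_01'
    (fun τ hτ => (hd q' hq' hqv' τ hτ).sub (hd q hq hqv τ hτ)) (C := K * ‖v‖ ^ 2 * ‖q' - q‖)
    (fun τ hτ => by
      have h6 := h1 τ ⟨hτ.1, hτ.2.le⟩
      have e : (f' (q' + τ • v) v - f' q' v) - (f' (q + τ • v) v - f' q v) =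
          ((f' (q' + τ • v) - f' q') - (f' (q + τ • v) - f' q)) v := by simp
      rw [e]
      refine (ContinuousLinearMap.le_opNorm _ _).trans ?_
      calc _ ≤ K * ‖v‖ * ‖q' - q‖ * ‖v‖ := by gcongr
        _ = _ := by ring)
  simpa using h5

end

variable {n : ℕ} {Ω : ℝ → Set (EuclideanSpace ℝ (Fin n))} {t₀ h ρ : ℝ}
  {η : ℝ → EuclideanSpace ℝ (Fin n) → ℝ}

theorem uniqueDiffOn_slab (hh : 0 < h) :
    UniqueDiffOn ℝ (Icc t₀ (t₀ + h) ×ˢ (univ : Set (EuclideanSpace ℝ (Fin n)))) :=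
  (uniqueDiffOn_Icc (by linarith)).prod uniqueDiffOn_univ

/-- The space-time derivative of the extended distance. -/
def extDeriv (Ω : ℝ → Set (EuclideanSpace ℝ (Fin n))) (t₀ h ρ : ℝ)
    (η : ℝ → EuclideanSpace ℝ (Fin n) → ℝ) :
    ℝ × EuclideanSpace ℝ (Fin n) → ℝ × EuclideanSpace ℝ (Fin n) →L[ℝ] ℝ :=
  fderivWithin ℝ (fun p : ℝ × EuclideanSpace ℝ (Fin n) => extDist Ω ρ η p.1 p.2)
    (Icc t₀ (t₀ + h) ×ˢ univ)

theorem IsCutoff.openTube_mem_nhdsWithin (hη : IsCutoff Ω t₀ h ρ η)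
    (hΩ : IsSmoothFront Ω t₀ h ρ) (hn : n ≠ 0) (hρ : 0 < ρ)
    {q : ℝ × EuclideanSpace ℝ (Fin n)} (hq : q ∈ openTube Ω t₀ h ρ) :
    openTube Ω t₀ h ρ ∈ 𝓝[Icc t₀ (t₀ + h) ×ˢ univ] q :=
  hη.tube_mem_nhdsWithin_of_lt hΩ hn hρ ⟨hq.1, mem_univ _⟩ hq.2

theorem IsCutoff.hasFDerivWithinAt_extDist (hη : IsCutoff Ω t₀ h ρ η)
    (hΩ : IsSmoothFront Ω t₀ h ρ) (hn : n ≠ 0) (hρ : 0 < ρ)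
    {q : ℝ × EuclideanSpace ℝ (Fin n)} (hq : q ∈ Icc t₀ (t₀ + h) ×ˢ univ) :
    HasFDerivWithinAt (fun p : ℝ × EuclideanSpace ℝ (Fin n) => extDist Ω ρ η p.1 p.2)
      (extDeriv Ω t₀ h ρ η q) (Icc t₀ (t₀ + h) ×ˢ univ) q := by
  refine DifferentiableWithinAt.hasFDerivWithinAt ?_
  by_cases hqT : q ∈ openTube Ω t₀ h ρ
  · have h1 := (hη.contDiffOn_extDist hΩ hρ q ⟨hqT.1, hqT.2.le⟩).mono_of_mem_nhdsWithin
      (mem_of_superset (hη.openTube_mem_nhdsWithin hΩ hn hρ hqT) fun p hp => ⟨hp.1, hp.2.le⟩)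
    exact h1.differentiableWithinAt (by simp)
  · exact (hη.hasFDerivWithinAt_extDist_zero hΩ hn hρ hq hqT).differentiableWithinAt

theorem IsCutoff.extDeriv_eq_zero (hη : IsCutoff Ω t₀ h ρ η)
    (hΩ : IsSmoothFront Ω t₀ h ρ) (hn : n ≠ 0) (hh : 0 < h) (hρ : 0 < ρ)
    {q : ℝ × EuclideanSpace ℝ (Fin n)} (hq : q ∈ Icc t₀ (t₀ + h) ×ˢ univ)
    (hqT : q ∉ openTube Ω t₀ h ρ) : extDeriv Ω t₀ h ρ η q = 0 :=
  (hη.hasFDerivWithinAt_extDist_zero hΩ hn hρ hq hqT).fderivWithin (uniqueDiffOn_slab hh q hq)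

set_option maxSynthPendingDepth 3 in
/-- Bounds on the derivatives of the extended distance up to order three. -/
theorem IsCutoff.exists_bound_extDeriv (hη : IsCutoff Ω t₀ h ρ η)
    (hΩ : IsSmoothFront Ω t₀ h ρ) (hn : n ≠ 0) (hh : 0 < h) (hρ : 0 < ρ) :
    ∃ C, 0 ≤ C ∧ (∀ q ∈ Icc t₀ (t₀ + h) ×ˢ (univ : Set (EuclideanSpace ℝ (Fin n))),
        ‖extDeriv Ω t₀ h ρ η q‖ ≤ C) ∧
      ∃ f'' : ℝ × EuclideanSpace ℝ (Fin n) → ℝ × EuclideanSpace ℝ (Fin n) →L[ℝ]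
        ℝ × EuclideanSpace ℝ (Fin n) →L[ℝ] ℝ,
      ∃ f''' : ℝ × EuclideanSpace ℝ (Fin n) → ℝ × EuclideanSpace ℝ (Fin n) →L[ℝ]
        ℝ × EuclideanSpace ℝ (Fin n) →L[ℝ] ℝ × EuclideanSpace ℝ (Fin n) →L[ℝ] ℝ,
      ∀ q ∈ openTube Ω t₀ h ρ,
        HasFDerivWithinAt (extDeriv Ω t₀ h ρ η) (f'' q) (Icc t₀ (t₀ + h) ×ˢ univ) q ∧
        HasFDerivWithinAt f'' (f''' q) (Icc t₀ (t₀ + h) ×ˢ univ) q ∧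
        ‖f'' q‖ ≤ C ∧ ‖f''' q‖ ≤ C := by
  obtain ⟨R, -, hcomp⟩ := hη.isCompact_tube hΩ hn hρ (2 * ρ)
  have hU := uniqueDiffOn_slab (n := n) (t₀ := t₀) hh
  have hTn := fun q hq => hη.openTube_mem_nhdsWithin hΩ hn hρ (q := q) hq
  have hTX : openTube Ω t₀ h ρ ⊆ Icc t₀ (t₀ + h) ×ˢ univ := fun q hq => ⟨hq.1, mem_univ _⟩
  have hTT : openTube Ω t₀ h ρ ⊆ tube Ω t₀ h (2 * ρ) := fun q hq => ⟨hq.1, hq.2.le⟩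
  have hsm := hη.contDiffOn_extDist hΩ hρ
  obtain ⟨C, hC0, hC⟩ := exists_bound_fderivWithin_of_isCompact hU hTX hTn hTT
    hcomp (hsm.of_le ENat.LEInfty.out)
  refine ⟨C, hC0, fun q hq => ?_, fderivWithin ℝ (extDeriv Ω t₀ h ρ η)
    (Icc t₀ (t₀ + h) ×ˢ univ), fderivWithin ℝ (fderivWithin ℝ (extDeriv Ω t₀ h ρ η)
    (Icc t₀ (t₀ + h) ×ˢ univ)) (Icc t₀ (t₀ + h) ×ˢ univ), fun q hq => ?_⟩
  · by_cases hqT : q ∈ openTube Ω t₀ h ρ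
    · exact (hC q hqT).1
    · rw [hη.extDeriv_eq_zero hΩ hn hh hρ hq hqT, norm_zero]
      exact hC0
  · have h1 := (hsm q (hTT hq)).mono_of_mem_nhdsWithin (mem_of_superset (hTn q hq) hTT)
    have h2 : ContDiffWithinAt ℝ ∞ (extDeriv Ω t₀ h ρ η) (Icc t₀ (t₀ + h) ×ˢ univ) q :=
      h1.fderivWithin_right hU (by simp) (hTX hq)
    have h3 : ContDiffWithinAt ℝ ∞ (fderivWithin ℝ (extDeriv Ω t₀ h ρ η)
        (Icc t₀ (t₀ + h) ×ˢ univ)) (Icc t₀ (t₀ + h) ×ˢ univ) q :=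
      h2.fderivWithin_right hU (by simp) (hTX hq)
    exact ⟨(h2.differentiableWithinAt (by simp)).hasFDerivWithinAt,
      (h3.differentiableWithinAt (by simp)).hasFDerivWithinAt, (hC q hq).2.1, (hC q hq).2.2⟩

end

/-! ### The gradient of the extended distance -/

section

variable {n : ℕ} {Ω : ℝ → Set (EuclideanSpace ℝ (Fin n))} {t₀ h ρ : ℝ}
  {η : ℝ → EuclideanSpace ℝ (Fin n) → ℝ}

theorem norm_comp_inr_le {F : Type*} [NormedAddCommGroup F] [NormedSpace ℝ F]
    (L : ℝ × EuclideanSpace ℝ (Fin n) →L[ℝ] F) :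
    ‖L.comp (ContinuousLinearMap.inr ℝ ℝ (EuclideanSpace ℝ (Fin n)))‖ ≤ ‖L‖ :=
  ContinuousLinearMap.opNorm_le_bound _ (norm_nonneg _) fun v => by
    have := L.le_opNorm ((0 : ℝ), v)
    simpa using this

theorem hasFDerivAt_slice {F : Type*} [NormedAddCommGroup F] [NormedSpace ℝ F] {I : Set ℝ}
    {f : ℝ × EuclideanSpace ℝ (Fin n) → F} {f' : ℝ × EuclideanSpace ℝ (Fin n) →L[ℝ] F} {t : ℝ}
    {x : EuclideanSpace ℝ (Fin n)} (hf : HasFDerivWithinAt f f' (I ×ˢ univ) (t, x)) (ht : t ∈ I) :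
    HasFDerivAt (fun y => f (t, y))
      (f'.comp (ContinuousLinearMap.inr ℝ ℝ (EuclideanSpace ℝ (Fin n)))) x := by
  rw [← hasFDerivWithinAt_univ]
  exact hf.comp x (hasFDerivAt_prodMk_right t x).hasFDerivWithinAt
    (fun y _ => ⟨ht, mem_univ _⟩)

set_option maxSynthPendingDepth 3 in
/-- The cutoff is quadratically small at the boundary of its support. -/
theorem IsCutoff.exists_bound_near (hη : IsCutoff Ω t₀ h ρ η)
    (hΩ : IsSmoothFront Ω t₀ h ρ) (hn : n ≠ 0) (hh : 0 < h) (hρ : 0 < ρ) :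
    ∃ K, 0 ≤ K ∧ ∀ t ∈ Icc t₀ (t₀ + h), ∀ x, (t, x) ∉ openTube Ω t₀ h ρ →
      ∀ᶠ y in 𝓝 x, (t, y) ∈ openTube Ω t₀ h ρ → |η t y| ≤ K * ‖y - x‖ ∧
        ∃ η' : EuclideanSpace ℝ (Fin n) →L[ℝ] ℝ, HasFDerivAt (η t) η' y ∧
          ‖η'‖ ≤ K * ‖y - x‖ := by
  obtain ⟨R, hR, -⟩ := hη.isCompact_tube hΩ hn hρ (2 * ρ)
  have hU := uniqueDiffOn_slab (n := n) (t₀ := t₀) hh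
  set X₀ := Icc t₀ (t₀ + h) ×ˢ (univ : Set (EuclideanSpace ℝ (Fin n))) with hX₀
  set f : ℝ × EuclideanSpace ℝ (Fin n) → ℝ := fun p => η p.1 p.2 with hf
  have h1 : ContDiffOn ℝ ∞ (fderivWithin ℝ f X₀) X₀ := hη.smooth.fderivWithin hU (by simp)
  have h2 : ContDiffOn ℝ ∞ (fderivWithin ℝ (fderivWithin ℝ f X₀) X₀) X₀ :=
    h1.fderivWithin hU (by simp)
  have hZ : IsCompact (Icc t₀ (t₀ + h) ×ˢ
      Metric.closedBall (0 : EuclideanSpace ℝ (Fin n)) (R + 1)) :=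
    isCompact_Icc.prod (isCompact_closedBall 0 _)
  have hZX : Icc t₀ (t₀ + h) ×ˢ Metric.closedBall (0 : EuclideanSpace ℝ (Fin n)) (R + 1) ⊆ X₀ :=
    prod_mono_right (subset_univ _)
  obtain ⟨C₁, hC₁⟩ := hZ.exists_bound_of_continuousOn (h1.continuousOn.mono hZX)
  obtain ⟨C₂, hC₂⟩ := hZ.exists_bound_of_continuousOn
    (f := fderivWithin ℝ (fderivWithin ℝ f X₀) X₀) (h2.continuousOn.mono hZX)
  refine ⟨max (max C₁ C₂) 0, le_max_right _ _, fun t ht x hx => ?_⟩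
  have hη0 : η t x = 0 := hη.eq_zero t ht x (by
    by_contra h3
    exact hx ⟨ht, not_le.mp h3⟩)
  by_cases hxR : x ∈ Metric.closedBall (0 : EuclideanSpace ℝ (Fin n)) R
  swap
  · filter_upwards [Metric.isClosed_closedBall.isOpen_compl.mem_nhds hxR] with y hy hy2
    exact absurd (hR ⟨ht, hy2.2.le⟩).2 hy
  have hball : Metric.ball (0 : EuclideanSpace ℝ (Fin n)) (R + 1) ⊆ Metric.closedBall 0 (R + 1) :=
    Metric.ball_subset_closedBall
  have hxb : x ∈ Metric.ball (0 : EuclideanSpace ℝ (Fin n)) (R + 1) := by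
    rw [Metric.mem_ball]
    have := Metric.mem_closedBall.mp hxR
    linarith
  have hd1 : ∀ y, HasFDerivAt (η t) ((fderivWithin ℝ f X₀ (t, y)).comp
      (ContinuousLinearMap.inr ℝ ℝ (EuclideanSpace ℝ (Fin n)))) y := fun y =>
    hasFDerivAt_slice
      (hη.smooth.differentiableOn (by simp) (t, y) ⟨ht, mem_univ _⟩).hasFDerivWithinAt ht
  have hd2 : ∀ y, HasFDerivAt (fun y => fderivWithin ℝ f X₀ (t, y))
      ((fderivWithin ℝ (fderivWithin ℝ f X₀) X₀ (t, y)).comp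
        (ContinuousLinearMap.inr ℝ ℝ (EuclideanSpace ℝ (Fin n)))) y := fun y =>
    hasFDerivAt_slice
      (h1.differentiableOn (by simp) (t, y) ⟨ht, mem_univ _⟩).hasFDerivWithinAt ht
  have hzero : (fderivWithin ℝ f X₀ (t, x)).comp
      (ContinuousLinearMap.inr ℝ ℝ (EuclideanSpace ℝ (Fin n))) = 0 := by
    refine IsLocalMin.hasFDerivAt_eq_zero (f := η t) ?_ (hd1 x)
    exact Eventually.of_forall fun y => by rw [hη0]; exact (hη.mem_Icc t ht y).1
  filter_upwards [Metric.isOpen_ball.mem_nhds hxb] with y hy _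
  refine ⟨?_, _, hd1 y, ?_⟩
  · have h3 := (convex_ball (0 : EuclideanSpace ℝ (Fin n))
      (R + 1)).norm_image_sub_le_of_norm_hasFDerivWithin_le
      (f := η t) (C := max (max C₁ C₂) 0) (fun y _ => (hd1 y).hasFDerivWithinAt)
      (fun y hy => (norm_comp_inr_le _).trans ((hC₁ (t, y) ⟨ht, hball hy⟩).trans
        ((le_max_left _ _).trans (le_max_left _ _)))) hxb hy
    rwa [hη0, sub_zero] at h3
  · have h3 := (convex_ball (0 : EuclideanSpace ℝ (Fin n))
      (R + 1)).norm_image_sub_le_of_norm_hasFDerivWithin_le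
      (f := fun y => fderivWithin ℝ f X₀ (t, y)) (C := max (max C₁ C₂) 0)
      (fun y _ => (hd2 y).hasFDerivWithinAt)
      (fun y hy => (norm_comp_inr_le _).trans ((hC₂ (t, y) ⟨ht, hball hy⟩).trans
        ((le_max_right _ _).trans (le_max_left _ _)))) hxb hy
    refine le_trans ?_ h3
    rw [← sub_zero ((fderivWithin ℝ f X₀ (t, y)).comp _), ← hzero,
      ← ContinuousLinearMap.sub_comp]
    exact norm_comp_inr_le _

/-- The spatial derivative of the extended distance. -/
def extGrad (Ω : ℝ → Set (EuclideanSpace ℝ (Fin n))) (t₀ h ρ : ℝ)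
    (η : ℝ → EuclideanSpace ℝ (Fin n) → ℝ) (t : ℝ) (x : EuclideanSpace ℝ (Fin n)) :
    EuclideanSpace ℝ (Fin n) →L[ℝ] ℝ :=
  (extDeriv Ω t₀ h ρ η (t, x)).comp (ContinuousLinearMap.inr ℝ ℝ (EuclideanSpace ℝ (Fin n)))

theorem IsCutoff.hasFDerivAt_extDist (hη : IsCutoff Ω t₀ h ρ η)
    (hΩ : IsSmoothFront Ω t₀ h ρ) (hn : n ≠ 0) (hρ : 0 < ρ) {t : ℝ} (ht : t ∈ Icc t₀ (t₀ + h))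
    (x : EuclideanSpace ℝ (Fin n)) :
    HasFDerivAt (extDist Ω ρ η t) (extGrad Ω t₀ h ρ η t x) x :=
  hasFDerivAt_slice (hη.hasFDerivWithinAt_extDist hΩ hn hρ (q := (t, x)) ⟨ht, mem_univ _⟩) ht

/-- The gradient of the extended distance is Lipschitz in space. At points outside the open tube
this uses that the cutoff and its gradient vanish there to first order. -/
theorem IsCutoff.exists_extGrad_lipschitz (hη : IsCutoff Ω t₀ h ρ η)
    (hΩ : IsSmoothFront Ω t₀ h ρ) (hn : n ≠ 0) (hh : 0 < h) (hρ : 0 < ρ) :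
    ∃ K, 0 ≤ K ∧ ∀ t ∈ Icc t₀ (t₀ + h), ∀ x y,
      ‖extGrad Ω t₀ h ρ η t y - extGrad Ω t₀ h ρ η t x‖ ≤ K * ‖y - x‖ := by
  obtain ⟨C, hC0, -, f'', f''', hf⟩ := hη.exists_bound_extDeriv hΩ hn hh hρ
  obtain ⟨K, hK0, hK⟩ := hη.exists_bound_near hΩ hn hh hρ
  refine ⟨max (C + 1) ((2 * ρ + 1) * K), le_max_of_le_left (by linarith), fun t ht =>
    norm_sub_le_of_eventually fun x => ?_⟩
  by_cases hx : (t, x) ∈ openTube Ω t₀ h ρ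
  · have h1 := eventually_norm_sub_le_of_hasFDerivAt (hasFDerivAt_slice (hf (t, x) hx).1 ht)
      ((norm_comp_inr_le _).trans (hf (t, x) hx).2.2.1)
    filter_upwards [h1] with y hy
    refine le_trans ?_ (hy.trans (mul_le_mul_of_nonneg_right (le_max_left _ _) (norm_nonneg _)))
    rw [extGrad, extGrad, ← ContinuousLinearMap.sub_comp]
    exact norm_comp_inr_le _
  · have hx0 : extGrad Ω t₀ h ρ η t x = 0 := by
      rw [extGrad, hη.extDeriv_eq_zero hΩ hn hh hρ ⟨ht, mem_univ _⟩ hx,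
        ContinuousLinearMap.zero_comp]
    have hge : 2 * ρ ≤ |signedDist Ω t x| := by
      by_contra h3
      exact hx ⟨ht, not_le.mp h3⟩
    rw [hx0]
    filter_upwards [hK t ht x hx, Metric.ball_mem_nhds x hρ] with y hy hyx
    rw [sub_zero]
    by_cases hyT : (t, y) ∈ openTube Ω t₀ h ρ
    swap
    · rw [extGrad, hη.extDeriv_eq_zero hΩ hn hh hρ ⟨ht, mem_univ _⟩ hyT,
        ContinuousLinearMap.zero_comp, norm_zero]
      positivity
    obtain ⟨h1, η', h2, h3⟩ := hy hyT
    refine le_trans ?_ (mul_le_mul_of_nonneg_right (le_max_right _ _) (norm_nonneg _))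
    -- the signed distance is differentiable in the open tube, with derivative of norm at most one
    have hST : DifferentiableWithinAt ℝ
        (fun p : ℝ × EuclideanSpace ℝ (Fin n) => signedDist Ω p.1 p.2)
        (Icc t₀ (t₀ + h) ×ˢ univ) (t, y) :=
      ((hΩ.smooth (t, y) ⟨hyT.1, hyT.2.le⟩).mono_of_mem_nhdsWithin (mem_of_superset
        (hη.openTube_mem_nhdsWithin hΩ hn hρ hyT) fun p hp =>
          ⟨hp.1, hp.2.le⟩)).differentiableWithinAt (by simp)
    have hS : HasFDerivAt (signedDist Ω t) _ y := hasFDerivAt_slice hST.hasFDerivWithinAt ht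
    set S' := (fderivWithin ℝ (fun p : ℝ × EuclideanSpace ℝ (Fin n) => signedDist Ω p.1 p.2)
      (Icc t₀ (t₀ + h) ×ˢ univ) (t, y)).comp
      (ContinuousLinearMap.inr ℝ ℝ (EuclideanSpace ℝ (Fin n)))
    have hS1 : ‖S'‖ ≤ 1 := hS.le_of_lip' zero_le_one (Eventually.of_forall fun w => by
      rw [one_mul, Real.norm_eq_abs, ← dist_eq_norm]
      exact abs_signedDist_sub_le w y)
    have hySlt : |signedDist Ω t y| < 2 * ρ := hyT.2
    have hnb : ∀ {a : ℝ}, |a| ≤ 2 * ρ →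
        ‖a • η' - η t y • S'‖ ≤ (2 * ρ + 1) * K * ‖y - x‖ := by
      intro a ha
      refine (norm_sub_le _ _).trans ?_
      rw [norm_smul, norm_smul, Real.norm_eq_abs, Real.norm_eq_abs]
      calc _ ≤ 2 * ρ * (K * ‖y - x‖) + K * ‖y - x‖ * 1 := by gcongr
        _ = _ := by ring
    have hxy := abs_signedDist_sub_le (Ω := Ω) (t := t) y x
    have hyx' : dist y x < ρ := hyx
    have hd := hη.hasFDerivAt_extDist hΩ hn hρ ht y
    have hcy := (continuous_signedDist Ω t).continuousAt (x := y)
    rcases le_total 0 (signedDist Ω t x) with h0 | h0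
    · rw [abs_of_nonneg h0] at hge
      have hy0 : 0 < signedDist Ω t y := by linarith [(abs_le.mp hxy).1]
      rw [abs_of_pos hy0] at hySlt
      have hd2 : HasFDerivAt (extDist Ω ρ η t)
          (-((2 * ρ - signedDist Ω t y) • η' - η t y • S')) y := by
        refine ((((hS.const_sub (2 * ρ)).mul h2).const_sub (2 * ρ)).congr_of_eventuallyEq
          ?_).congr_fderiv ?_
        · filter_upwards [hcy.eventually (lt_mem_nhds hy0)] with w hw
          exact hη.extDist_of_pos ht hw
        · rw [smul_neg, ← sub_eq_add_neg]
      rw [hd.unique hd2, norm_neg]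
      exact hnb (by rw [abs_of_pos] <;> linarith)
    · rw [abs_of_nonpos h0] at hge
      have hy0 : signedDist Ω t y < 0 := by linarith [(abs_le.mp hxy).2]
      rw [abs_of_neg hy0] at hySlt
      have hd2 : HasFDerivAt (extDist Ω ρ η t)
          (-((-(2 * ρ + signedDist Ω t y)) • η' - η t y • S')) y := by
        refine ((((hS.const_add (2 * ρ)).mul h2).const_sub (2 * ρ)).neg.congr_of_eventuallyEq
          ?_).congr_fderiv ?_
        · filter_upwards [hcy.eventually (gt_mem_nhds hy0)] with w hw
          exact hη.extDist_of_neg hρ ht hw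
        · module
      rw [hd.unique hd2, norm_neg]
      exact hnb (by rw [abs_neg, abs_of_pos] <;> linarith)

/-- Near the front the gradient does not vanish: the extended distance has slope one along the
segment to a nearest point of the front. -/
theorem IsCutoff.one_le_norm_extGrad (hη : IsCutoff Ω t₀ h ρ η)
    (hΩ : IsSmoothFront Ω t₀ h ρ) (hn : n ≠ 0) (hh : 0 < h) (hρ : 0 < ρ) {t : ℝ}
    {x : EuclideanSpace ℝ (Fin n)} (hx : (t, x) ∈ tube Ω t₀ h ρ) :
    1 ≤ ‖extGrad Ω t₀ h ρ η t x‖ := by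
  have ht : t ∈ Icc t₀ (t₀ + h) := hx.1
  have hoff : ∀ y, |signedDist Ω t y| ≤ ρ → signedDist Ω t y ≠ 0 →
      1 ≤ ‖extGrad Ω t₀ h ρ η t y‖ := by
    intro y hy hy0
    obtain ⟨z, -, hz2, hseg⟩ := hΩ.exists_nearest hn ht y
    have hd := hη.hasFDerivAt_extDist hΩ hn hρ ht y
    have h1 : HasDerivWithinAt (fun τ : ℝ => extDist Ω ρ η t (y + τ • (z - y)))
        (extGrad Ω t₀ h ρ η t y (z - y)) (Icc 0 1) 0 := by
      have h2 : HasDerivAt (fun τ : ℝ => y + τ • (z - y)) (z - y) 0 := by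
        simpa using ((hasDerivAt_id (0 : ℝ)).smul_const (z - y)).const_add y
      have h3 : HasFDerivAt (extDist Ω ρ η t) (extGrad Ω t₀ h ρ η t y)
          (y + (0 : ℝ) • (z - y)) := by simpa using hd
      exact (h3.comp_hasDerivAt (0 : ℝ) h2).hasDerivWithinAt
    have h4 : HasDerivWithinAt (fun τ : ℝ => (1 - τ) * signedDist Ω t y)
        (-signedDist Ω t y) (Icc 0 1) 0 := by
      simpa using (((hasDerivAt_id (0 : ℝ)).const_sub 1).mul_const
        (signedDist Ω t y)).hasDerivWithinAt
    have h5 : ∀ τ ∈ Icc (0 : ℝ) 1, extDist Ω ρ η t (y + τ • (z - y)) =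
        (1 - τ) * signedDist Ω t y := by
      intro τ hτ
      rw [extDist_of_abs_le, hseg τ hτ]
      rw [hseg τ hτ, abs_mul, abs_of_nonneg (by linarith [hτ.2])]
      refine le_trans ?_ hy
      exact mul_le_of_le_one_left (abs_nonneg _) (by linarith [hτ.1])
    have h6 := h4.congr h5 (h5 0 ⟨le_rfl, zero_le_one⟩)
    have h7 : extGrad Ω t₀ h ρ η t y (z - y) = -signedDist Ω t y :=
      (uniqueDiffOn_Icc zero_lt_one 0 ⟨le_rfl, zero_le_one⟩).eq_deriv _ h1 h6
    have h8 := (extGrad Ω t₀ h ρ η t y).le_opNorm (z - y)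
    rw [h7, norm_neg, Real.norm_eq_abs, ← dist_eq_norm, dist_comm, hz2] at h8
    have h9 : 0 < |signedDist Ω t y| := abs_pos.mpr hy0
    by_contra h10
    nlinarith
  by_cases hx0 : signedDist Ω t x = 0
  swap
  · exact hoff x hx.2 hx0
  obtain ⟨K, hK0, hK⟩ := hη.exists_extGrad_lipschitz hΩ hn hh hρ
  have hcont : Continuous (extGrad Ω t₀ h ρ η t) :=
    (LipschitzWith.of_dist_le_mul (K := ⟨K, hK0⟩) fun y w => by
      rw [dist_eq_norm, dist_eq_norm]; exact hK t ht w y).continuous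
  have hclosed : IsClosed {y | 1 ≤ ‖extGrad Ω t₀ h ρ η t y‖} :=
    isClosed_le continuous_const hcont.norm
  change x ∈ {y | 1 ≤ ‖extGrad Ω t₀ h ρ η t y‖}
  rw [← hclosed.closure_eq]
  refine mem_closure_iff_frequently.mpr ?_
  have hxf := (hΩ.signedDist_eq_zero_iff hn ht).mp hx0
  have h1 : ∃ᶠ y in 𝓝 x, y ∈ Ω t := mem_closure_iff_frequently.mp hxf.1
  have h2 : ∀ᶠ y in 𝓝 x, |signedDist Ω t y| < ρ :=
    (continuous_signedDist Ω t).abs.continuousAt.eventually (gt_mem_nhds (by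
      change |signedDist Ω t x| < ρ
      rw [hx0, abs_zero]; exact hρ))
  refine (h1.and_eventually h2).mono fun y hy => ?_
  exact hoff y hy.2.le (hΩ.signedDist_pos_of_mem hn ht hy.1).ne'

theorem IsCutoff.abs_extDist_sub_le (hη : IsCutoff Ω t₀ h ρ η)
    (hΩ : IsSmoothFront Ω t₀ h ρ) (hn : n ≠ 0) (hρ : 0 < ρ) {C : ℝ}
    (hC : ∀ q ∈ Icc t₀ (t₀ + h) ×ˢ (univ : Set (EuclideanSpace ℝ (Fin n))),
      ‖extDeriv Ω t₀ h ρ η q‖ ≤ C) {q q' : ℝ × EuclideanSpace ℝ (Fin n)}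
    (hq : q.1 ∈ Icc t₀ (t₀ + h)) (hq' : q'.1 ∈ Icc t₀ (t₀ + h)) :
    |extDist Ω ρ η q'.1 q'.2 - extDist Ω ρ η q.1 q.2| ≤ C * ‖q' - q‖ :=
  ((convex_Icc t₀ (t₀ + h)).prod convex_univ).norm_image_sub_le_of_norm_hasFDerivWithin_le
    (f := fun p : ℝ × EuclideanSpace ℝ (Fin n) => extDist Ω ρ η p.1 p.2)
    (fun _ hp => hη.hasFDerivWithinAt_extDist hΩ hn hρ hp) hC ⟨hq, mem_univ _⟩ ⟨hq', mem_univ _⟩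

set_option maxSynthPendingDepth 3 in
/-- The first order Taylor remainder in space varies in a Lipschitz way with the base point, with
a constant quadratic in the increment. -/
theorem IsCutoff.exists_remainder_lipschitz (hη : IsCutoff Ω t₀ h ρ η)
    (hΩ : IsSmoothFront Ω t₀ h ρ) (hn : n ≠ 0) (hh : 0 < h) (hρ : 0 < ρ) :
    ∃ K, 0 ≤ K ∧ ∀ q ∈ tube Ω t₀ h ρ, ∀ᶠ q' in 𝓝[Icc t₀ (t₀ + h) ×ˢ univ] q,
      ∀ v : EuclideanSpace ℝ (Fin n),
        |(extDist Ω ρ η q'.1 (q'.2 + v) - extDist Ω ρ η q'.1 q'.2 -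
            extGrad Ω t₀ h ρ η q'.1 q'.2 v) -
          (extDist Ω ρ η q.1 (q.2 + v) - extDist Ω ρ η q.1 q.2 -
            extGrad Ω t₀ h ρ η q.1 q.2 v)| ≤ K * ‖v‖ ^ 2 * ‖q' - q‖ := by
  obtain ⟨C, hC0, hC1, f'', f''', hf⟩ := hη.exists_bound_extDeriv hΩ hn hh hρ
  refine ⟨C + (8 * C / ρ ^ 2 + 2 * C / ρ), by positivity, ?_⟩
  rintro ⟨t, x⟩ ⟨ht, hx⟩
  have ht : t ∈ Icc t₀ (t₀ + h) := ht
  have hx : |signedDist Ω t x| ≤ ρ := hx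
  -- a convex neighbourhood of the base point inside the open tube
  have h1 : ∀ᶠ s in 𝓝[Icc t₀ (t₀ + h)] t, |signedDist Ω s x| < 5 / 4 * ρ :=
    (Tendsto.comp (hη.continuousOn_abs_signedDist hΩ hn hρ (t, x) ⟨ht, mem_univ _⟩)
      (tendsto_slice x)).eventually (gt_mem_nhds (by
        change |signedDist Ω t x| < 5 / 4 * ρ
        linarith))
  obtain ⟨r, hr0, hr⟩ := Metric.mem_nhdsWithin_iff.mp h1
  set B : Set (ℝ × EuclideanSpace ℝ (Fin n)) :=
    (Metric.ball t r ∩ Icc t₀ (t₀ + h)) ×ˢ Metric.ball x (3 / 4 * ρ) with hB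
  have hBconv : Convex ℝ B :=
    ((convex_ball t r).inter (convex_Icc _ _)).prod (convex_ball x _)
  have hBT : B ⊆ openTube Ω t₀ h ρ := by
    rintro ⟨s, y⟩ ⟨hs, hy⟩
    refine ⟨hs.2, ?_⟩
    have h2 : |signedDist Ω s x| < 5 / 4 * ρ := hr hs
    have h3 := abs_signedDist_sub_le (Ω := Ω) (t := s) y x
    have h4 := abs_sub_abs_le_abs_sub (signedDist Ω s y) (signedDist Ω s x)
    have h5 : dist y x < 3 / 4 * ρ := hy
    change |signedDist Ω s y| < 2 * ρ
    linarith
  have hBX : B ⊆ Icc t₀ (t₀ + h) ×ˢ univ := fun p hp => ⟨hp.1.2, mem_univ _⟩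
  have hqB : (t, x) ∈ B := ⟨⟨Metric.mem_ball_self hr0, ht⟩, Metric.mem_ball_self (by positivity)⟩
  have hfB : ∀ p ∈ B, HasFDerivWithinAt
      (fun p : ℝ × EuclideanSpace ℝ (Fin n) => extDist Ω ρ η p.1 p.2)
      (extDeriv Ω t₀ h ρ η p) B p := fun p hp =>
    (hη.hasFDerivWithinAt_extDist hΩ hn hρ (hBX hp)).mono hBX
  have hf'B : ∀ p ∈ B, HasFDerivWithinAt (extDeriv Ω t₀ h ρ η) (f'' p) B p := fun p hp =>
    (hf p (hBT hp)).1.mono hBX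
  have hf''B : ∀ p ∈ B, ∀ p' ∈ B, ‖f'' p' - f'' p‖ ≤ C * ‖p' - p‖ := fun p hp p' hp' =>
    hBconv.norm_image_sub_le_of_norm_hasFDerivWithin_le
      (fun a ha => (hf a (hBT ha)).2.1.mono hBX) (fun a ha => (hf a (hBT ha)).2.2.2) hp hp'
  have hnear : ∀ᶠ q' in 𝓝[Icc t₀ (t₀ + h) ×ˢ univ] (t, x),
      q'.1 ∈ Metric.ball t r ∧ q'.1 ∈ Icc t₀ (t₀ + h) ∧ q'.2 ∈ Metric.ball x (ρ / 8) := by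
    have e1 := (continuous_fst (X := ℝ) (Y := EuclideanSpace ℝ (Fin n))).continuousAt
      (x := (t, x)) |>.eventually (Metric.ball_mem_nhds t hr0)
    have e2 := (continuous_snd (X := ℝ) (Y := EuclideanSpace ℝ (Fin n))).continuousAt
      (x := (t, x)) |>.eventually (Metric.ball_mem_nhds x (show 0 < ρ / 8 by positivity))
    filter_upwards [mem_nhdsWithin_of_mem_nhds e1, mem_nhdsWithin_of_mem_nhds e2,
      self_mem_nhdsWithin] with q' a b c using ⟨a, c.1, b⟩
  filter_upwards [hnear] with q' hq' v
  have hd8 : dist q'.2 x < ρ / 8 := hq'.2.2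
  have hq'B : q' ∈ B := ⟨⟨hq'.1, hq'.2.1⟩, Metric.ball_subset_ball (by linarith) hq'.2.2⟩
  have hC2 : 0 ≤ 8 * C / ρ ^ 2 + 2 * C / ρ := by positivity
  have hvn : 0 ≤ ‖v‖ ^ 2 * ‖q' - (t, x)‖ := by positivity
  have hadd : ∀ p : ℝ × EuclideanSpace ℝ (Fin n), p + ((0 : ℝ), v) = (p.1, p.2 + v) := fun p => by
    ext <;> simp
  have hnv : ‖((0 : ℝ), v)‖ = ‖v‖ := by simp
  have hgr : ∀ p : ℝ × EuclideanSpace ℝ (Fin n), extGrad Ω t₀ h ρ η p.1 p.2 v =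
      extDeriv Ω t₀ h ρ η p ((0 : ℝ), v) := fun p => by simp [extGrad]
  rcases lt_or_ge ‖v‖ (ρ / 2) with hv | hv
  · have hmem : ∀ p : ℝ × EuclideanSpace ℝ (Fin n), p.1 ∈ Metric.ball t r →
        p.1 ∈ Icc t₀ (t₀ + h) → dist p.2 x < ρ / 8 → p + ((0 : ℝ), v) ∈ B := by
      intro p hp1 hp2 hp3
      rw [hadd]
      refine ⟨⟨hp1, hp2⟩, ?_⟩
      change dist (p.2 + v) x < 3 / 4 * ρ
      have := dist_triangle (p.2 + v) p.2 x
      rw [dist_self_add_left] at this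
      linarith
    have hmain := abs_remainder_sub_le hBconv hC0 hfB hf'B hf''B hqB hq'B
      (hmem (t, x) (Metric.mem_ball_self hr0) ht (by rw [dist_self]; positivity))
      (hmem q' hq'.1 hq'.2.1 hd8)
    rw [hnv, hadd, hadd] at hmain
    rw [hgr q', hgr (t, x)]
    refine hmain.trans ?_
    rw [mul_assoc, mul_assoc]
    refine mul_le_mul_of_nonneg_right ?_ hvn
    linarith
  · have e1 := hη.abs_extDist_sub_le hΩ hn hρ hC1 (q := (t, x + v)) (q' := (q'.1, q'.2 + v))
      ht hq'.2.1
    have e2 := hη.abs_extDist_sub_le hΩ hn hρ hC1 (q := (t, x)) (q' := q') ht hq'.2.1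
    have e3 : ‖extDeriv Ω t₀ h ρ η q' - extDeriv Ω t₀ h ρ η (t, x)‖ ≤ C * ‖q' - (t, x)‖ :=
      hBconv.norm_image_sub_le_of_norm_hasFDerivWithin_le hf'B
        (fun a ha => (hf a (hBT ha)).2.2.1) hqB hq'B
    have e4 : |extGrad Ω t₀ h ρ η q'.1 q'.2 v - extGrad Ω t₀ h ρ η t x v| ≤
        C * ‖q' - (t, x)‖ * ‖v‖ := by
      have e := (extDeriv Ω t₀ h ρ η q' - extDeriv Ω t₀ h ρ η (t, x)).le_opNorm ((0 : ℝ), v)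
      rw [hnv] at e
      rw [hgr q', hgr (t, x)]
      exact e.trans (mul_le_mul_of_nonneg_right e3 (norm_nonneg v))
    have e5 : (q'.1, q'.2 + v) - (t, x + v) = q' - (t, x) := by
      ext <;> simp
    rw [e5] at e1
    simp only at e1 e2 ⊢
    have e6 : 2 * C * ‖q' - (t, x)‖ + C * ‖q' - (t, x)‖ * ‖v‖ ≤
        (8 * C / ρ ^ 2 + 2 * C / ρ) * (‖v‖ ^ 2 * ‖q' - (t, x)‖) := by
      have f1 : 1 ≤ 4 / ρ ^ 2 * ‖v‖ ^ 2 := by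
        rw [div_mul_eq_mul_div, le_div_iff₀ (by positivity)]
        nlinarith
      have f2 : ‖v‖ ≤ 2 / ρ * ‖v‖ ^ 2 := by
        rw [div_mul_eq_mul_div, le_div_iff₀ (by positivity)]
        nlinarith [norm_nonneg v]
      have f3 : 0 ≤ C * ‖q' - (t, x)‖ := by positivity
      calc _ = C * ‖q' - (t, x)‖ * (2 * 1 + ‖v‖) := by ring
        _ ≤ C * ‖q' - (t, x)‖ * (2 * (4 / ρ ^ 2 * ‖v‖ ^ 2) + 2 / ρ * ‖v‖ ^ 2) := by gcongr
        _ = _ := by ring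
    have e7 : 0 ≤ C * (‖v‖ ^ 2 * ‖q' - (t, x)‖) := mul_nonneg hC0 hvn
    rw [mul_assoc, add_mul]
    rw [abs_le] at e1 e2 e4 ⊢
    constructor <;> linarith [e1.1, e1.2, e2.1, e2.2, e4.1, e4.2]

end

/-! ### The increments of the extended distance -/

section

variable {n : ℕ} {Ω : ℝ → Set (EuclideanSpace ℝ (Fin n))} {t₀ h ρ : ℝ}
  {η : ℝ → EuclideanSpace ℝ (Fin n) → ℝ}

/-- The Riesz representation of functionals, as a continuous linear map over `ℝ`. -/
def rieszInv (n : ℕ) : (EuclideanSpace ℝ (Fin n) →L[ℝ] ℝ) →L[ℝ] EuclideanSpace ℝ (Fin n) :=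
  LinearMap.mkContinuous
    { toFun := (InnerProductSpace.toDual ℝ (EuclideanSpace ℝ (Fin n))).symm
      map_add' := map_add _
      map_smul' := fun c f => by simp } 1 (fun f => by simp)

theorem rieszInv_apply (f : EuclideanSpace ℝ (Fin n) →L[ℝ] ℝ) :
    rieszInv n f = (InnerProductSpace.toDual ℝ (EuclideanSpace ℝ (Fin n))).symm f := rfl

theorem norm_rieszInv_apply (f : EuclideanSpace ℝ (Fin n) →L[ℝ] ℝ) : ‖rieszInv n f‖ = ‖f‖ := by
  rw [rieszInv_apply, LinearIsometryEquiv.norm_map]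

theorem inner_rieszInv (f : EuclideanSpace ℝ (Fin n) →L[ℝ] ℝ) (v : EuclideanSpace ℝ (Fin n)) :
    inner ℝ (rieszInv n f) v = f v := by
  rw [rieszInv_apply, InnerProductSpace.toDual_symm_apply]

/-- A Lipschitz bound within a space-time slab bounds the derivative, also at the ends of the time
interval. -/
theorem norm_le_of_lipschitz_slab (hh : 0 < h) {f : ℝ × EuclideanSpace ℝ (Fin n) → ℝ}
    {f' : ℝ × EuclideanSpace ℝ (Fin n) →L[ℝ] ℝ} {q : ℝ × EuclideanSpace ℝ (Fin n)} {c : ℝ}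
    (hc : 0 ≤ c) (hq : q.1 ∈ Icc t₀ (t₀ + h))
    (hf : HasFDerivWithinAt f f' (Icc t₀ (t₀ + h) ×ˢ univ) q)
    (hlip : ∀ᶠ q' in 𝓝[Icc t₀ (t₀ + h) ×ˢ univ] q, |f q' - f q| ≤ c * ‖q' - q‖) : ‖f'‖ ≤ c := by
  have key : ∀ w : ℝ × EuclideanSpace ℝ (Fin n),
      (∀ᶠ τ in 𝓝[>] (0 : ℝ), q.1 + τ * w.1 ∈ Icc t₀ (t₀ + h)) → |f' w| ≤ c * ‖w‖ := by
    intro w hw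
    have hmaps : Tendsto (fun τ : ℝ => q + τ • w) (𝓝[>] 0) (𝓝[Icc t₀ (t₀ + h) ×ˢ univ] q) := by
      refine tendsto_nhdsWithin_iff.mpr ⟨?_, ?_⟩
      · have : Tendsto (fun τ : ℝ => q + τ • w) (𝓝 0) (𝓝 (q + (0 : ℝ) • w)) :=
          Continuous.tendsto (by fun_prop) 0
        rw [zero_smul, add_zero] at this
        exact this.mono_left nhdsWithin_le_nhds
      · filter_upwards [hw] with τ hτ
        exact ⟨by simpa using hτ, mem_univ _⟩
    have ho := (hasFDerivWithinAt_iff_isLittleO.mp hf).comp_tendsto hmaps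
    refine le_of_forall_pos_le_add fun e he => ?_
    have h0 : 0 < e / (‖w‖ + 1) := by positivity
    obtain ⟨τ, h1, h2, h3⟩ := ((ho.def h0).and ((hmaps.eventually hlip).and
      self_mem_nhdsWithin)).exists
    have h3 : 0 < τ := h3
    simp only [Function.comp, add_sub_cancel_left, map_smul, norm_smul, Real.norm_eq_abs,
      abs_of_pos h3, smul_eq_mul] at h1 h2
    have h4 : τ * |f' w| ≤ τ * (c * ‖w‖ + e) := by
      have h5 := abs_add_le (f (q + τ • w) - f q) (-(f (q + τ • w) - f q - τ * f' w))
      have h6 : f (q + τ • w) - f q + -(f (q + τ • w) - f q - τ * f' w) = τ * f' w := by ring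
      rw [h6, abs_neg, abs_mul, abs_of_pos h3] at h5
      have h7 : e / (‖w‖ + 1) * ‖w‖ ≤ e := by
        rw [div_mul_eq_mul_div, div_le_iff₀ (by positivity)]
        nlinarith [norm_nonneg w]
      nlinarith
    exact le_of_mul_le_mul_left h4 h3
  have hsmall : ∀ w : ℝ × EuclideanSpace ℝ (Fin n), (q.1 < t₀ + h ∧ 0 ≤ w.1 ∨ t₀ < q.1 ∧ w.1 ≤ 0) →
      |f' w| ≤ c * ‖w‖ := by
    intro w hw
    refine key w ?_
    have hc : Tendsto (fun τ : ℝ => q.1 + τ * w.1) (𝓝[>] 0) (𝓝 q.1) := by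
      have : Tendsto (fun τ : ℝ => q.1 + τ * w.1) (𝓝 0) (𝓝 (q.1 + 0 * w.1)) :=
        Continuous.tendsto (by fun_prop) 0
      rw [zero_mul, add_zero] at this
      exact this.mono_left nhdsWithin_le_nhds
    rcases hw with ⟨h1, h2⟩ | ⟨h1, h2⟩
    · filter_upwards [hc.eventually (gt_mem_nhds h1), self_mem_nhdsWithin] with τ h3 h4
      exact ⟨hq.1.trans (le_add_of_nonneg_right (mul_nonneg (le_of_lt h4) h2)), h3.le⟩
    · filter_upwards [hc.eventually (lt_mem_nhds h1), self_mem_nhdsWithin] with τ h3 h4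
      exact ⟨h3.le, (add_le_of_nonpos_right (mul_nonpos_of_nonneg_of_nonpos (le_of_lt h4) h2)).trans
        hq.2⟩
  refine f'.opNorm_le_bound hc fun w => ?_
  rcases lt_or_ge q.1 (t₀ + h) with h1 | h1
  · rcases le_total 0 w.1 with h2 | h2
    · exact hsmall w (Or.inl ⟨h1, h2⟩)
    · have := hsmall (-w) (Or.inl ⟨h1, by simpa using h2⟩)
      simpa using this
  · have h1 : t₀ < q.1 := by linarith
    rcases le_total w.1 0 with h2 | h2
    · exact hsmall w (Or.inr ⟨h1, h2⟩)
    · have := hsmall (-w) (Or.inr ⟨h1, by simpa using h2⟩)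
      simpa using this

/-- The rescaled increments of the extended distance. -/
def extIncr (Ω : ℝ → Set (EuclideanSpace ℝ (Fin n))) (ρ : ℝ)
    (η : ℝ → EuclideanSpace ℝ (Fin n) → ℝ) (ε : ℝ) (q : ℝ × EuclideanSpace ℝ (Fin n))
    (z : EuclideanSpace ℝ (Fin n)) : ℝ :=
  (extDist Ω ρ η q.1 (q.2 + ε • z) - extDist Ω ρ η q.1 q.2) / ε

theorem IsCutoff.gradient_extDist (hη : IsCutoff Ω t₀ h ρ η)
    (hΩ : IsSmoothFront Ω t₀ h ρ) (hn : n ≠ 0) (hρ : 0 < ρ) {t : ℝ} (ht : t ∈ Icc t₀ (t₀ + h))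
    (x : EuclideanSpace ℝ (Fin n)) :
    gradient (extDist Ω ρ η t) x = rieszInv n (extGrad Ω t₀ h ρ η t x) := by
  rw [gradient, (hη.hasFDerivAt_extDist hΩ hn hρ ht x).fderiv, rieszInv_apply]

theorem IsCutoff.measurable_extDeriv (hη : IsCutoff Ω t₀ h ρ η)
    (hΩ : IsSmoothFront Ω t₀ h ρ) (hn : n ≠ 0) (hh : 0 < h) (hρ : 0 < ρ) {t : ℝ}
    (ht : t ∈ Icc t₀ (t₀ + h)) : Measurable fun x => extDeriv Ω t₀ h ρ η (t, x) := by
  obtain ⟨C, -, -, f'', f''', hf⟩ := hη.exists_bound_extDeriv hΩ hn hh hρ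
  set s : Set (EuclideanSpace ℝ (Fin n)) := {x | (t, x) ∈ openTube Ω t₀ h ρ} with hs
  have hso : IsOpen s := by
    have : s = {x | |signedDist Ω t x| < 2 * ρ} := by
      ext x
      exact ⟨fun hx => hx.2, fun hx => ⟨ht, hx⟩⟩
    rw [this]
    exact isOpen_lt (continuous_signedDist Ω t).abs continuous_const
  have hc : ContinuousOn (fun x => extDeriv Ω t₀ h ρ η (t, x)) s := fun x hx =>
    (hasFDerivAt_slice (hf (t, x) hx).1 ht).continuousAt.continuousWithinAt
  classical
  have hm := hc.measurable_piecewise (continuousOn_const (c := 0)) hso.measurableSet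
  convert hm using 1
  ext1 x
  by_cases hx : x ∈ s
  · rw [piecewise_eq_of_mem _ _ _ hx]
  · rw [piecewise_eq_of_notMem _ _ _ hx]
    exact hη.extDeriv_eq_zero hΩ hn hh hρ ⟨ht, mem_univ _⟩ hx

set_option maxSynthPendingDepth 3 in
/-- The rescaled increments of the extended distance form a family of increments in the sense of
`IsIncrementFamily` near the front, and they satisfy the bounds of `IsIncrement` everywhere. -/
theorem IsCutoff.exists_isIncrementFamily (hη : IsCutoff Ω t₀ h ρ η)
    (hΩ : IsSmoothFront Ω t₀ h ρ) (hn : n ≠ 0) (hh : 0 < h) (hρ : 0 < ρ) :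
    ∃ K : ℝ, 1 ≤ K ∧ (∀ ε : ℝ, 0 < ε → ∀ q : ℝ × EuclideanSpace ℝ (Fin n),
        q.1 ∈ Icc t₀ (t₀ + h) →
        IsIncrement (extIncr Ω ρ η ε q) (gradient (extDist Ω ρ η q.1) q.2) (K * ε) ∧
        ‖gradient (extDist Ω ρ η q.1) q.2‖ ≤ K ∧ ∀ z, |extIncr Ω ρ η ε q z| ≤ K * ‖z‖) ∧
      ∀ ε : ℝ, 0 < ε → ∀ q ∈ tube Ω t₀ h ρ, 1 ≤ ‖gradient (extDist Ω ρ η q.1) q.2‖ ∧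
        ∃ D' p', IsIncrementFamily (Icc t₀ (t₀ + h) ×ˢ univ) q (extIncr Ω ρ η ε)
          (fun q => gradient (extDist Ω ρ η q.1) q.2) D' p' (K * ε) K := by
  obtain ⟨C, hC0, hC1, f'', f''', hf⟩ := hη.exists_bound_extDeriv hΩ hn hh hρ
  obtain ⟨K₁, hK₁0, hK₁⟩ := hη.exists_extGrad_lipschitz hΩ hn hh hρ
  obtain ⟨K₂, hK₂0, hK₂⟩ := hη.exists_remainder_lipschitz hΩ hn hh hρ
  set K : ℝ := C + K₁ + K₂ + 1 with hK
  have hK0 : 0 ≤ K := by positivity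
  have hgr := fun {t : ℝ} (ht : t ∈ Icc t₀ (t₀ + h)) x => hη.gradient_extDist hΩ hn hρ ht x
  have hgn : ∀ t ∈ Icc t₀ (t₀ + h), ∀ x, ‖gradient (extDist Ω ρ η t) x‖ =
      ‖extGrad Ω t₀ h ρ η t x‖ := fun t ht x => by rw [hgr ht, norm_rieszInv_apply]
  have hPC : ∀ t ∈ Icc t₀ (t₀ + h), ∀ x, ‖extGrad Ω t₀ h ρ η t x‖ ≤ C := fun t ht x =>
    (norm_comp_inr_le _).trans (hC1 (t, x) ⟨ht, mem_univ _⟩)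
  have hdc : ∀ t ∈ Icc t₀ (t₀ + h), Continuous (extDist Ω ρ η t) := fun t ht =>
    continuous_iff_continuousAt.mpr fun x => (hη.hasFDerivAt_extDist hΩ hn hρ ht x).continuousAt
  -- the error of the increment is the rescaled Taylor remainder
  have hrem : ∀ ε : ℝ, 0 < ε → ∀ q : ℝ × EuclideanSpace ℝ (Fin n), q.1 ∈ Icc t₀ (t₀ + h) →
      ∀ z, extIncr Ω ρ η ε q z - inner ℝ (gradient (extDist Ω ρ η q.1) q.2) z =
        (extDist Ω ρ η q.1 (q.2 + ε • z) - extDist Ω ρ η q.1 q.2 -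
          extGrad Ω t₀ h ρ η q.1 q.2 (ε • z)) / ε := by
    intro ε hε q hq z
    rw [hgr hq, inner_rieszInv, map_smul, smul_eq_mul, extIncr]
    field_simp
  have hincr : ∀ ε : ℝ, 0 < ε → ∀ q : ℝ × EuclideanSpace ℝ (Fin n), q.1 ∈ Icc t₀ (t₀ + h) →
      IsIncrement (extIncr Ω ρ η ε q) (gradient (extDist Ω ρ η q.1) q.2) (K * ε) := by
    intro ε hε q hq
    refine ⟨?_, by positivity, fun z => ?_⟩
    · have := hdc q.1 hq
      unfold extIncr
      exact Continuous.measurable (by fun_prop)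
    · rw [hrem ε hε q hq, abs_div, abs_of_pos hε, div_le_iff₀ hε]
      refine (abs_sub_sub_le_sq (fun y => hη.hasFDerivAt_extDist hΩ hn hρ hq y)
        (hK₁ q.1 hq) hK₁0 q.2 (ε • z)).trans ?_
      rw [norm_smul, Real.norm_of_nonneg hε.le]
      calc _ = K₁ * (ε ^ 2 * ‖z‖ ^ 2) := by ring
        _ ≤ K * (ε ^ 2 * ‖z‖ ^ 2) :=
            mul_le_mul_of_nonneg_right (by rw [hK]; linarith) (by positivity)
        _ = _ := by ring
  refine ⟨K, by rw [hK]; linarith, fun ε hε q hq => ⟨hincr ε hε q hq, ?_, fun z => ?_⟩,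
    fun ε hε q hq => ?_⟩
  · rw [hgn q.1 hq]
    exact (hPC q.1 hq q.2).trans (by rw [hK]; linarith)
  · have h1 := hη.abs_extDist_sub_le hΩ hn hρ hC1 (q := q) (q' := (q.1, q.2 + ε • z)) hq hq
    have h2 : ‖(q.1, q.2 + ε • z) - q‖ = ε * ‖z‖ := by
      have : (q.1, q.2 + ε • z) - q = ((0 : ℝ), ε • z) := by ext <;> simp
      rw [this, Prod.norm_mk, norm_zero, norm_smul, Real.norm_of_nonneg hε.le]
      exact max_eq_right (by positivity)
    rw [h2] at h1
    rw [extIncr, abs_div, abs_of_pos hε, div_le_iff₀ hε]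
    refine h1.trans ?_
    have : C * (ε * ‖z‖) ≤ K * (ε * ‖z‖) :=
      mul_le_mul_of_nonneg_right (by rw [hK]; linarith) (by positivity)
    linarith
  have hqI : q.1 ∈ Icc t₀ (t₀ + h) := hq.1
  have hqX : q ∈ Icc t₀ (t₀ + h) ×ˢ (univ : Set (EuclideanSpace ℝ (Fin n))) := ⟨hqI, mem_univ _⟩
  have hqT : q ∈ openTube Ω t₀ h ρ := ⟨hqI, by
    have : |signedDist Ω q.1 q.2| ≤ ρ := hq.2
    linarith⟩
  have hmem : ∀ᶠ p in 𝓝[Icc t₀ (t₀ + h) ×ˢ univ] q,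
      p ∈ Icc t₀ (t₀ + h) ×ˢ (univ : Set (EuclideanSpace ℝ (Fin n))) :=
    eventually_mem_nhdsWithin
  -- the derivative of the gradient
  set Φ : (ℝ × EuclideanSpace ℝ (Fin n) →L[ℝ] ℝ) →L[ℝ] EuclideanSpace ℝ (Fin n) :=
    (rieszInv n).comp ((ContinuousLinearMap.compL ℝ (EuclideanSpace ℝ (Fin n))
      (ℝ × EuclideanSpace ℝ (Fin n)) ℝ).flip
        (ContinuousLinearMap.inr ℝ ℝ (EuclideanSpace ℝ (Fin n)))) with hΦ
  have hΦa : ∀ L, Φ L = rieszInv n (L.comp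
      (ContinuousLinearMap.inr ℝ ℝ (EuclideanSpace ℝ (Fin n)))) := fun L => rfl
  have hΦn : ∀ L, ‖Φ L‖ ≤ ‖L‖ := fun L => by
    rw [hΦa, norm_rieszInv_apply]
    exact norm_comp_inr_le L
  have hgΦ : ∀ p : ℝ × EuclideanSpace ℝ (Fin n), p.1 ∈ Icc t₀ (t₀ + h) →
      gradient (extDist Ω ρ η p.1) p.2 = Φ (extDeriv Ω t₀ h ρ η p) := fun p hp => by
    rw [hgr hp, hΦa]; rfl
  have hgd : HasFDerivWithinAt (fun q => gradient (extDist Ω ρ η q.1) q.2) (Φ.comp (f'' q))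
      (Icc t₀ (t₀ + h) ×ˢ univ) q := by
    have h1 := Φ.hasFDerivAt.comp_hasFDerivWithinAt q (hf q hqT).1
    exact h1.congr (fun p hp => hgΦ p hp.1) (hgΦ q hqI)
  have hDd : ∀ z, HasFDerivWithinAt (fun p => extIncr Ω ρ η ε p z)
      (ε⁻¹ • (extDeriv Ω t₀ h ρ η (q.1, q.2 + ε • z) - extDeriv Ω t₀ h ρ η q))
      (Icc t₀ (t₀ + h) ×ˢ univ) q := by
    intro z
    have h1 := hη.hasFDerivWithinAt_extDist hΩ hn hρ (q := (q.1, q.2 + ε • z))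
      ⟨hqI, mem_univ _⟩
    have h2 : HasFDerivWithinAt (fun p : ℝ × EuclideanSpace ℝ (Fin n) => (p.1, p.2 + ε • z))
        (ContinuousLinearMap.id ℝ _) (Icc t₀ (t₀ + h) ×ˢ univ) q :=
      ((hasFDerivWithinAt_id q _).add_const ((0 : ℝ), ε • z)).congr
        (fun p _ => by ext <;> simp) (by ext <;> simp)
    have hmaps : MapsTo (fun p : ℝ × EuclideanSpace ℝ (Fin n) => (p.1, p.2 + ε • z))
        (Icc t₀ (t₀ + h) ×ˢ univ) (Icc t₀ (t₀ + h) ×ˢ univ) := fun p hp => ⟨hp.1, mem_univ _⟩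
    have h3 := HasFDerivWithinAt.comp q h1 h2 hmaps
    rw [ContinuousLinearMap.comp_id] at h3
    have h4 := (h3.sub (hη.hasFDerivWithinAt_extDist hΩ hn hρ hqX)).const_mul ε⁻¹
    refine h4.congr_of_eventuallyEq (Eventually.of_forall fun p => ?_) ?_ <;>
    simp [extIncr, div_eq_inv_mul]
  have hlipR : ∀ᶠ p in 𝓝[Icc t₀ (t₀ + h) ×ˢ univ] q, ∀ z,
      |(extIncr Ω ρ η ε p z - inner ℝ (gradient (extDist Ω ρ η p.1) p.2) z) -
        (extIncr Ω ρ η ε q z - inner ℝ (gradient (extDist Ω ρ η q.1) q.2) z)| ≤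
      K * ε * ‖z‖ ^ 2 * ‖p - q‖ := by
    filter_upwards [hK₂ q hq, hmem] with p hp hpX z
    rw [hrem ε hε p hpX.1, hrem ε hε q hqI, ← sub_div, abs_div, abs_of_pos hε, div_le_iff₀ hε]
    refine (hp (ε • z)).trans ?_
    rw [norm_smul, Real.norm_of_nonneg hε.le]
    calc _ = K₂ * (ε ^ 2 * ‖z‖ ^ 2 * ‖p - q‖) := by ring
      _ ≤ K * (ε ^ 2 * ‖z‖ ^ 2 * ‖p - q‖) :=
          mul_le_mul_of_nonneg_right (by rw [hK]; linarith) (by positivity)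
      _ = _ := by ring
  refine ⟨?_, fun z => ε⁻¹ • (extDeriv Ω t₀ h ρ η (q.1, q.2 + ε • z) - extDeriv Ω t₀ h ρ η q),
    Φ.comp (f'' q), ?_⟩
  · rw [hgn q.1 hqI]
    exact hη.one_le_norm_extGrad hΩ hn hh hρ hq
  refine ⟨hincr ε hε q hqI, ?_, hlipR, ?_, hDd, hgd, ?_, fun z => ?_, ?_⟩
  · filter_upwards [hmem] with p hp using hincr ε hε p hp.1
  · filter_upwards [(hasFDerivWithinAt_iff_isLittleO.mp (hf q hqT).1).def one_pos, hmem]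
      with p hp hpX
    rw [hgΦ p hpX.1, hgΦ q hqI, ← map_sub]
    refine (hΦn _).trans ?_
    have h1 := norm_add_le (extDeriv Ω t₀ h ρ η p - extDeriv Ω t₀ h ρ η q - f'' q (p - q))
      (f'' q (p - q))
    rw [sub_add_cancel] at h1
    have h2 : ‖f'' q (p - q)‖ ≤ C * ‖p - q‖ :=
      ((f'' q).le_opNorm _).trans (mul_le_mul_of_nonneg_right (hf q hqT).2.2.1 (norm_nonneg _))
    have h3 : (C + 1) * ‖p - q‖ ≤ K * ‖p - q‖ :=
      mul_le_mul_of_nonneg_right (by rw [hK]; linarith) (norm_nonneg _)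
    linarith
  · refine Measurable.stronglyMeasurable ?_
    have h1 : Measurable fun z : EuclideanSpace ℝ (Fin n) =>
        extDeriv Ω t₀ h ρ η (q.1, q.2 + ε • z) :=
      (hη.measurable_extDeriv hΩ hn hh hρ hqI).comp (by fun_prop)
    change Measurable (ε⁻¹ • fun z : EuclideanSpace ℝ (Fin n) =>
      extDeriv Ω t₀ h ρ η (q.1, q.2 + ε • z) - extDeriv Ω t₀ h ρ η q)
    exact (h1.sub_const _).const_smul _
  · refine norm_le_of_lipschitz_slab hh (by positivity) hqI
      (f := fun p => extIncr Ω ρ η ε p z - inner ℝ (gradient (extDist Ω ρ η p.1) p.2) z) ?_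
      (hlipR.mono fun p hp => hp z)
    refine (hDd z).sub ?_
    have := (innerSL ℝ z).hasFDerivAt.comp_hasFDerivWithinAt q hgd
    refine this.congr_of_eventuallyEq (Eventually.of_forall fun w => ?_) ?_ <;>
    simp
  · refine ContinuousLinearMap.opNorm_le_bound _ hK0 fun w => ?_
    refine (hΦn _).trans (((f'' q).le_opNorm w).trans ?_)
    refine mul_le_mul_of_nonneg_right ((hf q hqT).2.2.1.trans ?_) (norm_nonneg _)
    rw [hK]; linarith

end

/-! ### Derivatives in time and space, and the final estimates -/

section

variable {n : ℕ}

/-- The integrated kernel difference is of order `ε |ln ε|` where the gradient does not vanish. -/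
theorem IsProfile.abs_integral_kerDiff_le_mul_log {ψ : ℝ → ℝ} {M K γ ε : ℝ}
    {D : EuclideanSpace ℝ (Fin n) → ℝ} {p : EuclideanSpace ℝ (Fin n)} (h : IsProfile ψ M)
    (hK : 0 ≤ K) (hγ : 0 < γ) (hγ1 : γ < 1) (hε : 0 < ε) (hε2 : ε ≤ 1 / 2)
    (hD : IsIncrement D p (K * ε)) (hp : p ≠ 0) (hpK : ‖p‖ ≤ K) (ξ : ℝ) :
    |∫ z in {z | ‖z‖ < γ / ε}, kerDiff ψ D p ξ z| ≤
      (2 * M * K ^ 2 * ((n + 2) * unitBallVol n) +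
        2 ^ (n + 1) * unitBallVol n * M * K * (n + 3)) * ε * |Real.log ε| / ‖p‖ := by
  have hv := unitBallVol_nonneg (n := n)
  have hM := h.nonneg
  have hA : 0 < γ / ε := by positivity
  have hpn : 0 < ‖p‖ := norm_pos_iff.mpr hp
  have hlog2 : 1 ≤ 2 * |Real.log ε| := by
    have h1 : Real.log ε ≤ Real.log (1 / 2) := Real.log_le_log hε hε2
    rw [one_div, Real.log_inv] at h1
    have h2 := Real.log_two_gt_d9
    rw [abs_of_neg (by linarith)]
    linarith
  have hKp : 1 ≤ K / ‖p‖ := (one_le_div hpn).mpr hpK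
  have e1 : M * (K * ε) * ((n + 2) * unitBallVol n) ≤
      2 * M * K ^ 2 * ((n + 2) * unitBallVol n) * ε * |Real.log ε| / ‖p‖ := by
    calc _ = M * (K * ε) * ((n + 2) * unitBallVol n) * 1 * 1 := by ring
      _ ≤ M * (K * ε) * ((n + 2) * unitBallVol n) * (2 * |Real.log ε|) * (K / ‖p‖) := by gcongr
      _ = _ := by ring
  have e2 : 0 ≤ 2 ^ (n + 1) * unitBallVol n * M * K * (n + 3) * ε * |Real.log ε| / ‖p‖ := by
    positivity
  have e3 : (2 * M * K ^ 2 * ((n + 2) * unitBallVol n) +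
        2 ^ (n + 1) * unitBallVol n * M * K * (n + 3)) * ε * |Real.log ε| / ‖p‖ =
      2 * M * K ^ 2 * ((n + 2) * unitBallVol n) * ε * |Real.log ε| / ‖p‖ +
      2 ^ (n + 1) * unitBallVol n * M * K * (n + 3) * ε * |Real.log ε| / ‖p‖ := by ring
  rw [e3]
  rcases le_total 1 (γ / ε) with hA1 | hA1
  · refine (h.abs_integral_kerDiff_le_log hD hp hA1 ξ).trans (add_le_add e1 ?_)
    have h1 : Real.log (γ / ε) ≤ |Real.log ε| := by
      rw [Real.log_div hγ.ne' hε.ne']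
      have := Real.log_neg hγ hγ1
      have := neg_abs_le (Real.log ε)
      linarith
    calc _ ≤ 2 ^ (n + 1) * unitBallVol n * M * (K * ε) / ‖p‖ *
          (2 * |Real.log ε| + (n + 1) * |Real.log ε|) := by gcongr
      _ = _ := by ring
  · refine (h.abs_integral_kerDiff_le hD hA ξ).trans (le_add_of_le_of_nonneg ?_ e2)
    refine le_trans ?_ e1
    refine mul_le_mul_of_nonneg_left ?_ (by positivity)
    exact mul_le_of_le_one_right (by positivity) hA1

/-- Derivatives of a space-time function in a slab, read off in the time variable. -/
theorem hasDerivWithinAt_time {I : Set ℝ} {f : ℝ × EuclideanSpace ℝ (Fin n) → ℝ}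
    {B : ℝ × EuclideanSpace ℝ (Fin n) →L[ℝ] ℝ} {t : ℝ} {x : EuclideanSpace ℝ (Fin n)}
    (hf : HasFDerivWithinAt f B (I ×ˢ univ) (t, x)) :
    HasDerivWithinAt (fun s => f (s, x)) (B (1, 0)) I t := by
  have h1 : HasDerivWithinAt (fun s : ℝ => (s, x)) ((1 : ℝ), (0 : EuclideanSpace ℝ (Fin n))) I t :=
    (hasDerivWithinAt_id t I).prodMk (hasDerivWithinAt_const t I x)
  have hmaps : MapsTo (fun s : ℝ => (s, x)) I (I ×ˢ univ) := fun s hs => ⟨hs, mem_univ _⟩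
  exact HasFDerivWithinAt.comp_hasDerivWithinAt t hf h1 hmaps

theorem slab_derivatives_le {t₀ h : ℝ} (hh : 0 < h) {f : ℝ × EuclideanSpace ℝ (Fin n) → ℝ}
    {B : ℝ × EuclideanSpace ℝ (Fin n) →L[ℝ] ℝ} {t c : ℝ} {x : EuclideanSpace ℝ (Fin n)}
    (ht : t ∈ Icc t₀ (t₀ + h))
    (hf : HasFDerivWithinAt f B (Icc t₀ (t₀ + h) ×ˢ univ) (t, x)) (hB : ‖B‖ ≤ c) :
    (DifferentiableWithinAt ℝ (fun s => f (s, x)) (Icc t₀ (t₀ + h)) t ∧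
      |derivWithin (fun s => f (s, x)) (Icc t₀ (t₀ + h)) t| ≤ c) ∧
    (DifferentiableAt ℝ (fun y => f (t, y)) x ∧ ‖gradient (fun y => f (t, y)) x‖ ≤ c) := by
  have h1 := hasDerivWithinAt_time hf
  have h2 := hasFDerivAt_slice hf ht
  refine ⟨⟨h1.differentiableWithinAt, ?_⟩, h2.differentiableAt, ?_⟩
  · rw [h1.derivWithin (uniqueDiffOn_Icc (by linarith) t ht)]
    refine (B.le_opNorm _).trans ?_
    have : ‖((1 : ℝ), (0 : EuclideanSpace ℝ (Fin n)))‖ = 1 := by simp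
    rw [this, mul_one]
    exact hB
  · rw [gradient, h2.fderiv, LinearIsometryEquiv.norm_map]
    exact (norm_comp_inr_le B).trans hB

end

end Dislocation

end

open Dislocation in
theorem lemma4p6 (n : ℕ) (hn : 2 ≤ n) (W φ : ℝ → ℝ) (hW : IsMultiWell W)
    (hφ : IsLayerSolution n W φ) (t₀ h ρ : ℝ) (hh : 0 < h) (hρ : 0 < ρ)
    (Ω : ℝ → Set (EuclideanSpace ℝ (Fin n))) (hΩ : IsSmoothFront Ω t₀ h ρ)
    (η : ℝ → EuclideanSpace ℝ (Fin n) → ℝ) (hη : IsCutoff Ω t₀ h ρ η)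
    (d : ℝ → EuclideanSpace ℝ (Fin n) → ℝ) (hd : d = extDist Ω ρ η) :
    ∃ C : ℝ, 0 < C ∧ ∀ γ : ℝ, 0 < γ → γ < 1 →
      (∀ ε : ℝ, 0 < ε → ε ≤ 1 / 2 → ∀ t ∈ Icc t₀ (t₀ + h), ∀ x : EuclideanSpace ℝ (Fin n),
        -- the functions `a_ε`, `ā_ε` are given by convergent integrals, and `a_ε` is `C²` in `ξ`
        ((∀ ξ : ℝ, IntegrableOn (aIntegrand φ d ε ξ t x) {z | ‖z‖ < γ / ε}) ∧
          ContDiff ℝ 2 (fun ξ => aEps φ d γ ε ξ t x) ∧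
          Integrable (fun ξ => aEps φ d γ ε ξ t x * deriv φ ξ)) ∧
        -- estimates where the gradient of `d` does not vanish
        (gradient (d t) x ≠ 0 →
          (∀ ξ : ℝ,
            |aEps φ d γ ε ξ t x| ≤ C * ε * |Real.log ε| / ‖gradient (d t) x‖ ∧
            |aEpsDot φ d γ ε ξ t x| ≤ C * ε * |Real.log ε| / ‖gradient (d t) x‖ ∧
            |aEpsDotDot φ d γ ε ξ t x| ≤ C * ε * |Real.log ε| / ‖gradient (d t) x‖) ∧
          |aBar φ d γ ε t x| ≤ C / ‖gradient (d t) x‖) ∧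
        -- estimates on the derivatives near the front
        ((t, x) ∈ tube Ω t₀ h ρ →
          (∀ ξ : ℝ,
            (DifferentiableWithinAt ℝ (fun s => aEps φ d γ ε ξ s x) (Icc t₀ (t₀ + h)) t ∧
              |derivWithin (fun s => aEps φ d γ ε ξ s x) (Icc t₀ (t₀ + h)) t| ≤ C) ∧
            (DifferentiableAt ℝ (fun y => aEps φ d γ ε ξ t y) x ∧
              ‖gradient (fun y => aEps φ d γ ε ξ t y) x‖ ≤ C) ∧
            (DifferentiableAt ℝ (fun y => aEpsDot φ d γ ε ξ t y) x ∧
              ‖gradient (fun y => aEpsDot φ d γ ε ξ t y) x‖ ≤ C)) ∧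
          (DifferentiableWithinAt ℝ (fun s => aBar φ d γ ε s x) (Icc t₀ (t₀ + h)) t ∧
            |derivWithin (fun s => aBar φ d γ ε s x) (Icc t₀ (t₀ + h)) t|
              ≤ C / (ε * |Real.log ε|)) ∧
          (DifferentiableAt ℝ (fun y => aBar φ d γ ε t y) x ∧
            ‖gradient (fun y => aBar φ d γ ε t y) x‖ ≤ C / (ε * |Real.log ε|)))) ∧
      -- decay in `ξ` near the front
      (∃ ε₀ : ℝ, 0 < ε₀ ∧ ∀ ε : ℝ, 0 < ε → ε < ε₀ → ∀ t ∈ Icc t₀ (t₀ + h),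
        ∀ x : EuclideanSpace ℝ (Fin n), (t, x) ∈ tube Ω t₀ h ρ → ∀ ξ : ℝ,
          |aEps φ d γ ε ξ t x| ≤ C * γ / (1 + |ξ|)) := by
  subst hd
  have hn0 : n ≠ 0 := by omega
  obtain ⟨M, hP0, hP1, hP2⟩ := hφ.exists_isProfile hW
  obtain ⟨N, hN0, hN⟩ := hφ.exists_deriv_le hW
  obtain ⟨K, hK1, hincr, hfam⟩ := hη.exists_isIncrementFamily hΩ hn0 hh hρ
  have hM := hP0.nonneg
  have hK0 : 0 ≤ K := zero_le_one.trans hK1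
  have hv := unitBallVol_nonneg (n := n)
  set C₁ : ℝ := 2 * M * K ^ 2 * ((n + 2) * unitBallVol n) +
    2 ^ (n + 1) * unitBallVol n * M * K * (n + 3) with hC₁
  set C₂ : ℝ := M * K * ((n + 2) * unitBallVol n) +
    K * ((n + 1) * (2 ^ (n + 1) * unitBallVol n * M * K)) with hC₂
  set C₃ : ℝ := 2 * (M + N) * K * ((n + 2) * unitBallVol n) +
    4 * K * ((n + 1) * (2 ^ (n + 1) * unitBallVol n * M * K)) with hC₃
  have hC₁0 : 0 ≤ C₁ := by positivity
  have hC₂0 : 0 ≤ C₂ := by positivity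
  have hC₃0 : 0 ≤ C₃ := by positivity
  refine ⟨C₁ + C₂ + C₃ + 1, by positivity, fun γ hγ hγ1 => ⟨fun ε hε hε2 t ht x => ?_, ?_⟩⟩
  · have hA : 0 < γ / ε := by positivity
    have hlog : 0 < |Real.log ε| := abs_pos.mpr (Real.log_neg hε (by linarith)).ne
    obtain ⟨hD, hpK, -⟩ := hincr ε hε (t, x) ht
    have hDt : ∀ y, IsIncrement (extIncr Ω ρ η ε (t, y)) (gradient (extDist Ω ρ η t) y) (K * ε) :=
      fun y => (hincr ε hε (t, y) ht).1
    have hdot : ∀ y, (fun ξ => aEpsDot φ (extDist Ω ρ η) γ ε ξ t y) = fun ξ =>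
        ∫ z in {z | ‖z‖ < γ / ε}, kerDiff (deriv φ) (extIncr Ω ρ η ε (t, y))
          (gradient (extDist Ω ρ η t) y) ξ z := fun y =>
      funext fun ξ => (hP0.hasDerivAt_integral_kerDiff hP1 (hDt y) hA ξ).deriv
    have hdotdot : (fun ξ => aEpsDotDot φ (extDist Ω ρ η) γ ε ξ t x) = fun ξ =>
        ∫ z in {z | ‖z‖ < γ / ε}, kerDiff (deriv (deriv φ)) (extIncr Ω ρ η ε (t, x))
          (gradient (extDist Ω ρ η t) x) ξ z := by
      funext ξ
      rw [aEpsDotDot, hdot x]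
      exact (hP1.hasDerivAt_integral_kerDiff hP2 hD hA ξ).deriv
    refine ⟨⟨fun ξ => hP0.integrableOn_kerDiff hD hA ξ, ?_, ?_⟩, fun hp => ?_, fun htube => ?_⟩
    · have hdiff : Differentiable ℝ fun ξ => aEps φ (extDist Ω ρ η) γ ε ξ t x := fun ξ =>
        (hP0.hasDerivAt_integral_kerDiff hP1 hD hA ξ).differentiableAt
      have h2 : ContDiff ℝ 1 (deriv fun ξ => aEps φ (extDist Ω ρ η) γ ε ξ t x) := by
        change ContDiff ℝ 1 (fun ξ => aEpsDot φ (extDist Ω ρ η) γ ε ξ t x)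
        rw [contDiff_one_iff_deriv]
        refine ⟨?_, ?_⟩
        · rw [hdot x]
          exact fun ξ => (hP1.hasDerivAt_integral_kerDiff hP2 hD hA ξ).differentiableAt
        · change Continuous (fun ξ => aEpsDotDot φ (extDist Ω ρ η) γ ε ξ t x)
          rw [hdotdot]
          exact hP2.continuous_integral_kerDiff hD hA
      exact (contDiff_succ_iff_deriv (n := 1)).mpr ⟨hdiff, by simp, h2⟩
    · exact hφ.integrable_deriv.bdd_mul
        (hP0.continuous_integral_kerDiff hD hA).aestronglyMeasurable
        (Eventually.of_forall fun ξ => hP0.abs_integral_kerDiff_le hD hA ξ)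
    · have hpn : 0 < ‖gradient (extDist Ω ρ η t) x‖ := norm_pos_iff.mpr hp
      have hle : C₁ * ε * |Real.log ε| / ‖gradient (extDist Ω ρ η t) x‖ ≤
          (C₁ + C₂ + C₃ + 1) * ε * |Real.log ε| / ‖gradient (extDist Ω ρ η t) x‖ := by
        gcongr
        linarith
      have hest : ∀ {ψ : ℝ → ℝ}, IsProfile ψ M → ∀ ξ,
          |∫ z in {z | ‖z‖ < γ / ε}, kerDiff ψ (extIncr Ω ρ η ε (t, x))
            (gradient (extDist Ω ρ η t) x) ξ z| ≤
          C₁ * ε * |Real.log ε| / ‖gradient (extDist Ω ρ η t) x‖ := fun hψ ξ =>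
        hψ.abs_integral_kerDiff_le_mul_log hK0 hγ hγ1 hε hε2 hD hp hpK ξ
      refine ⟨fun ξ => ⟨(hest hP0 ξ).trans hle, ?_, ?_⟩, ?_⟩
      · rw [congrFun (hdot x) ξ]
        exact (hest hP1 ξ).trans hle
      · rw [congrFun hdotdot ξ]
        exact (hest hP2 ξ).trans hle
      · have h1 := norm_integral_le_of_norm_le
          (hφ.integrable_deriv.const_mul
            (C₁ * ε * |Real.log ε| / ‖gradient (extDist Ω ρ η t) x‖))
          (f := fun ξ => aEps φ (extDist Ω ρ η) γ ε ξ t x * deriv φ ξ)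
          (Eventually.of_forall fun ξ => by
            rw [norm_mul, Real.norm_of_nonneg (hφ.deriv_pos ξ).le]
            exact mul_le_mul_of_nonneg_right (hest hP0 ξ) (hφ.deriv_pos ξ).le)
        rw [integral_const_mul, hφ.integral_deriv, mul_one, Real.norm_eq_abs] at h1
        rw [aBar, abs_mul, abs_of_pos (show 0 < 1 / (ε * |Real.log ε|) by positivity)]
        calc _ ≤ 1 / (ε * |Real.log ε|) *
              (C₁ * ε * |Real.log ε| / ‖gradient (extDist Ω ρ η t) x‖) := by gcongr
          _ = C₁ / ‖gradient (extDist Ω ρ η t) x‖ := by field_simp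
          _ ≤ _ := by gcongr; linarith
    · obtain ⟨hp1, D', p', hF⟩ := hfam ε hε (t, x) htube
      have hp0 : gradient (extDist Ω ρ η t) x ≠ 0 := by
        intro h0
        simp only [h0, norm_zero] at hp1
        linarith
      have hpn : 0 < ‖gradient (extDist Ω ρ η t) x‖ := norm_pos_iff.mpr hp0
      have hbd : M * (K * ε) * ((n + 2) * unitBallVol n * (γ / ε)) +
          K * ((n + 1) * (2 ^ (n + 1) * unitBallVol n * M * (K * ε) /
            ‖gradient (extDist Ω ρ η t) x‖) * (γ / ε)) ≤ C₂ := by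
        have e1 : M * (K * ε) * ((n + 2) * unitBallVol n * (γ / ε)) =
            M * K * ((n + 2) * unitBallVol n) * γ := by field_simp
        have e2 : K * ((n + 1) * (2 ^ (n + 1) * unitBallVol n * M * (K * ε) /
            ‖gradient (extDist Ω ρ η t) x‖) * (γ / ε)) =
            K * ((n + 1) * (2 ^ (n + 1) * unitBallVol n * M * K)) *
              (γ / ‖gradient (extDist Ω ρ η t) x‖) := by field_simp
        have e3 : γ / ‖gradient (extDist Ω ρ η t) x‖ ≤ 1 := by
          rw [div_le_one hpn]
          exact hγ1.le.trans hp1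
        rw [e1, e2, hC₂]
        exact add_le_add (mul_le_of_le_one_right (by positivity) hγ1.le)
          (mul_le_of_le_one_right (by positivity) e3)
      have hC₂C : C₂ ≤ C₁ + C₂ + C₃ + 1 := by linarith
      refine ⟨fun ξ => ?_, ?_⟩
      · have h1 := hF.hasFDerivWithinAt_integral_kerDiff hP0 hP1 hn0 hp0 hA ξ
        have h2 := hF.hasFDerivWithinAt_integral_kerDiff hP1 hP2 hn0 hp0 hA ξ
        have s1 := slab_derivatives_le hh ht h1.1 ((h1.2.trans hbd).trans hC₂C)
        have s2 := slab_derivatives_le hh ht h2.1 ((h2.2.trans hbd).trans hC₂C)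
        have hdy : (fun y => aEpsDot φ (extDist Ω ρ η) γ ε ξ t y) = fun y =>
            ∫ z in {z | ‖z‖ < γ / ε}, kerDiff (deriv φ) (extIncr Ω ρ η ε (t, y))
              (gradient (extDist Ω ρ η t) y) ξ z := funext fun y => congrFun (hdot y) ξ
        rw [hdy]
        exact ⟨s1.1, s1.2, s2.2⟩
      · obtain ⟨B, hB, hBn⟩ := hF.hasFDerivWithinAt_average hP0 hP1 hn0 hp0 hA
          hφ.integrable_deriv (fun ξ => (hφ.deriv_pos ξ).le)
        rw [hφ.integral_deriv, mul_one] at hBn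
        have hB2 := hB.const_mul (1 / (ε * |Real.log ε|))
        have hB3 : ‖(1 / (ε * |Real.log ε|)) • B‖ ≤
            (C₁ + C₂ + C₃ + 1) / (ε * |Real.log ε|) := by
          rw [norm_smul, Real.norm_of_nonneg (by positivity), div_mul_eq_mul_div, one_mul]
          gcongr
          exact (hBn.trans hbd).trans hC₂C
        exact slab_derivatives_le hh ht hB2 hB3
  · refine ⟨1, one_pos, fun ε hε _ t ht x htube ξ => ?_⟩
    have hA : 0 < γ / ε := by positivity
    obtain ⟨hD, hpK, hDK⟩ := hincr ε hε (t, x) ht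
    have hp1 := (hfam ε hε (t, x) htube).1
    have hp0 : gradient (extDist Ω ρ η t) x ≠ 0 := by
      intro h0
      simp only [h0, norm_zero] at hp1
      linarith
    have hpn : 0 < ‖gradient (extDist Ω ρ η t) x‖ := norm_pos_iff.mpr hp0
    have hmain := hP0.abs_integral_kerDiff_le_decay hD hn0 hp0 hA hN0
      (fun x => by rw [abs_of_pos (hφ.deriv_pos x)]; exact hN x) hK1 hpK hDK ξ
    refine hmain.trans (div_le_div_of_nonneg_right ?_ (by positivity))
    have e1 : 2 * (M + N) * (K * ε) * ((n + 2) * unitBallVol n * (γ / ε)) =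
        2 * (M + N) * K * ((n + 2) * unitBallVol n) * γ := by field_simp
    have e2 : 4 * K * ((n + 1) * (2 ^ (n + 1) * unitBallVol n * M * (K * ε) /
        ‖gradient (extDist Ω ρ η t) x‖) * (γ / ε)) =
        4 * K * ((n + 1) * (2 ^ (n + 1) * unitBallVol n * M * K)) * γ *
          (1 / ‖gradient (extDist Ω ρ η t) x‖) := by field_simp
    have e3 : 1 / ‖gradient (extDist Ω ρ η t) x‖ ≤ 1 := by
      rw [div_le_one hpn]
      exact hp1
    calc _ ≤ 2 * (M + N) * K * ((n + 2) * unitBallVol n) * γ +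
          4 * K * ((n + 1) * (2 ^ (n + 1) * unitBallVol n * M * K)) * γ := by
          rw [e1, e2]
          exact add_le_add le_rfl (mul_le_of_le_one_right (by positivity) e3)
      _ = C₃ * γ := by rw [hC₃]; ring
      _ ≤ _ := by gcongr; linarith
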